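/- Let $N\ge 1$, $p=p_F:=1+\frac2N$, $A\ge \frac{2}{p-1}=N$ and $\phi(x)=(1+|x|)^{-A}$ on $\mathbf R^N$. For $0<\alpha<1$ consider the time-fractional Cauchy problem $$\partial_t^\alpha u-\Delta u=u^p\ \text{ in }(0,T)\times\mathbf R^N,\qquad u(0)=\mu ,$$ where $\partial_t^\alpha$ is the Caputo derivative and $\mu$ is a nonnegative Radon measure. A solution in $[0,T]\times\mathbf R^N$ is a nonnegative measurable $u$ with $$\infty>u(t,x)=[P_\alpha(t)\mu](x)+\alpha\int_0^t(t-s)^{\alpha-1}[S_\alpha(t-s)u(s)^p](x)\,ds\quad\text{for a.a. }t\in(0,T],\ x\in\mathbf R^N,$$ where $P_\alpha(t)=\int_0^\infty h_\alpha(\theta)e^{t^\alpha\theta\Delta}\,d\theta$, $S_\alpha(t)=\int_0^\infty\theta h_\alpha(\theta)e^{t^\alpha\theta\Delta}\,d\theta$, $e^{t\Delta}$ is the heat semigroup on $\mathbf R^N$, and $h_\alpha(\theta)=\sum_{n\ge0}\frac{(-\theta)^n}{n!\,\Gamma(1-\alpha-\alpha n)}$ is the probability density on $(0,\infty)$ with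 $\int_0^\infty h_\alpha(\theta)e^{z\theta}d\theta=\sum_{k\ge0}\frac{z^k}{\Gamma(\alpha k+1)}$. The minimal solution is the solution that is a.e. bounded above by every other solution in $[0,T]\times\mathbf R^N$, and the life span $T_\alpha[\mu]\in[0,\infty]$ is the supremum of all $T>0$ such that the minimal solution exists in $[0,T]\times\mathbf R^N$. (i) Let $A>N$. Then for each $\alpha\in(0,1)$ there is $K(\alpha)>0$ such that $T_\alpha[\kappa\phi]=\infty$ whenever $0<\kappa<K(\alpha)$, while $0<T_\alpha[\kappa\phi]<\infty$ and $$T_\alpha[\kappa\phi]^{\frac{\alpha-1}{2}}\log T_\alpha[\kappa\phi]\le C\kappa^{-(p-1)}$$ whenever $\kappa>K(\alpha)$. Here $C>0$ is independent of $\kappa$ and is uniform in $\alpha$ away from $0$: for every $\alpha_0\in(0,1)$ one $C=C(N,A,\alpha_0)$ serves for all $\alpha\in[\alpha_0,1)$. (ii) Let $A=N$. Then for every $\alpha_0\in(0,1)$ there are $C>0$ and $\kappa_0>0$, depending only on $N$ and $\alpha_0$, such that for all $\alpha\in[\alpha_0,1)$ and all $0<\kappa<\kappa_0$ one has $0<T_\alpha[\kappa\phi]<\infty$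 and $$T_\alpha[\kappa\phi]^{\frac{\alpha-1}{2p}}\log T_\alpha[\kappa\phi]\le C\kappa^{-\frac{p-1}{p}} .$$ -/

import Mathlib

open MeasureTheory
open scoped ENNReal

noncomputable section

namespace TimeFractionalFujita

/-- The Fujita exponent `1 + 2 / N`. -/
def fujitaExponent (N : ℕ) : ℝ := 1 + 2 / (N : ℝ)

/-- The heat kernel `G(t, x) = (4πt)^{-N/2} exp(-|x|² / (4t))` on `ℝ^N`, for `t > 0`. -/
def heatKernel {N : ℕ} (t : ℝ) (x : EuclideanSpace ℝ (Fin N)) : ℝ :=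
  (4 * Real.pi * t) ^ (-((N : ℝ) / 2)) * Real.exp (-‖x‖ ^ 2 / (4 * t))

/-- The heat semigroup `e^{tΔ}μ(x) = ∫ G(t, x - y) dμ(y)` applied to a nonnegative measure `μ`;
the value is in `[0, ∞]`. A nonnegative function `f` is identified with the measure `f dx`,
that is, with `volume.withDensity f`. -/
def heatSemigroup {N : ℕ} (t : ℝ) (μ : Measure (EuclideanSpace ℝ (Fin N)))
    (x : EuclideanSpace ℝ (Fin N)) : ℝ≥0∞ :=
  ∫⁻ y, ENNReal.ofReal (heatKernel t (x - y)) ∂μ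

/-- The M-Wright (Mainardi) function
`h_α(θ) = ∑_{n ≥ 0} (-θ)^n / (n! Γ(1 - α - αn))`, for `0 < α < 1`. It is the positive probability
density on `(0, ∞)` with `∫ h_α(θ) e^{zθ} dθ = E_{α,1}(z)` (Mittag-Leffler function). The
convention `1 / Γ(-k) = 0` for `k = 0, 1, 2, …` used in the series is the one that `Real.Gamma`
obeys. -/
def wrightDensity (α θ : ℝ) : ℝ :=
  ∑' n : ℕ, (-θ) ^ n / ((n.factorial : ℝ) * Real.Gamma (1 - α - α * (n : ℝ)))

/-- `[P_α(t)μ](x) = ∫_0^∞ h_α(θ) [e^{t^α θ Δ}μ](x) dθ`. -/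
def operatorP {N : ℕ} (α t : ℝ) (μ : Measure (EuclideanSpace ℝ (Fin N)))
    (x : EuclideanSpace ℝ (Fin N)) : ℝ≥0∞ :=
  ∫⁻ θ in Set.Ioi (0 : ℝ),
    ENNReal.ofReal (wrightDensity α θ) * heatSemigroup (t ^ α * θ) μ x

/-- `[S_α(t)μ](x) = ∫_0^∞ θ h_α(θ) [e^{t^α θ Δ}μ](x) dθ`. -/
def operatorS {N : ℕ} (α t : ℝ) (μ : Measure (EuclideanSpace ℝ (Fin N)))
    (x : EuclideanSpace ℝ (Fin N)) : ℝ≥0∞ :=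
  ∫⁻ θ in Set.Ioi (0 : ℝ),
    ENNReal.ofReal (θ * wrightDensity α θ) * heatSemigroup (t ^ α * θ) μ x

/-- The right-hand side of the integral equation:
`[P_α(t)μ](x) + α ∫_0^t (t - s)^{α-1} [S_α(t - s) u(s)^p](x) ds`. -/
def mildRHS {N : ℕ} (p α : ℝ) (μ : Measure (EuclideanSpace ℝ (Fin N)))
    (u : ℝ → EuclideanSpace ℝ (Fin N) → ℝ≥0∞) (t : ℝ) (x : EuclideanSpace ℝ (Fin N)) : ℝ≥0∞ :=
  operatorP α t μ x
    + ENNReal.ofReal α * ∫⁻ s in Set.Ioo (0 : ℝ) t,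
        ENNReal.ofReal ((t - s) ^ (α - 1))
          * operatorS α (t - s) (volume.withDensity fun y => u s y ^ p) x

/-- `u` is a (nonnegative, mild) solution of `∂_t^α u - Δu = u^p`, `u(0) = μ`, in
`[0, T] × ℝ^N`: it is measurable, and for almost all `t ∈ (0, T]` and `x` it satisfies
`∞ > u(t, x) = (right-hand side of the integral equation)`. Only the values of `u` on
`(0, T] × ℝ^N` matter. -/
structure IsSolution {N : ℕ} (p α T : ℝ) (μ : Measure (EuclideanSpace ℝ (Fin N)))
    (u : ℝ → EuclideanSpace ℝ (Fin N) → ℝ≥0∞) : Prop where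
  measurable : Measurable fun z : ℝ × EuclideanSpace ℝ (Fin N) => u z.1 z.2
  eq_mildRHS : ∀ᵐ t ∂(volume.restrict (Set.Ioc (0 : ℝ) T)),
    ∀ᵐ x ∂(volume : Measure (EuclideanSpace ℝ (Fin N))),
      u t x < ∞ ∧ u t x = mildRHS p α μ u t x

/-- `u` is the minimal solution in `[0, T] × ℝ^N`: a solution which lies almost everywhere below
every other solution in `[0, T] × ℝ^N`. -/
structure IsMinimalSolution {N : ℕ} (p α T : ℝ) (μ : Measure (EuclideanSpace ℝ (Fin N)))
    (u : ℝ → EuclideanSpace ℝ (Fin N) → ℝ≥0∞) : Prop where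
  isSolution : IsSolution p α T μ u
  le_solution : ∀ v : ℝ → EuclideanSpace ℝ (Fin N) → ℝ≥0∞, IsSolution p α T μ v →
    ∀ᵐ t ∂(volume.restrict (Set.Ioc (0 : ℝ) T)),
      ∀ᵐ x ∂(volume : Measure (EuclideanSpace ℝ (Fin N))), u t x ≤ v t x

/-- The life span `T_α[μ] ∈ [0, ∞]`: the supremum of all `T > 0` such that the minimal solution
exists in `[0, T] × ℝ^N`. -/
def lifeSpan {N : ℕ} (p α : ℝ) (μ : Measure (EuclideanSpace ℝ (Fin N))) : ℝ≥0∞ :=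
  sSup {τ : ℝ≥0∞ | ∃ T : ℝ, 0 < T ∧ τ = ENNReal.ofReal T ∧
    ∃ u : ℝ → EuclideanSpace ℝ (Fin N) → ℝ≥0∞, IsMinimalSolution p α T μ u}

/-- The initial datum `κφ`, `φ(x) = (1 + |x|)^{-A}`, as the measure `κφ dx` on `ℝ^N`. -/
def decayingDatum (N : ℕ) (A κ : ℝ) : Measure (EuclideanSpace ℝ (Fin N)) :=
  volume.withDensity fun x => ENNReal.ofReal (κ * (1 + ‖x‖) ^ (-A))

end TimeFractionalFujita

end

/-!
Turning the Hankel contour of the series of `h_α` onto a ray gives `π h_α` as the imaginary part of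
an absolutely convergent integral, hence the decay of `h_α` and its Mellin transform. Testing `h_α`
against a flat log-normal weight yields a Gaussian average of that transform over the line
`Re s = 1/2`, which depends continuously on `α`, up to `α = 1`, and on the scale of the average, and
is positive at scale `0`. So the moments of the positive part of `h_α` are bounded below uniformly
for `α` in `[α₀, 1)`, and `P_α(t)` and `S_α(t)` keep a fixed share of the mass of
a measure in the parabolic ball `|x| ≤ t^{α/2}`.

The minimal solution is the increasing limit of the Picard iterates, and it exists in `[0, T]` if
and only if this limit is finite almost everywhere there. At the Fujita exponent the estimate
`∫ (e^{τΔ}μ)^p ≤ μ(ℝ^N)^p / τ` is scale invariant. As `α < 1`, the singularity `s^{-α}` which it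
produces in the Duhamel term is integrable, so data of small mass have global solutions.

Conversely, let `g(t)` be the integral of `u(t)^p` over the parabolic ball at time `t`, and let `m`
be the mass of `μ` in the ball at time `T₁`. By Hölder's inequality the integral equation implies
`t^α g(t) ≳ (m + T^{α-1} ∫_{T₁}^t g)^p` for `t` in `[T₁, T]`. This is the integrated form of a
superlinear differential inequality in the variable `log t`, whose blow-up bounds `log (T / T₁)` by
a multiple of `(T / T₁)^{1-α} m^{1-p}`. The power of `T / T₁` is harmless as long as
`log (T / T₁) ≤ 1 / (1 - α)`, so one takes `log (T / T₁) = min (log T / 2) (1 / (1 - α))`. The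
estimates follow, since the mass of `κ (1 + |x|)^{-A}` in a ball of radius `R` is at least a
multiple of `κ`, and of `κ log R` if `A = N`.
-/

noncomputable section

namespace TimeFractionalFujita

open Set Filter Topology

/-! ### The M-Wright function as an integral along a ray -/

lemma norm_cpow_mul_cexp_neg_mul (a z : ℂ) {t : ℝ} (ht : 0 < t) :
    ‖(t : ℂ) ^ a * Complex.exp (-(z * t))‖ = t ^ a.re * Real.exp (-(z.re * t)) := by
  rw [norm_mul, Complex.norm_cpow_eq_rpow_re_of_pos ht, Complex.norm_exp, Complex.neg_re,
    Complex.re_mul_ofReal]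

lemma aestronglyMeasurable_cpow_mul_cexp_neg_mul (a z : ℂ) :
    AEStronglyMeasurable (fun t : ℝ ↦ (t : ℂ) ^ a * Complex.exp (-(z * t)))
      (volume.restrict (Ioi 0)) := by
  refine ContinuousOn.aestronglyMeasurable (fun t ht ↦ ?_) measurableSet_Ioi
  have ht' : (t : ℂ) ∈ Complex.slitPlane := Complex.ofReal_mem_slitPlane.2 ht
  exact (((continuousAt_cpow_const ht').comp Complex.continuous_ofReal.continuousAt).mul
    (by fun_prop)).continuousWithinAt

lemma integrableOn_rpow_mul_exp_neg_mul {s b : ℝ} (hs : -1 < s) (hb : 0 < b) :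
    IntegrableOn (fun t : ℝ ↦ t ^ s * Real.exp (-(b * t))) (Ioi 0) := by
  simpa using integrableOn_rpow_mul_exp_neg_mul_rpow hs one_pos hb

lemma integrableOn_cpow_mul_cexp_neg_mul {a z : ℂ} (ha : 0 < a.re) (hz : 0 < z.re) :
    IntegrableOn (fun t : ℝ ↦ (t : ℂ) ^ (a - 1) * Complex.exp (-(z * t))) (Ioi 0) := by
  have hdom := integrableOn_rpow_mul_exp_neg_mul (s := (a - 1).re) (by simpa using ha) hz
  refine hdom.mono' (aestronglyMeasurable_cpow_mul_cexp_neg_mul _ _) ?_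
  filter_upwards [self_mem_ae_restrict measurableSet_Ioi] with t ht
  rw [norm_cpow_mul_cexp_neg_mul _ _ ht]

lemma differentiableAt_integral_cpow_mul_cexp_neg_mul {a z : ℂ} (ha : 0 < a.re) (hz : 0 < z.re) :
    DifferentiableAt ℂ
      (fun w ↦ ∫ t : ℝ in Ioi 0, (t : ℂ) ^ (a - 1) * Complex.exp (-(w * t))) z := by
  refine (hasDerivAt_integral_of_dominated_loc_of_deriv_le (μ := volume.restrict (Ioi 0))
    (F := fun w (t : ℝ) ↦ (t : ℂ) ^ (a - 1) * Complex.exp (-(w * t)))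
    (F' := fun w (t : ℝ) ↦ (t : ℂ) ^ (a - 1) * Complex.exp (-(w * t)) * (-t))
    (bound := fun t ↦ t ^ a.re * Real.exp (-(z.re / 2 * t)))
    (Metric.ball_mem_nhds z (half_pos hz))
    (.of_forall fun w ↦ aestronglyMeasurable_cpow_mul_cexp_neg_mul _ _)
    (integrableOn_cpow_mul_cexp_neg_mul ha hz)
    ((aestronglyMeasurable_cpow_mul_cexp_neg_mul _ _).mul
      (by fun_prop : Continuous fun t : ℝ ↦ (-t : ℂ)).aestronglyMeasurable)
    ?_ (integrableOn_rpow_mul_exp_neg_mul (by linarith) (half_pos hz)) ?_).2.differentiableAt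
  · filter_upwards [self_mem_ae_restrict measurableSet_Ioi] with t (ht : 0 < t) w hw
    have hre : z.re / 2 ≤ w.re := by
      have h := (Complex.abs_re_le_norm (w - z)).trans (mem_ball_iff_norm.1 hw).le
      linarith [(abs_le.1 h).1, Complex.sub_re w z]
    rw [norm_mul, norm_cpow_mul_cexp_neg_mul _ _ ht, norm_neg, Complex.norm_real,
      Real.norm_of_nonneg ht.le, Complex.sub_re, Complex.one_re, Real.rpow_sub_one ht.ne']
    calc t ^ a.re / t * Real.exp (-(w.re * t)) * t = t ^ a.re * Real.exp (-(w.re * t)) := by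
          field_simp
      _ ≤ t ^ a.re * Real.exp (-(z.re / 2 * t)) := by gcongr
  · filter_upwards with t w _
    have hexp : HasDerivAt (fun w : ℂ ↦ -(w * t)) (-(t : ℂ)) w :=
      (hasDerivAt_mul_const (t : ℂ)).neg
    simpa only [mul_assoc] using hexp.cexp.const_mul ((t : ℂ) ^ (a - 1))

lemma differentiableAt_one_div_cpow_const (a : ℂ) {z : ℂ} (hz : 0 < z.re) :
    DifferentiableAt ℂ (fun w : ℂ ↦ (1 / w) ^ a) z := by
  have hz0 : z ≠ 0 := by rintro rfl; simp at hz
  have hslit : 1 / z ∈ Complex.slitPlane := by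
    rw [one_div]
    exact Or.inl (Complex.inv_re z ▸ div_pos hz (Complex.normSq_pos.2 hz0))
  exact DifferentiableAt.cpow_const (by fun_prop (disch := assumption)) hslit

-- Both sides are analytic in `z`, and for real `z` this is the classical Gamma integral.
lemma integral_cpow_mul_cexp_neg_mul {a z : ℂ} (ha : 0 < a.re) (hz : 0 < z.re) :
    ∫ t : ℝ in Ioi 0, (t : ℂ) ^ (a - 1) * Complex.exp (-(z * t)) =
      (1 / z) ^ a * Complex.Gamma a := by
  have hopen : IsOpen {w : ℂ | 0 < w.re} := isOpen_lt continuous_const Complex.continuous_re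
  have hconn : IsPreconnected {w : ℂ | 0 < w.re} := (convex_halfSpace_re_gt 0).isPreconnected
  have hleft : AnalyticOnNhd ℂ
      (fun w ↦ ∫ t : ℝ in Ioi 0, (t : ℂ) ^ (a - 1) * Complex.exp (-(w * t))) {w | 0 < w.re} :=
    DifferentiableOn.analyticOnNhd (fun w hw ↦
      (differentiableAt_integral_cpow_mul_cexp_neg_mul ha hw).differentiableWithinAt) hopen
  have hright : AnalyticOnNhd ℂ (fun w ↦ (1 / w) ^ a * Complex.Gamma a) {w | 0 < w.re} :=
    DifferentiableOn.analyticOnNhd (fun w hw ↦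
      ((differentiableAt_one_div_cpow_const a hw).mul_const _).differentiableWithinAt) hopen
  have hreal : Tendsto Complex.ofReal (𝓝[>] 1) (𝓝[≠] 1) :=
    Complex.continuous_ofReal.continuousWithinAt.tendsto_nhdsWithin fun x (hx : 1 < x) ↦ by
      simpa using hx.ne'
  refine hleft.eqOn_of_preconnected_of_frequently_eq hright hconn (z₀ := 1) (by simp)
    (hreal.frequently (Eventually.frequently ?_)) hz
  filter_upwards [self_mem_nhdsWithin] with x (hx : 1 < x)
  exact Complex.integral_cpow_mul_exp_neg_mul_Ioi ha (one_pos.trans hx)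

/-- The angle of the ray onto which the contour integral of the M-Wright function is turned. The
choice `πα / (1 + α)` makes both `exp (-z)` and `exp (-θ z ^ α)` decay along the image rays. -/
def rayAngle (α : ℝ) : ℝ := Real.pi * α / (1 + α)

/-- The unit complex number of argument `rayAngle α`. -/
def ray (α : ℝ) : ℂ := Complex.exp (rayAngle α * Complex.I)

/-- The integrand of `rayIntegral`. -/
def rayIntegrand (α θ r : ℝ) : ℂ :=
  ((r ^ (α - 1) : ℝ) : ℂ) * ray α * Complex.exp (-((ray α)⁻¹ * r)) *
    Complex.exp (-(θ * ((r ^ α : ℝ) : ℂ) * ray α))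

/-- The Hankel-type integral of the M-Wright function along a ray; its imaginary part is `π h_α(θ)`
(see `wrightDensity_eq_rayIntegral_im_div_pi`). -/
def rayIntegral (α θ : ℝ) : ℂ := ∫ r in Ioi 0, rayIntegrand α θ r

lemma rayAngle_pos {α : ℝ} (hα₀ : 0 < α) : 0 < rayAngle α := by
  unfold rayAngle; positivity

lemma rayAngle_lt_pi_div_two {α : ℝ} (hα₀ : 0 < α) (hα₁ : α < 1) : rayAngle α < Real.pi / 2 := by
  rw [rayAngle, div_lt_div_iff₀ (by positivity) (by positivity)]
  nlinarith [Real.pi_pos]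

lemma rayAngle_add_rayAngle_mul_self {α : ℝ} (hα₀ : 0 < α) :
    rayAngle α + rayAngle α * α = Real.pi * α := by
  unfold rayAngle; field_simp

lemma re_ray_pos {α : ℝ} (hα₀ : 0 < α) (hα₁ : α < 1) : 0 < (ray α).re := by
  rw [ray, Complex.exp_ofReal_mul_I_re]
  exact Real.cos_pos_of_mem_Ioo
    ⟨by linarith [rayAngle_pos hα₀, Real.pi_pos], rayAngle_lt_pi_div_two hα₀ hα₁⟩

lemma norm_ray (α : ℝ) : ‖ray α‖ = 1 := Complex.norm_exp_ofReal_mul_I _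

lemma ray_ne_zero (α : ℝ) : ray α ≠ 0 := Complex.exp_ne_zero _

lemma inv_ray_re (α : ℝ) : ((ray α)⁻¹).re = (ray α).re := by
  simp [Complex.inv_re, Complex.normSq_eq_norm_sq, norm_ray]

lemma log_ray {α : ℝ} (hα₀ : 0 < α) (hα₁ : α < 1) :
    Complex.log (ray α) = rayAngle α * Complex.I := by
  have hpos := rayAngle_pos hα₀
  have hlt := rayAngle_lt_pi_div_two hα₀ hα₁
  rw [ray, Complex.log_exp] <;> simp <;> linarith [Real.pi_pos]

lemma ray_cpow {α : ℝ} (hα₀ : 0 < α) (hα₁ : α < 1) (z : ℂ) :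
    ray α ^ z = Complex.exp (rayAngle α * Complex.I * z) := by
  rw [Complex.cpow_def_of_ne_zero (ray_ne_zero α), log_ray hα₀ hα₁]

lemma ray_cpow_mul_ray_cpow_mul {α : ℝ} (hα₀ : 0 < α) (hα₁ : α < 1) (z : ℂ) :
    ray α ^ z * ray α ^ (α * z) = Complex.exp (Real.pi * α * z * Complex.I) := by
  rw [ray_cpow hα₀ hα₁, ray_cpow hα₀ hα₁, ← Complex.exp_add, ← Complex.ofReal_mul Real.pi,
    ← rayAngle_add_rayAngle_mul_self hα₀]
  push_cast
  ring_nf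

lemma measurable_uncurry_rayIntegrand (α : ℝ) : Measurable (Function.uncurry (rayIntegrand α)) := by
  simp only [Function.uncurry_def, rayIntegrand]
  fun_prop

lemma norm_rayIntegrand (α θ : ℝ) {r : ℝ} (hr : 0 < r) :
    ‖rayIntegrand α θ r‖ = r ^ (α - 1) * Real.exp (-((ray α).re * r)) *
      Real.exp (-((ray α).re * (θ * r ^ α))) := by
  rw [rayIntegrand, norm_mul, norm_mul, norm_mul, norm_ray, Complex.norm_real, Complex.norm_exp,
    Complex.norm_exp, Real.norm_of_nonneg (by positivity), mul_one, Complex.neg_re,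
    Complex.neg_re, Complex.re_mul_ofReal, inv_ray_re, ← Complex.ofReal_mul,
    Complex.re_ofReal_mul, mul_comm (θ * r ^ α)]

lemma exists_mul_rpow_le_add_mul {α b c : ℝ} (hα₀ : 0 < α) (hα₁ : α < 1) (hb : 0 ≤ b)
    (hc : 0 < c) : ∃ K : ℝ, ∀ r, 0 < r → b * r ^ α ≤ K + c * r := by
  refine ⟨(1 - α) * (b * c ^ (-α)) ^ (1 / (1 - α)), fun r hr ↦ ?_⟩
  have hyoung := Real.geom_mean_le_arith_mean2_weighted hα₀.le (sub_nonneg.2 hα₁.le)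
    (p₁ := c * r) (p₂ := (b * c ^ (-α)) ^ (1 / (1 - α))) (by positivity) (by positivity) (by ring)
  have hgeom : (c * r) ^ α * ((b * c ^ (-α)) ^ (1 / (1 - α))) ^ (1 - α) = b * r ^ α := by
    rw [← Real.rpow_mul (by positivity), one_div_mul_cancel (by linarith), Real.rpow_one,
      Real.mul_rpow hc.le hr.le, Real.rpow_neg hc.le]
    field_simp
  have hle : α * (c * r) ≤ c * r := mul_le_of_le_one_left (by positivity) hα₁.le
  linarith

lemma integrableOn_rpow_mul_exp_mul_exp_rpow {α b c s : ℝ} (hα₀ : 0 < α) (hα₁ : α < 1)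
    (hb : 0 ≤ b) (hc : 0 < c) (hs : -1 < s) :
    IntegrableOn (fun r : ℝ ↦ r ^ s * Real.exp (-(c * r)) * Real.exp (b * r ^ α)) (Ioi 0) := by
  obtain ⟨K, hK⟩ := exists_mul_rpow_le_add_mul hα₀ hα₁ hb (half_pos hc)
  refine ((integrableOn_rpow_mul_exp_neg_mul hs (half_pos hc)).const_mul (Real.exp K)).mono'
    (Measurable.aestronglyMeasurable (by fun_prop)) ?_
  filter_upwards [self_mem_ae_restrict measurableSet_Ioi] with r (hr : 0 < r)
  rw [Real.norm_of_nonneg (by positivity), mul_assoc, ← Real.exp_add, mul_left_comm,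
    ← Real.exp_add]
  refine mul_le_mul_of_nonneg_left (Real.exp_le_exp.2 ?_) (by positivity)
  linarith [hK r hr]

lemma rpow_mul_succ_sub_one (α : ℝ) {r : ℝ} (hr : 0 < r) (n : ℕ) :
    r ^ (α * (n + 1) - 1) = r ^ (α - 1) * (r ^ α) ^ n := by
  rw [← Real.rpow_mul_natCast hr.le, ← Real.rpow_add hr]
  ring_nf

/-- The `n`-th term of the expansion of `rayIntegrand α θ r` in powers of `θ`. -/
def rayIntegrandTerm (α θ : ℝ) (n : ℕ) (r : ℝ) : ℂ :=
  (-(θ : ℂ)) ^ n / (n.factorial : ℂ) * ray α ^ (n + 1) *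
    (((r ^ (α * (n + 1) - 1) : ℝ) : ℂ) * Complex.exp (-((ray α)⁻¹ * r)))

lemma measurable_rayIntegrandTerm (α θ : ℝ) (n : ℕ) : Measurable (rayIntegrandTerm α θ n) := by
  unfold rayIntegrandTerm
  fun_prop

lemma norm_rayIntegrandTerm (α θ : ℝ) (n : ℕ) {r : ℝ} (hr : 0 < r) :
    ‖rayIntegrandTerm α θ n r‖ = |θ| ^ n / (n.factorial : ℝ) *
      (r ^ (α * (n + 1) - 1) * Real.exp (-((ray α).re * r))) := by
  rw [rayIntegrandTerm, norm_mul, norm_mul, norm_mul, norm_pow, norm_ray, one_pow, mul_one,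
    norm_div, norm_pow, norm_neg, Complex.norm_real, Real.norm_eq_abs, Complex.norm_natCast,
    Complex.norm_real, Real.norm_of_nonneg (by positivity), Complex.norm_exp, Complex.neg_re,
    Complex.re_mul_ofReal, inv_ray_re]

lemma hasSum_rayIntegrandTerm (α θ : ℝ) {r : ℝ} (hr : 0 < r) :
    HasSum (fun n ↦ rayIntegrandTerm α θ n r) (rayIntegrand α θ r) := by
  have hexp := (NormedSpace.expSeries_div_hasSum_exp (𝔸 := ℂ)
    (-(θ * ((r ^ α : ℝ) : ℂ) * ray α))).mul_left
      (((r ^ (α - 1) : ℝ) : ℂ) * ray α * Complex.exp (-((ray α)⁻¹ * r)))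
  rw [← Complex.exp_eq_exp_ℂ] at hexp
  convert! hexp using 2 with n
  have hpow : (-(θ * ((r ^ α : ℝ) : ℂ) * ray α)) ^ n =
      (-(θ : ℂ)) ^ n * ((r ^ α : ℝ) : ℂ) ^ n * ray α ^ n := by
    rw [← mul_pow, ← mul_pow]; ring
  rw [rayIntegrandTerm, rpow_mul_succ_sub_one α hr, hpow]
  push_cast
  ring

lemma hasSum_norm_rayIntegrandTerm (α θ : ℝ) {r : ℝ} (hr : 0 < r) :
    HasSum (fun n ↦ ‖rayIntegrandTerm α θ n r‖)
      (r ^ (α - 1) * Real.exp (-((ray α).re * r)) * Real.exp (|θ| * r ^ α)) := by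
  have hexp := (NormedSpace.expSeries_div_hasSum_exp (𝔸 := ℝ) (|θ| * r ^ α)).mul_left
    (r ^ (α - 1) * Real.exp (-((ray α).re * r)))
  rw [← Real.exp_eq_exp_ℝ] at hexp
  convert! hexp using 2 with n
  rw [norm_rayIntegrandTerm α θ n hr, rpow_mul_succ_sub_one α hr, mul_pow]
  ring

lemma integral_rayIntegrandTerm {α : ℝ} (hα₀ : 0 < α) (hα₁ : α < 1) (θ : ℝ) (n : ℕ) :
    ∫ r in Ioi 0, rayIntegrandTerm α θ n r = (-(θ : ℂ)) ^ n / (n.factorial : ℂ) *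
      (Complex.exp (Real.pi * α * (n + 1) * Complex.I) * (Real.Gamma (α * (n + 1)) : ℂ)) := by
  have hre : 0 < ((α * (n + 1) : ℝ) : ℂ).re := by
    rw [Complex.ofReal_re]; positivity
  have hgamma : ∫ r : ℝ in Ioi 0, ((r ^ (α * (n + 1) - 1) : ℝ) : ℂ) *
      Complex.exp (-((ray α)⁻¹ * r)) =
        ray α ^ ((α * (n + 1) : ℝ) : ℂ) * Complex.Gamma ((α * (n + 1) : ℝ) : ℂ) := by
    have h := integral_cpow_mul_cexp_neg_mul hre (z := (ray α)⁻¹)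
      (by rw [inv_ray_re]; exact re_ray_pos hα₀ hα₁)
    rw [one_div, inv_inv] at h
    rw [← h]
    refine setIntegral_congr_fun measurableSet_Ioi fun r (hr : 0 < r) ↦ ?_
    simp [Complex.ofReal_cpow hr.le]
  have hray := ray_cpow_mul_ray_cpow_mul hα₀ hα₁ ((n + 1 : ℕ) : ℂ)
  simp only [rayIntegrandTerm]
  rw [Complex.cpow_natCast] at hray
  rw [integral_const_mul, hgamma, Complex.Gamma_ofReal, mul_assoc, ← mul_assoc (ray α ^ (n + 1))]
  push_cast at hray ⊢
  rw [hray]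

lemma hasSum_rayIntegral {α : ℝ} (hα₀ : 0 < α) (hα₁ : α < 1) (θ : ℝ) :
    HasSum (fun n : ℕ ↦ (-(θ : ℂ)) ^ n / (n.factorial : ℂ) *
      (Complex.exp (Real.pi * α * (n + 1) * Complex.I) * (Real.Gamma (α * (n + 1)) : ℂ)))
      (rayIntegral α θ) := by
  simp only [← integral_rayIntegrandTerm hα₀ hα₁]
  refine hasSum_integral_of_dominated_convergence (fun n r ↦ ‖rayIntegrandTerm α θ n r‖)
    (fun n ↦ (measurable_rayIntegrandTerm α θ n).aestronglyMeasurable)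
    (fun n ↦ .of_forall fun r ↦ le_rfl) ?_ ?_ ?_
  · filter_upwards [self_mem_ae_restrict measurableSet_Ioi] with r hr
    exact (hasSum_norm_rayIntegrandTerm α θ hr).summable
  · refine (integrableOn_rpow_mul_exp_mul_exp_rpow hα₀ hα₁ (abs_nonneg θ) (re_ray_pos hα₀ hα₁)
      (s := α - 1) (by linarith)).congr_fun (fun r hr ↦ ?_) measurableSet_Ioi
    exact (hasSum_norm_rayIntegrandTerm α θ hr).tsum_eq.symm
  · filter_upwards [self_mem_ae_restrict measurableSet_Ioi] with r hr
    exact hasSum_rayIntegrandTerm α θ hr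

lemma one_div_Gamma_one_sub {x : ℝ} (hx : 0 < x) :
    1 / Real.Gamma (1 - x) = Real.Gamma x * Real.sin (Real.pi * x) / Real.pi := by
  have hΓ := (Real.Gamma_pos_of_pos hx).ne'
  have hreflection := Real.Gamma_mul_Gamma_one_sub x
  -- The poles of `Γ(1 - x)` are zeros of the sine, and there both sides are `0`.
  by_cases hsin : Real.sin (Real.pi * x) = 0
  · rw [hsin, div_zero] at hreflection
    rw [(mul_eq_zero.1 hreflection).resolve_left hΓ, hsin]
    simp
  · rw [eq_div_of_mul_eq hΓ ((mul_comm _ _).trans hreflection)]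
    field_simp

lemma hasSum_wrightDensity {α : ℝ} (hα₀ : 0 < α) (hα₁ : α < 1) (θ : ℝ) :
    HasSum (fun n : ℕ ↦ (-θ) ^ n / ((n.factorial : ℝ) * Real.Gamma (1 - α - α * (n : ℝ))))
      ((rayIntegral α θ).im / Real.pi) := by
  convert! (Complex.imCLM.hasSum (hasSum_rayIntegral hα₀ hα₁ θ)).div_const Real.pi using 2 with n
  have hcoeff : (-(θ : ℂ)) ^ n / (n.factorial : ℂ) =
      (((-θ) ^ n / (n.factorial : ℝ) : ℝ) : ℂ) := by
    push_cast; rfl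
  have hangle : (Real.pi * α * (n + 1) * Complex.I : ℂ) =
      ((Real.pi * (α * (n + 1)) : ℝ) : ℂ) * Complex.I := by
    push_cast; ring
  rw [Complex.imCLM_apply, hcoeff, hangle, Complex.im_ofReal_mul, Complex.im_mul_ofReal,
    Complex.exp_ofReal_mul_I_im, show 1 - α - α * n = 1 - α * (n + 1) by ring, ← div_div,
    div_eq_mul_one_div _ (Real.Gamma _), one_div_Gamma_one_sub (by positivity)]
  ring

lemma wrightDensity_eq_rayIntegral_im_div_pi {α : ℝ} (hα₀ : 0 < α) (hα₁ : α < 1) (θ : ℝ) :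
    wrightDensity α θ = (rayIntegral α θ).im / Real.pi :=
  (hasSum_wrightDensity hα₀ hα₁ θ).tsum_eq

lemma measurable_wrightDensity {α : ℝ} (hα₀ : 0 < α) (hα₁ : α < 1) :
    Measurable (wrightDensity α) := by
  refine measurable_of_tendsto_metrizable (f := fun (n : ℕ) θ ↦ ∑ i ∈ Finset.range n,
    (-θ) ^ i / ((i.factorial : ℝ) * Real.Gamma (1 - α - α * (i : ℝ)))) (fun n ↦ by fun_prop)
    (tendsto_pi_nhds.2 fun θ ↦ ?_)
  rw [wrightDensity_eq_rayIntegral_im_div_pi hα₀ hα₁]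
  exact (hasSum_wrightDensity hα₀ hα₁ θ).tendsto_sum_nat

lemma norm_rayIntegrand_le (α : ℝ) (hray : 0 ≤ (ray α).re) {θ r : ℝ} (hθ : 0 ≤ θ) (hr : 0 < r) :
    ‖rayIntegrand α θ r‖ ≤ r ^ (α - 1) * Real.exp (-((ray α).re * r)) := by
  rw [norm_rayIntegrand α θ hr]
  exact mul_le_of_le_one_right (by positivity)
    (Real.exp_le_one_iff.2 (neg_nonpos.2 (by positivity)))

lemma integrableOn_rayIntegrand {α : ℝ} (hα₀ : 0 < α) (hα₁ : α < 1) {θ : ℝ} (hθ : 0 ≤ θ) :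
    IntegrableOn (rayIntegrand α θ) (Ioi 0) := by
  have hray := re_ray_pos hα₀ hα₁
  refine (integrableOn_rpow_mul_exp_neg_mul (s := α - 1) (by linarith) hray).mono'
    ((measurable_uncurry_rayIntegrand α).of_uncurry_left).aestronglyMeasurable ?_
  filter_upwards [self_mem_ae_restrict measurableSet_Ioi] with r hr
  exact norm_rayIntegrand_le α hray.le hθ hr

lemma abs_wrightDensity_le_abs_im_rayIntegral {α : ℝ} (hα₀ : 0 < α) (hα₁ : α < 1) (θ : ℝ) :
    |wrightDensity α θ| ≤ |(rayIntegral α θ).im| := by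
  rw [wrightDensity_eq_rayIntegral_im_div_pi hα₀ hα₁, abs_div, abs_of_pos Real.pi_pos]
  exact div_le_self (abs_nonneg _) (by linarith [Real.pi_gt_three])

lemma exists_abs_wrightDensity_le {α : ℝ} (hα₀ : 0 < α) (hα₁ : α < 1) :
    ∃ C : ℝ, ∀ θ, 0 ≤ θ → |wrightDensity α θ| ≤ C := by
  have hray := re_ray_pos hα₀ hα₁
  refine ⟨∫ r in Ioi (0 : ℝ), r ^ (α - 1) * Real.exp (-((ray α).re * r)), fun θ hθ ↦ ?_⟩
  refine (abs_wrightDensity_le_abs_im_rayIntegral hα₀ hα₁ θ).trans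
    ((Complex.abs_im_le_norm _).trans (norm_integral_le_of_norm_le
      (integrableOn_rpow_mul_exp_neg_mul (s := α - 1) (by linarith) hray) ?_))
  filter_upwards [self_mem_ae_restrict measurableSet_Ioi] with r hr
  exact norm_rayIntegrand_le α hray.le hθ hr

lemma norm_cexp_sub_one_le_of_re_nonpos {z : ℂ} (hz : z.re ≤ 0) :
    ‖Complex.exp z - 1‖ ≤ ‖z‖ := by
  simpa using Convex.norm_image_sub_le_of_norm_deriv_le (𝕜 := ℂ) (f := Complex.exp)
    (s := {w | w.re ≤ 0}) (x := 0) (y := z) (C := 1)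
    (fun w _ ↦ Complex.differentiable_exp.differentiableAt)
    (fun w hw ↦ by
      rw [Complex.deriv_exp, Complex.norm_exp]
      exact Real.exp_le_one_iff.2 hw)
    (convex_halfSpace_re_le 0) (by simp) hz

lemma norm_rpow_mul_cexp_neg_mul_rpow (α p : ℝ) (z : ℂ) {r : ℝ} (hr : 0 < r) :
    ‖((r ^ p : ℝ) : ℂ) * Complex.exp (-(z * ((r ^ α : ℝ) : ℂ)))‖ =
      r ^ p * Real.exp (-z.re * r ^ α) := by
  rw [norm_mul, Complex.norm_real, Complex.norm_exp, Real.norm_of_nonneg (by positivity),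
    Complex.neg_re, Complex.re_mul_ofReal, neg_mul]

lemma integrableOn_rpow_mul_cexp_neg_mul_rpow {α p : ℝ} (hα₀ : 0 < α) (hp : -1 < p) {z : ℂ}
    (hz : 0 < z.re) :
    IntegrableOn (fun r : ℝ ↦ ((r ^ p : ℝ) : ℂ) * Complex.exp (-(z * ((r ^ α : ℝ) : ℂ))))
      (Ioi 0) := by
  refine (integrableOn_rpow_mul_exp_neg_mul_rpow hp hα₀ hz).mono'
    (Measurable.aestronglyMeasurable (by fun_prop)) ?_
  filter_upwards [self_mem_ae_restrict measurableSet_Ioi] with r hr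
  rw [norm_rpow_mul_cexp_neg_mul_rpow α p z hr]

lemma integral_rpow_sub_one_mul_cexp_neg_mul_rpow {α : ℝ} (hα₀ : 0 < α) {z : ℂ} (hz : 0 < z.re) :
    ∫ r : ℝ in Ioi 0, ((r ^ (α - 1) : ℝ) : ℂ) * Complex.exp (-(z * ((r ^ α : ℝ) : ℂ))) =
      1 / (α * z) := by
  have hsubst := integral_comp_rpow_Ioi (fun t : ℝ ↦ Complex.exp (-(z * t))) hα₀.ne'
  have hexp := integral_cpow_mul_cexp_neg_mul (a := 1) (by simp) hz
  simp only [sub_self, Complex.cpow_zero, one_mul, Complex.cpow_one, Complex.Gamma_one,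
    mul_one] at hexp
  have hα : (α : ℂ) ≠ 0 := by exact_mod_cast hα₀.ne'
  rw [one_div, mul_inv, ← one_div z, ← hexp, ← hsubst, ← integral_const_mul]
  refine setIntegral_congr_fun measurableSet_Ioi fun r _ ↦ ?_
  simp only [abs_of_pos hα₀, Complex.real_smul]
  push_cast
  field_simp

-- Dropping the factor `exp (-(ray α)⁻¹ r)` leaves an integral with the real value `1 / (αθ)`, so
-- only the remainder, of size at most `r`, contributes to the imaginary part.
lemma abs_im_rayIntegral_le {α : ℝ} (hα₀ : 0 < α) (hα₁ : α < 1) {θ : ℝ} (hθ : 0 < θ) :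
    |(rayIntegral α θ).im| ≤
      ∫ r in Ioi (0 : ℝ), r ^ α * Real.exp (-(θ * (ray α).re) * r ^ α) := by
  have hray := re_ray_pos hα₀ hα₁
  have hre : ((θ : ℂ) * ray α).re = θ * (ray α).re := Complex.re_ofReal_mul _ _
  have hpos : 0 < ((θ : ℂ) * ray α).re := hre ▸ mul_pos hθ hray
  set g : ℝ → ℂ := fun r ↦ ((r ^ (α - 1) : ℝ) : ℂ) *
    Complex.exp (-(θ * ray α * ((r ^ α : ℝ) : ℂ))) * ray α with hg
  have hgint : IntegrableOn g (Ioi 0) :=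
    (integrableOn_rpow_mul_cexp_neg_mul_rpow hα₀ (by linarith) hpos).mul_const _
  have hgval : ∫ r in Ioi (0 : ℝ), g r = ((1 / (α * θ) : ℝ) : ℂ) := by
    rw [hg, integral_mul_const, integral_rpow_sub_one_mul_cexp_neg_mul_rpow hα₀ hpos]
    have := ray_ne_zero α
    push_cast
    field_simp
  have him : (rayIntegral α θ).im = (∫ r in Ioi (0 : ℝ), (rayIntegrand α θ r - g r)).im := by
    rw [integral_sub (integrableOn_rayIntegrand hα₀ hα₁ hθ.le) hgint, hgval, Complex.sub_im,
      Complex.ofReal_im, sub_zero, rayIntegral]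
  rw [him, ← hre]
  refine (Complex.abs_im_le_norm _).trans (norm_integral_le_of_norm_le
    (integrableOn_rpow_mul_exp_neg_mul_rpow (by linarith) hα₀ hpos) ?_)
  filter_upwards [self_mem_ae_restrict measurableSet_Ioi] with r (hr : 0 < r)
  have hfactor : rayIntegrand α θ r - g r = (Complex.exp (-((ray α)⁻¹ * r)) - 1) * g r := by
    simp only [hg, rayIntegrand]
    rw [mul_right_comm (θ : ℂ)]
    ring
  have hexp : ‖Complex.exp (-((ray α)⁻¹ * r)) - 1‖ ≤ r := by
    refine (norm_cexp_sub_one_le_of_re_nonpos ?_).trans_eq ?_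
    · rw [Complex.neg_re, Complex.re_mul_ofReal, inv_ray_re]
      exact neg_nonpos.2 (by positivity)
    · rw [norm_neg, norm_mul, norm_inv, norm_ray, inv_one, one_mul, Complex.norm_real,
        Real.norm_of_nonneg hr.le]
  rw [hfactor, norm_mul, hg, norm_mul, norm_ray, mul_one, norm_rpow_mul_cexp_neg_mul_rpow _ _ _ hr]
  refine (mul_le_mul_of_nonneg_right hexp (by positivity)).trans_eq ?_
  rw [← mul_assoc, Real.rpow_sub_one hr.ne', mul_div_cancel₀ _ hr.ne']

lemma exists_abs_wrightDensity_le_rpow {α : ℝ} (hα₀ : 0 < α) (hα₁ : α < 1) :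
    ∃ C : ℝ, ∀ θ, 0 < θ → |wrightDensity α θ| ≤ C * θ ^ (-(1 + 1 / α)) := by
  have hray := re_ray_pos hα₀ hα₁
  refine ⟨(ray α).re ^ (-(1 + 1 / α)) * (1 / α) * Real.Gamma ((α + 1) / α), fun θ hθ ↦ ?_⟩
  refine (abs_wrightDensity_le_abs_im_rayIntegral hα₀ hα₁ θ).trans
    ((abs_im_rayIntegral_le hα₀ hα₁ hθ).trans_eq ?_)
  rw [integral_rpow_mul_exp_neg_mul_rpow hα₀ (by linarith) (mul_pos hθ hray),
    Real.mul_rpow hθ.le hray.le, show -(α + 1) / α = -(1 + 1 / α) by field_simp]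
  ring

lemma norm_cpow_mul_rayIntegrand (α : ℝ) (s : ℂ) {θ r : ℝ} (hθ : 0 < θ) (hr : 0 < r) :
    ‖(θ : ℂ) ^ (s - 1) * rayIntegrand α θ r‖ = r ^ (α - 1) * Real.exp (-((ray α).re * r)) *
      (θ ^ (s.re - 1) * Real.exp (-((ray α).re * r ^ α * θ))) := by
  rw [norm_mul, norm_rayIntegrand α θ hr, Complex.norm_cpow_eq_rpow_re_of_pos hθ, Complex.sub_re,
    Complex.one_re, mul_comm θ (r ^ α), ← mul_assoc (ray α).re]
  ring

lemma integral_norm_cpow_mul_rayIntegrand {α : ℝ} (hray : 0 < (ray α).re) {s : ℂ} (hs : 0 < s.re)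
    {r : ℝ} (hr : 0 < r) :
    ∫ θ in Ioi (0 : ℝ), ‖(θ : ℂ) ^ (s - 1) * rayIntegrand α θ r‖ =
      (ray α).re ^ (-s.re) * Real.Gamma s.re *
        (r ^ (α * (1 - s.re) - 1) * Real.exp (-((ray α).re * r))) := by
  rw [setIntegral_congr_fun measurableSet_Ioi fun θ hθ ↦ norm_cpow_mul_rayIntegrand α s hθ hr,
    integral_const_mul, Real.integral_rpow_mul_exp_neg_mul_Ioi hs (by positivity), one_div,
    Real.inv_rpow (by positivity), ← Real.rpow_neg (by positivity),
    Real.mul_rpow hray.le (by positivity), ← Real.rpow_mul hr.le,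
    show α * (1 - s.re) - 1 = α - 1 + α * -s.re by ring, Real.rpow_add hr]
  ring

lemma integrable_cpow_mul_rayIntegrand {α : ℝ} (hα₀ : 0 < α) (hα₁ : α < 1) {s : ℂ}
    (hs₀ : 0 < s.re) (hs₁ : s.re < 1) :
    Integrable (fun z : ℝ × ℝ ↦ (z.1 : ℂ) ^ (s - 1) * rayIntegrand α z.1 z.2)
      ((volume.restrict (Ioi 0)).prod (volume.restrict (Ioi 0))) := by
  have hray := re_ray_pos hα₀ hα₁
  have hmeas : Measurable fun z : ℝ × ℝ ↦ (z.1 : ℂ) ^ (s - 1) * rayIntegrand α z.1 z.2 :=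
    Measurable.mul (by fun_prop) (measurable_uncurry_rayIntegrand α)
  rw [integrable_prod_iff' hmeas.aestronglyMeasurable]
  constructor
  · filter_upwards [self_mem_ae_restrict measurableSet_Ioi] with r (hr : 0 < r)
    refine ((integrableOn_rpow_mul_exp_neg_mul (s := s.re - 1) (by linarith)
      (b := (ray α).re * r ^ α) (by positivity)).const_mul
      (r ^ (α - 1) * Real.exp (-((ray α).re * r)))).mono'
      (hmeas.comp (measurable_id.prodMk measurable_const)).aestronglyMeasurable ?_
    filter_upwards [self_mem_ae_restrict measurableSet_Ioi] with θ hθ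
    exact (norm_cpow_mul_rayIntegrand α s hθ hr).le
  · have hexponent : -1 < α * (1 - s.re) - 1 := by
      linarith [mul_pos hα₀ (sub_pos.2 hs₁)]
    refine IntegrableOn.congr_fun ((integrableOn_rpow_mul_exp_neg_mul hexponent hray).const_mul
      ((ray α).re ^ (-s.re) * Real.Gamma s.re)) (fun r hr ↦ ?_) measurableSet_Ioi
    exact (integral_norm_cpow_mul_rayIntegrand hray hs₀ hr).symm

lemma one_div_rpow_mul_ray_cpow {α : ℝ} (hα₀ : 0 < α) (hα₁ : α < 1) (s : ℂ) {r : ℝ} (hr : 0 < r) :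
    (1 / (((r ^ α : ℝ) : ℂ) * ray α)) ^ s = (r : ℂ) ^ (-(α * s)) * ray α ^ (-s) := by
  have hrα : 0 < r ^ α := by positivity
  have harg : (((r ^ α : ℝ) : ℂ) * ray α).arg ≠ Real.pi := by
    rw [Complex.arg_real_mul _ hrα, ne_eq, Complex.arg_eq_pi_iff]
    exact fun h ↦ h.1.not_gt (re_ray_pos hα₀ hα₁)
  have hne : ((r ^ α : ℝ) : ℂ) * ray α ≠ 0 :=
    mul_ne_zero (by exact_mod_cast hrα.ne') (ray_ne_zero α)
  rw [one_div, Complex.inv_cpow _ _ harg, Complex.cpow_def_of_ne_zero hne,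
    Complex.log_ofReal_mul hrα (ray_ne_zero α), Real.log_rpow hr,
    Complex.cpow_def_of_ne_zero (by exact_mod_cast hr.ne'),
    Complex.cpow_def_of_ne_zero (ray_ne_zero α), ← Complex.exp_neg, ← Complex.exp_add,
    ← Complex.ofReal_log hr.le]
  push_cast
  ring_nf

lemma integral_cpow_mul_rayIntegrand {α : ℝ} (hα₀ : 0 < α) (hα₁ : α < 1) {s : ℂ} (hs : 0 < s.re)
    {r : ℝ} (hr : 0 < r) :
    ∫ θ : ℝ in Ioi 0, (θ : ℂ) ^ (s - 1) * rayIntegrand α θ r =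
      Complex.Gamma s * ray α ^ (1 - s) *
        ((r : ℂ) ^ (α * (1 - s) - 1) * Complex.exp (-((ray α)⁻¹ * r))) := by
  have hpos : 0 < (((r ^ α : ℝ) : ℂ) * ray α).re := by
    rw [Complex.re_ofReal_mul]
    exact mul_pos (by positivity) (re_ray_pos hα₀ hα₁)
  have hsplit : ∀ θ : ℝ, (θ : ℂ) ^ (s - 1) * rayIntegrand α θ r =
      ((r ^ (α - 1) : ℝ) : ℂ) * ray α * Complex.exp (-((ray α)⁻¹ * r)) *
        ((θ : ℂ) ^ (s - 1) * Complex.exp (-(((r ^ α : ℝ) : ℂ) * ray α * θ))) := by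
    intro θ
    rw [rayIntegrand, mul_comm (θ : ℂ) _, mul_right_comm _ (θ : ℂ)]
    ring
  have hrpow : (r : ℂ) ^ (α * (1 - s) - 1) = ((r ^ (α - 1) : ℝ) : ℂ) * (r : ℂ) ^ (-(α * s)) := by
    rw [Complex.ofReal_cpow hr.le, ← Complex.cpow_add _ _ (by exact_mod_cast hr.ne')]
    push_cast
    ring_nf
  simp only [hsplit]
  rw [integral_const_mul, integral_cpow_mul_cexp_neg_mul hs hpos,
    one_div_rpow_mul_ray_cpow hα₀ hα₁ s hr, hrpow, sub_eq_add_neg 1 s,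
    Complex.cpow_add _ _ (ray_ne_zero α), Complex.cpow_one]
  ring

/-- The Mellin transform of `rayIntegral α`, for arguments in the strip `0 < Re s < 1`. -/
def mellinSymbol (α : ℝ) (s : ℂ) : ℂ :=
  Complex.Gamma s * Complex.Gamma (α * (1 - s)) * Complex.exp (Real.pi * α * (1 - s) * Complex.I)

lemma hasMellin_rayIntegral {α : ℝ} (hα₀ : 0 < α) (hα₁ : α < 1) {s : ℂ} (hs₀ : 0 < s.re)
    (hs₁ : s.re < 1) :
    HasMellin (rayIntegral α) s (mellinSymbol α s) := by
  have hinteg := integrable_cpow_mul_rayIntegrand hα₀ hα₁ hs₀ hs₁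
  have hfubini : (fun θ : ℝ ↦ (θ : ℂ) ^ (s - 1) • rayIntegral α θ) =
      fun θ : ℝ ↦ ∫ r in Ioi 0, (θ : ℂ) ^ (s - 1) * rayIntegrand α θ r := by
    funext θ
    rw [rayIntegral, smul_eq_mul, integral_const_mul]
  have hre : 0 < ((α : ℂ) * (1 - s)).re := by
    rw [Complex.re_ofReal_mul, Complex.sub_re, Complex.one_re]
    exact mul_pos hα₀ (sub_pos.2 hs₁)
  refine ⟨by rw [MellinConvergent, hfubini]; exact hinteg.integral_prod_left, ?_⟩
  rw [mellin, hfubini, integral_integral_swap hinteg, setIntegral_congr_fun measurableSet_Ioi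
    fun r hr ↦ integral_cpow_mul_rayIntegrand hα₀ hα₁ hs₀ hr, integral_const_mul,
    integral_cpow_mul_cexp_neg_mul hre (by rw [inv_ray_re]; exact re_ray_pos hα₀ hα₁), one_div,
    inv_inv, mellinSymbol, ← ray_cpow_mul_ray_cpow_mul hα₀ hα₁]
  ring

/-! ### Uniform lower bounds for the moments of the M-Wright function -/

lemma measurable_rayIntegral (α : ℝ) : Measurable (rayIntegral α) :=
  ((measurable_uncurry_rayIntegrand α).stronglyMeasurable.integral_prod_right'
    (ν := volume.restrict (Ioi 0))).measurable

/-- The log-normal weight `θ ^ (-1/2) exp (-(ε log θ)² / 4)`. It decays faster than every power of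
`θ` at `0` and at `∞`, and it is a Gaussian superposition of the powers `θ ^ (s - 1)` with
`Re s = 1/2`. -/
def logGaussian (ε θ : ℝ) : ℝ := θ ^ (-(1 / 2) : ℝ) * Real.exp (-(ε * Real.log θ) ^ 2 / 4)

/-- The Gaussian average of `mellinSymbol α` over the line `Re s = 1/2`, at scale `ε`. -/
def gaussianMellin (α ε : ℝ) : ℂ :=
  ∫ x : ℝ, (Real.exp (-x ^ 2) : ℂ) * mellinSymbol α (1 / 2 + (ε * x : ℝ) * Complex.I)

lemma logGaussian_nonneg (ε : ℝ) {θ : ℝ} (hθ : 0 ≤ θ) : 0 ≤ logGaussian ε θ := by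
  unfold logGaussian; positivity

lemma logGaussian_le_rpow (ε : ℝ) {θ : ℝ} (hθ : 0 ≤ θ) :
    logGaussian ε θ ≤ θ ^ (-(1 / 2) : ℝ) :=
  mul_le_of_le_one_right (by positivity)
    (Real.exp_le_one_iff.2 (by linarith [sq_nonneg (ε * Real.log θ)]))

lemma measurable_logGaussian (ε : ℝ) : Measurable (logGaussian ε) := by
  unfold logGaussian; fun_prop

lemma integrable_exp_neg_sq : Integrable fun x : ℝ ↦ Real.exp (-x ^ 2) := by
  simpa using integrable_exp_neg_mul_sq one_pos

lemma integral_gaussian_mul_cpow (ε : ℝ) {θ : ℝ} (hθ : 0 < θ) :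
    ∫ x : ℝ, (Real.exp (-x ^ 2) : ℂ) * (θ : ℂ) ^ ((1 / 2 + (ε * x : ℝ) * Complex.I) - 1) =
      ((√Real.pi * logGaussian ε θ : ℝ) : ℂ) := by
  have hfourier := fourierIntegral_gaussian (b := 1) (by simp) ((ε * Real.log θ : ℝ) : ℂ)
  have hintegrand : ∀ x : ℝ, (Real.exp (-x ^ 2) : ℂ) *
      (θ : ℂ) ^ ((1 / 2 + (ε * x : ℝ) * Complex.I : ℂ) - 1) =
      ((θ ^ (-(1 / 2) : ℝ) : ℝ) : ℂ) * (Complex.exp (Complex.I * ((ε * Real.log θ : ℝ) : ℂ) * x) *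
        Complex.exp (-1 * (x : ℂ) ^ 2)) := by
    intro x
    have hθ' : (θ : ℂ) ≠ 0 := by exact_mod_cast hθ.ne'
    rw [Complex.ofReal_cpow hθ.le, Complex.cpow_def_of_ne_zero hθ',
      Complex.cpow_def_of_ne_zero hθ', Complex.ofReal_exp, ← Complex.exp_add, ← Complex.exp_add,
      ← Complex.exp_add, ← Complex.ofReal_log hθ.le]
    push_cast
    ring_nf
  have hsqrt : ((Real.pi : ℂ) / 1) ^ (1 / 2 : ℂ) = ((√Real.pi : ℝ) : ℂ) := by
    rw [Real.sqrt_eq_rpow, Complex.ofReal_cpow Real.pi_pos.le]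
    push_cast
    simp
  simp only [hintegrand]
  rw [integral_const_mul, hfourier, hsqrt, logGaussian]
  push_cast
  ring_nf

lemma norm_cpow_half_add_mul_I_sub_one {θ : ℝ} (hθ : 0 < θ) (y : ℝ) :
    ‖(θ : ℂ) ^ ((1 / 2 + (y : ℝ) * Complex.I : ℂ) - 1)‖ = θ ^ (-(1 / 2) : ℝ) := by
  rw [Complex.norm_cpow_eq_rpow_re_of_pos hθ]
  norm_num

lemma integrableOn_rpow_mul_norm_rayIntegral {α : ℝ} (hα₀ : 0 < α) (hα₁ : α < 1) :
    IntegrableOn (fun θ : ℝ ↦ θ ^ (-(1 / 2) : ℝ) * ‖rayIntegral α θ‖) (Ioi 0) := by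
  refine IntegrableOn.congr_fun (hasMellin_rayIntegral hα₀ hα₁ (s := 1 / 2 + (0 : ℝ) * Complex.I)
    (by simp) (by norm_num)).1.norm (fun θ hθ ↦ ?_) measurableSet_Ioi
  rw [norm_smul, norm_cpow_half_add_mul_I_sub_one hθ]

lemma integrableOn_wrightDensity_mul_logGaussian {α : ℝ} (hα₀ : 0 < α) (hα₁ : α < 1) (ε : ℝ) :
    IntegrableOn (fun θ ↦ wrightDensity α θ * logGaussian ε θ) (Ioi 0) := by
  refine (integrableOn_rpow_mul_norm_rayIntegral hα₀ hα₁).mono'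
    ((measurable_wrightDensity hα₀ hα₁).mul (measurable_logGaussian ε)).aestronglyMeasurable ?_
  filter_upwards [self_mem_ae_restrict measurableSet_Ioi] with θ (hθ : 0 < θ)
  rw [norm_mul, Real.norm_of_nonneg (logGaussian_nonneg ε hθ.le), mul_comm]
  exact mul_le_mul (logGaussian_le_rpow ε hθ.le)
    ((abs_wrightDensity_le_abs_im_rayIntegral hα₀ hα₁ θ).trans (Complex.abs_im_le_norm _))
    (norm_nonneg _) (by positivity)

lemma integrable_gaussian_mul_cpow_mul_rayIntegral {α : ℝ} (hα₀ : 0 < α) (hα₁ : α < 1) (ε : ℝ) :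
    Integrable (fun z : ℝ × ℝ ↦ (Real.exp (-z.2 ^ 2) : ℂ) *
      (z.1 : ℂ) ^ ((1 / 2 + (ε * z.2 : ℝ) * Complex.I : ℂ) - 1) * rayIntegral α z.1)
      ((volume.restrict (Ioi 0)).prod volume) := by
  refine ((integrableOn_rpow_mul_norm_rayIntegral hα₀ hα₁).mul_prod integrable_exp_neg_sq).mono'
    (Measurable.aestronglyMeasurable (Measurable.mul (by fun_prop)
      ((measurable_rayIntegral α).comp measurable_fst))) ?_
  filter_upwards [Measure.quasiMeasurePreserving_fst.ae (self_mem_ae_restrict measurableSet_Ioi)]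
    with z hz
  rw [norm_mul, norm_mul, norm_cpow_half_add_mul_I_sub_one hz, Complex.norm_real,
    Real.norm_of_nonneg (Real.exp_pos _).le]
  exact le_of_eq (by ring)

lemma integral_wrightDensity_mul_logGaussian {α : ℝ} (hα₀ : 0 < α) (hα₁ : α < 1) (ε : ℝ) :
    Real.pi * √Real.pi * ∫ θ in Ioi (0 : ℝ), wrightDensity α θ * logGaussian ε θ =
      (gaussianMellin α ε).im := by
  have hinteg := integrable_gaussian_mul_cpow_mul_rayIntegral hα₀ hα₁ ε
  have hinner_x : ∀ θ ∈ Ioi (0 : ℝ), (∫ x : ℝ, (Real.exp (-x ^ 2) : ℂ) *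
      (θ : ℂ) ^ ((1 / 2 + (ε * x : ℝ) * Complex.I : ℂ) - 1) * rayIntegral α θ) =
      ((√Real.pi * logGaussian ε θ : ℝ) : ℂ) * rayIntegral α θ := fun θ hθ ↦ by
    rw [integral_mul_const, integral_gaussian_mul_cpow ε hθ]
  have hinner_θ : ∀ x : ℝ, (∫ θ : ℝ in Ioi 0, (Real.exp (-x ^ 2) : ℂ) *
      (θ : ℂ) ^ ((1 / 2 + (ε * x : ℝ) * Complex.I : ℂ) - 1) * rayIntegral α θ) =
      (Real.exp (-x ^ 2) : ℂ) * mellinSymbol α (1 / 2 + (ε * x : ℝ) * Complex.I) := fun x ↦ by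
    simp only [mul_assoc, ← (hasMellin_rayIntegral hα₀ hα₁
      (s := 1 / 2 + (ε * x : ℝ) * Complex.I) (by simp) (by norm_num)).2]
    rw [integral_const_mul, mellin]
    simp only [smul_eq_mul]
  have hswap := integral_integral_swap (f := fun θ x : ℝ ↦ (Real.exp (-x ^ 2) : ℂ) *
    (θ : ℂ) ^ ((1 / 2 + (ε * x : ℝ) * Complex.I : ℂ) - 1) * rayIntegral α θ) hinteg
  simp only [hinner_θ] at hswap
  rw [setIntegral_congr_fun measurableSet_Ioi hinner_x] at hswap
  rw [gaussianMellin, ← hswap, ← Complex.imCLM_apply, ← Complex.imCLM.integral_comp_comm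
    (IntegrableOn.congr_fun hinteg.integral_prod_left hinner_x measurableSet_Ioi),
    ← integral_const_mul]
  refine setIntegral_congr_fun measurableSet_Ioi fun θ _ ↦ ?_
  rw [Complex.imCLM_apply, Complex.im_ofReal_mul,
    wrightDensity_eq_rayIntegral_im_div_pi hα₀ hα₁]
  field_simp

lemma norm_Gamma_le {z : ℂ} (hz : 0 < z.re) : ‖Complex.Gamma z‖ ≤ Real.Gamma z.re := by
  rw [Complex.Gamma_eq_integral hz, Real.Gamma_eq_integral hz, Complex.GammaIntegral]
  refine norm_integral_le_of_norm_le (Real.GammaIntegral_convergent hz) ?_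
  filter_upwards [self_mem_ae_restrict measurableSet_Ioi] with t ht
  rw [norm_mul, Complex.norm_cpow_eq_rpow_re_of_pos ht, Complex.norm_real,
    Real.norm_of_nonneg (Real.exp_pos _).le, Complex.sub_re, Complex.one_re]

lemma norm_mellinSymbol_le {α : ℝ} (hα₀ : 0 < α) {s : ℂ} (hs₀ : 0 < s.re) (hs₁ : s.re < 1) :
    ‖mellinSymbol α s‖ ≤
      Real.Gamma s.re * Real.Gamma (α * (1 - s.re)) * Real.exp (Real.pi * α * s.im) := by
  have hre : ((α : ℂ) * (1 - s)).re = α * (1 - s.re) := by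
    rw [Complex.re_ofReal_mul, Complex.sub_re, Complex.one_re]
  have hpos : 0 < α * (1 - s.re) := mul_pos hα₀ (sub_pos.2 hs₁)
  have hexp : ‖Complex.exp (Real.pi * α * (1 - s) * Complex.I)‖ =
      Real.exp (Real.pi * α * s.im) := by
    rw [Complex.norm_exp, Complex.mul_I_re, ← Complex.ofReal_mul, Complex.im_ofReal_mul]
    simp
  rw [mellinSymbol, norm_mul, norm_mul, hexp]
  gcongr
  · exact norm_Gamma_le hs₀
  · exact hre ▸ norm_Gamma_le (hre.symm ▸ hpos)

lemma continuousAt_Gamma_of_re_pos {z : ℂ} (hz : 0 < z.re) : ContinuousAt Complex.Gamma z :=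
  Complex.continuousAt_Gamma z fun m hm ↦ by
    rw [hm, Complex.neg_re, Complex.natCast_re] at hz
    linarith [Nat.cast_nonneg (α := ℝ) m]

lemma continuousAt_mellinSymbol {α : ℝ} (hα₀ : 0 < α) {s : ℂ} (hs₀ : 0 < s.re) (hs₁ : s.re < 1) :
    ContinuousAt (fun z : ℝ × ℂ ↦ mellinSymbol z.1 z.2) (α, s) := by
  have hpos : 0 < ((α : ℂ) * (1 - s)).re := by
    rw [Complex.re_ofReal_mul, Complex.sub_re, Complex.one_re]
    exact mul_pos hα₀ (sub_pos.2 hs₁)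
  unfold mellinSymbol
  refine ContinuousAt.mul (ContinuousAt.mul ?_ ?_) (by fun_prop)
  · exact ContinuousAt.comp (f := fun z : ℝ × ℂ ↦ z.2) (continuousAt_Gamma_of_re_pos hs₀)
      (by fun_prop)
  · exact ContinuousAt.comp (f := fun z : ℝ × ℂ ↦ (z.1 : ℂ) * (1 - z.2))
      (continuousAt_Gamma_of_re_pos hpos) (by fun_prop)

lemma continuousAt_mellinSymbol_half_add_mul_I {α : ℝ} (hα₀ : 0 < α) (ε x : ℝ) :
    ContinuousAt (fun z : ℝ × ℝ × ℝ ↦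
      mellinSymbol z.1 (1 / 2 + (z.2.1 * z.2.2 : ℝ) * Complex.I)) (α, ε, x) :=
  ContinuousAt.comp (x := (α, ε, x)) (g := fun z : ℝ × ℂ ↦ mellinSymbol z.1 z.2)
    (f := fun z : ℝ × ℝ × ℝ ↦ ((z.1, 1 / 2 + (z.2.1 * z.2.2 : ℝ) * Complex.I) : ℝ × ℂ))
    (continuousAt_mellinSymbol hα₀ (by simp) (by norm_num)) (by fun_prop)

lemma integrable_exp_neg_sq_mul_exp_mul (c : ℝ) :
    Integrable fun x : ℝ ↦ Real.exp (-x ^ 2) * Real.exp (c * x) := by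
  refine (integrable_cexp_quadratic (b := 1) (by simp) (c : ℂ) 0).norm.congr
    (.of_forall fun x ↦ ?_)
  have hreal : (-1 * (x : ℂ) ^ 2 + c * x + 0) = ((-x ^ 2 + c * x : ℝ) : ℂ) := by push_cast; ring
  beta_reduce
  rw [Complex.norm_exp, ← Real.exp_add, hreal, Complex.ofReal_re]

lemma integrable_exp_neg_sq_mul_exp_mul_abs (c : ℝ) :
    Integrable fun x : ℝ ↦ Real.exp (-x ^ 2) * Real.exp (c * |x|) := by
  refine ((integrable_exp_neg_sq_mul_exp_mul c).add
    (integrable_exp_neg_sq_mul_exp_mul (-c))).mono' (by fun_prop) (.of_forall fun x ↦ ?_)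
  rw [Real.norm_of_nonneg (by positivity), Pi.add_apply, ← mul_add]
  gcongr
  rcases abs_cases x with ⟨hx, -⟩ | ⟨hx, -⟩ <;> rw [hx]
  · exact le_add_of_nonneg_right (Real.exp_pos _).le
  · rw [mul_neg, ← neg_mul]
    exact le_add_of_nonneg_left (Real.exp_pos _).le

lemma norm_gaussian_mul_mellinSymbol_le {α ε : ℝ} (hα : α ∈ Ioc 0 1) (hε : ε ∈ Icc 0 1) (x : ℝ) :
    ‖(Real.exp (-x ^ 2) : ℂ) * mellinSymbol α (1 / 2 + (ε * x : ℝ) * Complex.I)‖ ≤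
      Real.Gamma (1 / 2) * Real.Gamma (α / 2) *
        (Real.exp (-x ^ 2) * Real.exp (Real.pi * |x|)) := by
  obtain ⟨⟨hα₀, hα₁⟩, hε₀, hε₁⟩ := And.intro hα hε
  have hsymbol := norm_mellinSymbol_le hα₀ (s := 1 / 2 + (ε * x : ℝ) * Complex.I)
    (by simp) (by norm_num)
  have hre : (1 / 2 + (ε * x : ℝ) * Complex.I : ℂ).re = 1 / 2 := by simp
  have him : (1 / 2 + (ε * x : ℝ) * Complex.I : ℂ).im = ε * x := by simp
  rw [hre, him, show α * (1 - 1 / 2) = α / 2 by ring] at hsymbol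
  have hexponent : Real.pi * α * (ε * x) ≤ Real.pi * |x| := by
    rw [mul_assoc, ← mul_assoc α]
    refine mul_le_mul_of_nonneg_left ((le_abs_self _).trans ?_) Real.pi_pos.le
    rw [abs_mul, abs_of_nonneg (by positivity : 0 ≤ α * ε)]
    exact mul_le_of_le_one_left (abs_nonneg x) (mul_le_one₀ hα₁ hε₀ hε₁)
  have := Real.Gamma_pos_of_pos (s := 1 / 2) (by norm_num)
  have := Real.Gamma_pos_of_pos (s := α / 2) (by positivity)
  rw [norm_mul, Complex.norm_real, Real.norm_of_nonneg (Real.exp_pos _).le, mul_left_comm]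
  gcongr
  exact hsymbol.trans (by gcongr)

lemma exists_Gamma_div_two_le {a b : ℝ} (ha : 0 < a) :
    ∃ B : ℝ, ∀ α ∈ Icc a b, Real.Gamma (α / 2) ≤ B := by
  have hcont : ContinuousOn (fun α : ℝ ↦ Real.Gamma (α / 2)) (Icc a b) := fun α hα ↦ by
    have hΓ : ContinuousAt Real.Gamma (α / 2) := (Real.differentiableAt_Gamma fun m hm ↦ by
      linarith [Nat.cast_nonneg (α := ℝ) m, ha.trans_le hα.1]).continuousAt
    exact (ContinuousAt.comp (f := fun a : ℝ ↦ a / 2) hΓ (by fun_prop)).continuousWithinAt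
  obtain ⟨B, hB⟩ := isCompact_Icc.bddAbove_image hcont
  exact ⟨B, fun α hα ↦ hB ⟨α, hα, rfl⟩⟩

lemma continuousOn_gaussianMellin {α₀ : ℝ} (hα₀ : 0 < α₀) :
    ContinuousOn (Function.uncurry gaussianMellin) (Icc α₀ 1 ×ˢ Icc 0 1) := by
  obtain ⟨B, hB⟩ := exists_Gamma_div_two_le (b := 1) hα₀
  refine continuousOn_of_dominated (bound := fun x ↦ Real.Gamma (1 / 2) * B *
    (Real.exp (-x ^ 2) * Real.exp (Real.pi * |x|))) ?_ ?_
    ((integrable_exp_neg_sq_mul_exp_mul_abs _).const_mul _) (.of_forall fun x ↦ ?_)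
  · rintro ⟨α, ε⟩ ⟨hα, -⟩
    refine Continuous.aestronglyMeasurable (Continuous.mul (by fun_prop)
      (continuous_iff_continuousAt.2 fun x ↦ ?_))
    exact ContinuousAt.comp (f := fun x : ℝ ↦ ((α, ε, x) : ℝ × ℝ × ℝ))
      (continuousAt_mellinSymbol_half_add_mul_I (hα₀.trans_le hα.1) ε x) (by fun_prop)
  · rintro ⟨α, ε⟩ ⟨hα, hε⟩
    refine .of_forall fun x ↦
      (norm_gaussian_mul_mellinSymbol_le ⟨hα₀.trans_le hα.1, hα.2⟩ hε x).trans ?_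
    have := Real.Gamma_pos_of_pos (s := 1 / 2) (by norm_num)
    gcongr
    exact hB α hα
  · rintro ⟨α, ε⟩ ⟨hα, -⟩
    refine ContinuousAt.continuousWithinAt (ContinuousAt.mul (by fun_prop) ?_)
    exact ContinuousAt.comp (x := (α, ε)) (f := fun z : ℝ × ℝ ↦ ((z.1, z.2, x) : ℝ × ℝ × ℝ))
      (continuousAt_mellinSymbol_half_add_mul_I (hα₀.trans_le hα.1) ε x) (by fun_prop)

lemma im_gaussianMellin_zero_pos {α : ℝ} (hα₀ : 0 < α) (hα₁ : α ≤ 1) :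
    0 < (gaussianMellin α 0).im := by
  have hsymbol : mellinSymbol α (1 / 2) = ((Real.Gamma (1 / 2) * Real.Gamma (α / 2) : ℝ) : ℂ) *
      Complex.exp (((Real.pi * (α / 2) : ℝ) : ℂ) * Complex.I) := by
    rw [mellinSymbol, Complex.ofReal_mul, ← Complex.Gamma_ofReal, ← Complex.Gamma_ofReal]
    push_cast
    ring_nf
  have hgauss : 0 < ∫ x : ℝ, Real.exp (-x ^ 2) := by
    rw [show ∫ x : ℝ, Real.exp (-x ^ 2) = √Real.pi by simpa using integral_gaussian 1]
    exact Real.sqrt_pos.2 Real.pi_pos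
  have := Real.Gamma_pos_of_pos (s := 1 / 2) (by norm_num)
  have := Real.Gamma_pos_of_pos (s := α / 2) (by positivity)
  have hsin : 0 < Real.sin (Real.pi * (α / 2)) :=
    Real.sin_pos_of_pos_of_lt_pi (by positivity) (by nlinarith [Real.pi_pos])
  simp only [gaussianMellin, zero_mul, Complex.ofReal_zero, add_zero]
  rw [integral_mul_const, integral_complex_ofReal, Complex.im_ofReal_mul, hsymbol,
    Complex.im_ofReal_mul, Complex.exp_ofReal_mul_I_im]
  positivity

lemma exists_forall_le_of_continuousOn_prod_Icc {X : Type*} [TopologicalSpace X] {K : Set X}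
    (hK : IsCompact K) {f : X × ℝ → ℝ} {δ : ℝ} (hδ : 0 < δ)
    (hf : ContinuousOn f (K ×ˢ Icc 0 δ)) (hpos : ∀ x ∈ K, 0 < f (x, 0)) :
    ∃ ε > 0, ∃ c > 0, ∀ x ∈ K, c ≤ f (x, ε) := by
  have hzero : (0 : ℝ) ∈ Icc 0 δ := left_mem_Icc.2 hδ.le
  have hcont : ContinuousOn (fun x ↦ f (x, 0)) K :=
    hf.comp (by fun_prop) fun x hx ↦ ⟨hx, hzero⟩
  obtain ⟨c, hc, hcf⟩ := hK.exists_forall_le' hcont hpos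
  have hnear : ∀ᶠ ε in 𝓝 (0 : ℝ), ∀ x ∈ K, x ∈ K → ε ∈ Icc 0 δ → c / 2 < f (x, ε) := by
    refine hK.eventually_forall_of_forall_eventually fun x hx ↦ ?_
    have hlt : c / 2 < f (x, 0) := (half_lt_self hc).trans_le (hcf x hx)
    have hev := eventually_nhdsWithin_iff.1
      ((hf (x, 0) ⟨hx, hzero⟩).eventually (lt_mem_nhds hlt))
    filter_upwards [(continuous_swap.tendsto ((0 : ℝ), x)).eventually hev] with z hz h₁ h₂
    exact hz ⟨h₁, h₂⟩
  have hright : ∀ᶠ ε in 𝓝[>] (0 : ℝ), ε ∈ Ioc 0 δ := Ioc_mem_nhdsGT hδ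
  obtain ⟨ε, hε, hεδ⟩ := ((hnear.filter_mono nhdsWithin_le_nhds).and hright).exists
  exact ⟨ε, hεδ.1, c / 2, half_pos hc, fun x hx ↦ (hε x hx hx ⟨hεδ.1.le, hεδ.2⟩).le⟩

lemma exists_le_integral_wrightDensity_mul_logGaussian {α₀ : ℝ} (hα₀ : 0 < α₀) :
    ∃ ε > 0, ∃ c > 0, ∀ α, α₀ ≤ α → α < 1 →
      c ≤ ∫ θ in Ioi (0 : ℝ), wrightDensity α θ * logGaussian ε θ := by
  obtain ⟨ε, hε, c, hc, hle⟩ := exists_forall_le_of_continuousOn_prod_Icc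
    (isCompact_Icc (a := α₀) (b := 1)) one_pos
    (Complex.continuous_im.comp_continuousOn (continuousOn_gaussianMellin hα₀))
    fun α hα ↦ im_gaussianMellin_zero_pos (hα₀.trans_le hα.1) hα.2
  have hπ : 0 < Real.pi * √Real.pi := mul_pos Real.pi_pos (Real.sqrt_pos.2 Real.pi_pos)
  refine ⟨ε, hε, c / (Real.pi * √Real.pi), div_pos hc hπ, fun α hα hα₁ ↦ ?_⟩
  rw [div_le_iff₀' hπ, integral_wrightDensity_mul_logGaussian (hα₀.trans_le hα) hα₁]
  exact hle α ⟨hα, hα₁.le⟩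

lemma rpow_mul_logGaussian_le {ε : ℝ} (hε : ε ≠ 0) (k : ℝ) {θ : ℝ} (hθ : 0 < θ) :
    θ ^ k * logGaussian ε θ ≤ Real.exp ((k - 1 / 2) ^ 2 / ε ^ 2) := by
  have hexp : θ ^ k * logGaussian ε θ =
      Real.exp ((k - 1 / 2) * Real.log θ + -(ε * Real.log θ) ^ 2 / 4) := by
    rw [logGaussian, ← mul_assoc, ← Real.rpow_add hθ, Real.rpow_def_of_pos hθ, ← Real.exp_add]
    ring_nf
  rw [hexp, Real.exp_le_exp, le_div_iff₀ (by positivity)]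
  nlinarith [sq_nonneg (ε ^ 2 * Real.log θ / 2 - (k - 1 / 2))]

lemma exists_logGaussian_le_mul {ε : ℝ} (hε : ε ≠ 0) (j m : ℝ) :
    ∃ B > 0, ∀ θ, 0 < θ → logGaussian ε θ ≤ B * (θ ^ j * min 1 (1 / θ) ^ m) := by
  refine ⟨max (Real.exp ((-j - 1 / 2) ^ 2 / ε ^ 2)) (Real.exp ((m - j - 1 / 2) ^ 2 / ε ^ 2)),
    lt_max_of_lt_left (Real.exp_pos _), fun θ hθ ↦ ?_⟩
  have hθj : 0 < θ ^ j := Real.rpow_pos_of_pos hθ j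
  have hθm : 0 < θ ^ m := Real.rpow_pos_of_pos hθ m
  rcases le_total 1 (1 / θ) with h | h
  · have hle := rpow_mul_logGaussian_le hε (-j) hθ
    rw [Real.rpow_neg hθ.le, inv_mul_le_iff₀ hθj, mul_comm] at hle
    rw [min_eq_left h, Real.one_rpow, mul_one]
    exact hle.trans (mul_le_mul_of_nonneg_right (le_max_left _ _) hθj.le)
  · have hle := rpow_mul_logGaussian_le hε (m - j) hθ
    rw [Real.rpow_sub hθ, div_mul_eq_mul_div, div_le_iff₀ hθj] at hle
    rw [min_eq_right h, one_div θ, Real.inv_rpow hθ.le, ← mul_assoc, ← div_eq_mul_inv,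
      le_div_iff₀ hθm, mul_comm _ (θ ^ m)]
    exact hle.trans (mul_le_mul_of_nonneg_right (le_max_right _ _) hθj.le)

-- Only the positive part of the density is used, so its positivity need not be known.
lemma exists_le_lintegral_wrightDensity {α₀ : ℝ} (hα₀ : 0 < α₀) (j m : ℝ) :
    ∃ c > 0, ∀ α, α₀ ≤ α → α < 1 → ENNReal.ofReal c ≤
      ∫⁻ θ in Ioi (0 : ℝ), ENNReal.ofReal (θ ^ j * wrightDensity α θ) *
        ENNReal.ofReal (min 1 (1 / θ) ^ m) := by
  obtain ⟨ε, hε, c, hc, hlow⟩ := exists_le_integral_wrightDensity_mul_logGaussian hα₀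
  obtain ⟨B, hB, hle⟩ := exists_logGaussian_le_mul hε.ne' j m
  refine ⟨c / B, div_pos hc hB, fun α hα hα₁ ↦ ?_⟩
  rw [ENNReal.ofReal_div_of_pos hB]
  refine ENNReal.div_le_of_le_mul' ?_
  rw [← lintegral_const_mul' _ _ ENNReal.ofReal_ne_top]
  calc ENNReal.ofReal c
      ≤ ENNReal.ofReal (∫ θ in Ioi (0 : ℝ), wrightDensity α θ * logGaussian ε θ) :=
        ENNReal.ofReal_le_ofReal (hlow α hα hα₁)
    _ ≤ ∫⁻ θ in Ioi (0 : ℝ), ENNReal.ofReal (wrightDensity α θ * logGaussian ε θ) := by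
        rw [integral_eq_lintegral_pos_part_sub_lintegral_neg_part
          (integrableOn_wrightDensity_mul_logGaussian (hα₀.trans_le hα) hα₁ ε)]
        exact (ENNReal.ofReal_le_ofReal (sub_le_self _ ENNReal.toReal_nonneg)).trans
          ENNReal.ofReal_toReal_le
    _ ≤ ∫⁻ θ in Ioi (0 : ℝ), ENNReal.ofReal B * (ENNReal.ofReal (θ ^ j * wrightDensity α θ) *
          ENNReal.ofReal (min 1 (1 / θ) ^ m)) := by
        refine setLIntegral_mono' measurableSet_Ioi fun θ (hθ : 0 < θ) ↦ ?_
        have : 0 ≤ min 1 (1 / θ) ^ m := by positivity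
        rcases le_or_gt (wrightDensity α θ) 0 with hneg | hpos
        · rw [ENNReal.ofReal_of_nonpos
            (mul_nonpos_of_nonpos_of_nonneg hneg (logGaussian_nonneg ε hθ.le))]
          exact zero_le
        · rw [← ENNReal.ofReal_mul (by positivity), ← ENNReal.ofReal_mul hB.le]
          refine ENNReal.ofReal_le_ofReal
            ((mul_le_mul_of_nonneg_left (hle θ hθ) hpos.le).trans_eq ?_)
          ring

lemma lintegral_wrightDensity_mul_rpow_lt_top {α k : ℝ} (hα₀ : 0 < α) (hα₁ : α < 1) (hk : -1 < k)
    (hkα : k < 1 / α) :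
    ∫⁻ θ in Ioi (0 : ℝ), ENNReal.ofReal (wrightDensity α θ) * ENNReal.ofReal (θ ^ k) < ∞ := by
  obtain ⟨C, hC⟩ := exists_abs_wrightDensity_le hα₀ hα₁
  obtain ⟨D, hD⟩ := exists_abs_wrightDensity_le_rpow hα₀ hα₁
  rw [← Ioc_union_Ioi_eq_Ioi zero_le_one]
  refine (lintegral_union_le _ _ _).trans_lt (ENNReal.add_lt_top.2 ⟨?_, ?_⟩)
  · have hinteg : IntegrableOn (fun θ : ℝ ↦ C * θ ^ k) (Ioc 0 1) :=
      ((intervalIntegrable_iff_integrableOn_Ioc_of_le zero_le_one).1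
        (intervalIntegral.intervalIntegrable_rpow' hk)).const_mul C
    refine (setLIntegral_mono' measurableSet_Ioc fun θ hθ ↦ ?_).trans_lt hinteg.lintegral_lt_top
    rw [ENNReal.ofReal_mul' (Real.rpow_nonneg hθ.1.le k)]
    gcongr
    exact (le_abs_self _).trans (hC θ hθ.1.le)
  · have hinteg : IntegrableOn (fun θ : ℝ ↦ D * θ ^ (-(1 + 1 / α) + k)) (Ioi 1) :=
      (integrableOn_Ioi_rpow_of_lt (by linarith) one_pos).const_mul D
    refine (setLIntegral_mono' measurableSet_Ioi fun θ hθ ↦ ?_).trans_lt hinteg.lintegral_lt_top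
    have hθ₀ : 0 < θ := zero_lt_one.trans hθ
    rw [Real.rpow_add hθ₀, ← mul_assoc, ENNReal.ofReal_mul' (Real.rpow_nonneg hθ₀.le k)]
    gcongr
    exact (le_abs_self _).trans (hD θ hθ₀)

lemma lintegral_mul_wrightDensity_mul_rpow_lt_top {α k : ℝ} (hα₀ : 0 < α) (hα₁ : α < 1)
    (hk : -2 < k) (hkα : k < 1 / α - 1) :
    ∫⁻ θ in Ioi (0 : ℝ), ENNReal.ofReal (θ * wrightDensity α θ) * ENNReal.ofReal (θ ^ k) < ∞ := by
  refine (setLIntegral_congr_fun measurableSet_Ioi fun θ (hθ : 0 < θ) ↦ ?_).trans_lt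
    (lintegral_wrightDensity_mul_rpow_lt_top hα₀ hα₁ (k := 1 + k) (by linarith) (by linarith))
  rw [Real.rpow_add hθ, Real.rpow_one, ENNReal.ofReal_mul hθ.le, ENNReal.ofReal_mul hθ.le]
  ring

variable {N : ℕ}

local notation "ℝᴺ" => EuclideanSpace ℝ (Fin N)

/-! ### The heat kernel and the integral equation -/

lemma one_lt_fujitaExponent (hN : 1 ≤ N) : 1 < fujitaExponent N := by
  rw [fujitaExponent, lt_add_iff_pos_right]
  positivity

lemma heatKernel_nonneg {t : ℝ} (ht : 0 ≤ t) (x : ℝᴺ) : 0 ≤ heatKernel t x := by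
  unfold heatKernel; positivity

lemma heatKernel_sub_comm (t : ℝ) (x y : ℝᴺ) : heatKernel t (x - y) = heatKernel t (y - x) := by
  rw [heatKernel, heatKernel, norm_sub_rev]

lemma measurable_heatKernel : Measurable fun z : ℝ × ℝᴺ ↦ heatKernel z.1 z.2 := by
  unfold heatKernel; fun_prop

lemma heatKernel_rpow {τ q : ℝ} (hτ : 0 < τ) (x : ℝᴺ) :
    heatKernel τ x ^ q =
      (4 * Real.pi * τ) ^ (-((N : ℝ) / 2) * q) * Real.exp (-(q / (4 * τ)) * ‖x‖ ^ 2) := by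
  rw [heatKernel, Real.mul_rpow (by positivity) (by positivity), ← Real.rpow_mul (by positivity),
    ← Real.exp_mul]
  ring_nf

lemma lintegral_heatKernel_rpow {τ q : ℝ} (hτ : 0 < τ) (hq : 0 < q) (y : ℝᴺ) :
    ∫⁻ x, ENNReal.ofReal (heatKernel τ (x - y)) ^ q =
      ENNReal.ofReal ((4 * Real.pi * τ) ^ (-((N : ℝ) / 2) * (q - 1)) * q ^ (-((N : ℝ) / 2))) := by
  have hb : 0 < q / (4 * τ) := by positivity
  have hinteg : Integrable fun x : ℝᴺ ↦ Real.exp (-(q / (4 * τ)) * ‖x‖ ^ 2) := by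
    refine .of_integral_ne_zero ?_
    rw [GaussianFourier.integral_rexp_neg_mul_sq_norm hb]
    positivity
  have hwidth : Real.pi / (q / (4 * τ)) = (4 * Real.pi * τ) * q⁻¹ := by field_simp
  rw [lintegral_sub_right_eq_self (fun x ↦ ENNReal.ofReal (heatKernel τ x) ^ q) y]
  simp only [ENNReal.ofReal_rpow_of_nonneg (heatKernel_nonneg hτ.le _) hq.le, heatKernel_rpow hτ]
  rw [← ofReal_integral_eq_lintegral_ofReal (hinteg.const_mul _)
    (.of_forall fun x ↦ by positivity), integral_const_mul,
    GaussianFourier.integral_rexp_neg_mul_sq_norm hb, finrank_euclideanSpace_fin, hwidth,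
    Real.mul_rpow (x := 4 * Real.pi * τ) (by positivity) (by positivity), ← mul_assoc,
    ← Real.rpow_add (by positivity), Real.inv_rpow hq.le, ← Real.rpow_neg hq.le]
  ring_nf

lemma lintegral_heatKernel {τ : ℝ} (hτ : 0 < τ) (y : ℝᴺ) :
    ∫⁻ x, ENNReal.ofReal (heatKernel τ (x - y)) = 1 := by
  simpa using lintegral_heatKernel_rpow hτ one_pos y

lemma lintegral_heatKernel_left {τ : ℝ} (hτ : 0 < τ) (x : ℝᴺ) :
    ∫⁻ y, ENNReal.ofReal (heatKernel τ (x - y)) = 1 := by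
  simpa only [heatKernel_sub_comm] using lintegral_heatKernel hτ x

lemma lintegral_heatKernel_rpow_fujitaExponent_le (hN : 1 ≤ N) {τ : ℝ} (hτ : 0 < τ) (y : ℝᴺ) :
    ∫⁻ x, ENNReal.ofReal (heatKernel τ (x - y)) ^ fujitaExponent N ≤ ENNReal.ofReal τ⁻¹ := by
  have hp := one_lt_fujitaExponent hN
  have hexponent : -((N : ℝ) / 2) * (fujitaExponent N - 1) = -1 := by
    unfold fujitaExponent; field_simp; ring
  rw [lintegral_heatKernel_rpow hτ (by linarith) y, hexponent, Real.rpow_neg_one]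
  refine ENNReal.ofReal_le_ofReal ?_
  have hconst : fujitaExponent N ^ (-((N : ℝ) / 2)) ≤ 1 :=
    Real.rpow_le_one_of_one_le_of_nonpos hp.le (neg_nonpos.2 (by positivity))
  have hτ_le : τ ≤ 4 * Real.pi * τ := by nlinarith [Real.pi_gt_three]
  exact (mul_le_of_le_one_right (by positivity) hconst).trans (inv_anti₀ hτ hτ_le)

lemma volume_real_ball_zero_one_pos : 0 < volume.real (Metric.ball (0 : ℝᴺ) 1) :=
  ENNReal.toReal_pos (Metric.measure_ball_pos _ _ one_pos).ne' measure_ball_lt_top.ne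

lemma exists_closedBall_half_subset_inter {E : Type*} [SeminormedAddCommGroup E] [NormedSpace ℝ E]
    {r ρ : ℝ} (hρ : 0 < ρ) (hr : 0 ≤ r) (hrρ : r ≤ ρ) {y : E} (hy : ‖y‖ ≤ ρ) :
    ∃ z, Metric.closedBall z (r / 2) ⊆ Metric.closedBall 0 ρ ∩ Metric.closedBall y r := by
  have hc₀ : 0 ≤ r / (2 * ρ) := by positivity
  have hc₁ : r / (2 * ρ) ≤ 1 := by rw [div_le_one₀ (by positivity)]; linarith
  refine ⟨(1 - r / (2 * ρ)) • y, subset_inter ?_ ?_⟩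
  · refine Metric.closedBall_subset_closedBall' ?_
    rw [dist_zero_right, norm_smul, Real.norm_of_nonneg (sub_nonneg.2 hc₁)]
    calc r / 2 + (1 - r / (2 * ρ)) * ‖y‖ ≤ r / 2 + (1 - r / (2 * ρ)) * ρ := by gcongr
      _ = ρ := by field_simp; ring
  · refine Metric.closedBall_subset_closedBall' ?_
    rw [dist_eq_norm, show (1 - r / (2 * ρ)) • y - y = -(r / (2 * ρ)) • y by module, norm_smul,
      norm_neg, Real.norm_of_nonneg hc₀]
    calc r / 2 + r / (2 * ρ) * ‖y‖ ≤ r / 2 + r / (2 * ρ) * ρ := by gcongr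
      _ = r := by field_simp; ring

lemma min_sqrt_sq {τ ρ : ℝ} (hτ : 0 ≤ τ) (hρ : 0 ≤ ρ) : min √τ ρ ^ 2 = min τ (ρ ^ 2) := by
  rw [(pow_left_monotoneOn (n := 2)).map_min (Real.sqrt_nonneg τ) hρ, Real.sq_sqrt hτ]

lemma le_heatKernel_of_norm_sq_le {τ : ℝ} (hτ : 0 < τ) {x : ℝᴺ} (hx : ‖x‖ ^ 2 ≤ τ) :
    (4 * Real.pi * τ) ^ (-((N : ℝ) / 2)) * Real.exp (-(1 / 4)) ≤ heatKernel τ x := by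
  unfold heatKernel
  gcongr ?_ * Real.exp ?_
  rw [neg_div, neg_le_neg_iff, div_le_div_iff₀ (by positivity) (by norm_num)]
  linarith

lemma rpow_mul_half_pow {τ r : ℝ} (hτ : 0 < τ) (hr : 0 ≤ r) (n : ℕ) :
    (4 * Real.pi * τ) ^ (-((n : ℝ) / 2)) * (r / 2) ^ n =
      (16 * Real.pi) ^ (-((n : ℝ) / 2)) * (r ^ 2 / τ) ^ ((n : ℝ) / 2) := by
  have hpow : (r / 2) ^ n = (τ / 4) ^ ((n : ℝ) / 2) * (r ^ 2 / τ) ^ ((n : ℝ) / 2) := by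
    rw [← Real.mul_rpow (by positivity) (by positivity),
      show τ / 4 * (r ^ 2 / τ) = (r / 2) ^ (2 : ℝ) by rw [Real.rpow_two]; field_simp; ring,
      ← Real.rpow_mul (by positivity), mul_div_cancel₀ _ two_ne_zero, Real.rpow_natCast]
  rw [hpow, ← mul_assoc, show 16 * Real.pi = 4 * Real.pi * τ * (τ / 4)⁻¹ by field_simp; norm_num,
    Real.mul_rpow (x := 4 * Real.pi * τ) (by positivity) (by positivity),
    Real.inv_rpow (by positivity), ← Real.rpow_neg (by positivity), neg_neg]

lemma exists_le_setLIntegral_heatKernel :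
    ∃ c > 0, ∀ ρ τ : ℝ, 0 < ρ → 0 < τ → ∀ y : ℝᴺ, ‖y‖ ≤ ρ →
      ENNReal.ofReal (c * min 1 (ρ ^ 2 / τ) ^ ((N : ℝ) / 2)) ≤
        ∫⁻ x in Metric.closedBall 0 ρ, ENNReal.ofReal (heatKernel τ (x - y)) := by
  set ω := volume.real (Metric.ball (0 : ℝᴺ) 1) with hω
  have hω₀ : 0 < ω := volume_real_ball_zero_one_pos
  refine ⟨Real.exp (-(1 / 4)) * ω * (16 * Real.pi) ^ (-((N : ℝ) / 2)), by positivity,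
    fun ρ τ hρ hτ y hy ↦ ?_⟩
  have hr : 0 ≤ min √τ ρ := by positivity
  have hr_sq := min_sqrt_sq hτ.le hρ.le
  obtain ⟨z, hz⟩ := exists_closedBall_half_subset_inter hρ hr (min_le_right _ _) hy
  have hlow : ∀ x ∈ Metric.closedBall z (min √τ ρ / 2),
      ENNReal.ofReal ((4 * Real.pi * τ) ^ (-((N : ℝ) / 2)) * Real.exp (-(1 / 4))) ≤
        ENNReal.ofReal (heatKernel τ (x - y)) := fun x hx ↦ by
    refine ENNReal.ofReal_le_ofReal (le_heatKernel_of_norm_sq_le hτ ?_)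
    calc ‖x - y‖ ^ 2 ≤ min √τ ρ ^ 2 := by gcongr; exact mem_closedBall_iff_norm.1 (hz hx).2
      _ ≤ τ := hr_sq.trans_le (min_le_left _ _)
  calc ENNReal.ofReal (Real.exp (-(1 / 4)) * ω * (16 * Real.pi) ^ (-((N : ℝ) / 2)) *
        min 1 (ρ ^ 2 / τ) ^ ((N : ℝ) / 2))
      = ENNReal.ofReal ((4 * Real.pi * τ) ^ (-((N : ℝ) / 2)) * Real.exp (-(1 / 4))) *
        volume (Metric.closedBall z (min √τ ρ / 2)) := by
        have hmin : min 1 (ρ ^ 2 / τ) = min √τ ρ ^ 2 / τ := by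
          rw [hr_sq, ← min_div_div_right hτ.le, div_self hτ.ne']
        rw [Measure.addHaar_closedBall _ _ (by positivity), finrank_euclideanSpace_fin,
          ← ofReal_measureReal measure_ball_lt_top.ne, ← hω, ← ENNReal.ofReal_mul (by positivity),
          ← ENNReal.ofReal_mul (by positivity), hmin, mul_assoc (_ * ω),
          ← rpow_mul_half_pow hτ hr]
        ring_nf
    _ ≤ ∫⁻ x in Metric.closedBall z (min √τ ρ / 2), ENNReal.ofReal (heatKernel τ (x - y)) := by
        rw [← setLIntegral_const]
        exact setLIntegral_mono' measurableSet_closedBall hlow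
    _ ≤ ∫⁻ x in Metric.closedBall 0 ρ, ENNReal.ofReal (heatKernel τ (x - y)) :=
        lintegral_mono_set (hz.trans inter_subset_left)

lemma measurable_heatSemigroup (μ : Measure ℝᴺ) [SFinite μ] :
    Measurable fun z : ℝ × ℝᴺ ↦ heatSemigroup z.1 μ z.2 :=
  Measurable.lintegral_prod_right' (f := fun w : (ℝ × ℝᴺ) × ℝᴺ ↦
      ENNReal.ofReal (heatKernel w.1.1 (w.1.2 - w.2)))
    (measurable_heatKernel.comp (g := fun z : ℝ × ℝᴺ ↦ heatKernel z.1 z.2)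
      (f := fun w : (ℝ × ℝᴺ) × ℝᴺ ↦ (w.1.1, w.1.2 - w.2)) (by fun_prop)).ennreal_ofReal

lemma measurable_operatorP {α : ℝ} (hα₀ : 0 < α) (hα₁ : α < 1) (μ : Measure ℝᴺ) [SFinite μ] :
    Measurable fun z : ℝ × ℝᴺ ↦ operatorP α z.1 μ z.2 :=
  Measurable.lintegral_prod_right' (f := fun w : (ℝ × ℝᴺ) × ℝ ↦
      ENNReal.ofReal (wrightDensity α w.2) * heatSemigroup (w.1.1 ^ α * w.2) μ w.1.2)
    (((measurable_wrightDensity hα₀ hα₁).comp measurable_snd).ennreal_ofReal.mul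
      ((measurable_heatSemigroup μ).comp
        (f := fun w : (ℝ × ℝᴺ) × ℝ ↦ (w.1.1 ^ α * w.2, w.1.2)) (by fun_prop)))

lemma heatSemigroup_withDensity {f : ℝᴺ → ℝ≥0∞} (hf : Measurable f) (t : ℝ) (x : ℝᴺ) :
    heatSemigroup t (volume.withDensity f) x =
      ∫⁻ y, f y * ENNReal.ofReal (heatKernel t (x - y)) :=
  lintegral_withDensity_eq_lintegral_mul _ hf
    (measurable_heatKernel.comp (f := fun y : ℝᴺ ↦ (t, x - y)) (by fun_prop)).ennreal_ofReal

lemma measurable_heatSemigroup_withDensity {f : ℝ → ℝᴺ → ℝ≥0∞}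
    (hf : Measurable fun z : ℝ × ℝᴺ ↦ f z.1 z.2) :
    Measurable fun z : (ℝ × ℝ) × ℝᴺ ↦
      heatSemigroup z.1.1 (volume.withDensity (f z.1.2)) z.2 := by
  have hslice : ∀ s, Measurable (f s) := fun s ↦ hf.comp measurable_prodMk_left
  simp only [heatSemigroup_withDensity (hslice _)]
  exact Measurable.lintegral_prod_right' (f := fun w : ((ℝ × ℝ) × ℝᴺ) × ℝᴺ ↦
      f w.1.1.2 w.2 * ENNReal.ofReal (heatKernel w.1.1.1 (w.1.2 - w.2)))
    ((hf.comp (f := fun w : ((ℝ × ℝ) × ℝᴺ) × ℝᴺ ↦ (w.1.1.2, w.2)) (by fun_prop)).mul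
      (measurable_heatKernel.comp (f := fun w : ((ℝ × ℝ) × ℝᴺ) × ℝᴺ ↦ (w.1.1.1, w.1.2 - w.2))
        (by fun_prop)).ennreal_ofReal)

lemma measurable_operatorS {α : ℝ} (hα₀ : 0 < α) (hα₁ : α < 1) {f : ℝ → ℝᴺ → ℝ≥0∞}
    (hf : Measurable fun z : ℝ × ℝᴺ ↦ f z.1 z.2) :
    Measurable fun z : (ℝ × ℝᴺ) × ℝ ↦
      operatorS α (z.1.1 - z.2) (volume.withDensity (f z.2)) z.1.2 :=
  Measurable.lintegral_prod_right' (f := fun w : ((ℝ × ℝᴺ) × ℝ) × ℝ ↦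
      ENNReal.ofReal (w.2 * wrightDensity α w.2) *
        heatSemigroup ((w.1.1.1 - w.1.2) ^ α * w.2) (volume.withDensity (f w.1.2)) w.1.1.2)
    ((measurable_snd.mul
        ((measurable_wrightDensity hα₀ hα₁).comp measurable_snd)).ennreal_ofReal.mul
      ((measurable_heatSemigroup_withDensity hf).comp (f := fun w : ((ℝ × ℝᴺ) × ℝ) × ℝ ↦
        (((w.1.1.1 - w.1.2) ^ α * w.2, w.1.2), w.1.1.2)) (by fun_prop)))

lemma measurable_mildRHS {α : ℝ} (hα₀ : 0 < α) (hα₁ : α < 1) (p : ℝ) (μ : Measure ℝᴺ) [SFinite μ]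
    {u : ℝ → ℝᴺ → ℝ≥0∞} (hu : Measurable fun z : ℝ × ℝᴺ ↦ u z.1 z.2) :
    Measurable fun z : ℝ × ℝᴺ ↦ mildRHS p α μ u z.1 z.2 := by
  refine (measurable_operatorP hα₀ hα₁ μ).add (Measurable.const_mul ?_ _)
  have hset : MeasurableSet {w : (ℝ × ℝᴺ) × ℝ | w.2 ∈ Ioo 0 w.1.1} :=
    (measurableSet_lt measurable_const measurable_snd).inter
      (measurableSet_lt measurable_snd measurable_fst.fst)
  simp only [← lintegral_indicator measurableSet_Ioo]
  exact Measurable.lintegral_prod_right' (f := {w : (ℝ × ℝᴺ) × ℝ | w.2 ∈ Ioo 0 w.1.1}.indicator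
      fun w ↦ ENNReal.ofReal ((w.1.1 - w.2) ^ (α - 1)) *
        operatorS α (w.1.1 - w.2) (volume.withDensity fun y ↦ u w.2 y ^ p) w.1.2)
    (Measurable.indicator (Measurable.mul (by fun_prop)
      (measurable_operatorS hα₀ hα₁ (f := fun s y ↦ u s y ^ p) (hu.pow_const p))) hset)

lemma heatSemigroup_mono {μ ν : Measure ℝᴺ} (h : μ ≤ ν) (t : ℝ) (x : ℝᴺ) :
    heatSemigroup t μ x ≤ heatSemigroup t ν x :=
  lintegral_mono' h le_rfl

lemma operatorP_mono {μ ν : Measure ℝᴺ} (h : μ ≤ ν) (α t : ℝ) (x : ℝᴺ) :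
    operatorP α t μ x ≤ operatorP α t ν x :=
  lintegral_mono fun _ ↦ mul_le_mul_right (heatSemigroup_mono h _ _) _

lemma operatorS_mono {μ ν : Measure ℝᴺ} (h : μ ≤ ν) (α t : ℝ) (x : ℝᴺ) :
    operatorS α t μ x ≤ operatorS α t ν x :=
  lintegral_mono fun _ ↦ mul_le_mul_right (heatSemigroup_mono h _ _) _

lemma mildRHS_mono_of_ae_le {p α T : ℝ} (hp : 0 ≤ p) {μ ν : Measure ℝᴺ} (hμν : μ ≤ ν)
    {u v : ℝ → ℝᴺ → ℝ≥0∞} (huv : ∀ᵐ t ∂(volume.restrict (Ioc (0 : ℝ) T)), ∀ᵐ x, u t x ≤ v t x)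
    {t : ℝ} (ht : t ≤ T) (x : ℝᴺ) : mildRHS p α μ u t x ≤ mildRHS p α ν v t x := by
  refine add_le_add (operatorP_mono hμν _ _ _) (mul_le_mul_right (lintegral_mono_ae ?_) _)
  filter_upwards [ae_restrict_of_ae_restrict_of_subset
    (Ioo_subset_Ioc_self.trans (Ioc_subset_Ioc_right ht)) huv] with s hs
  refine mul_le_mul_right (operatorS_mono (withDensity_mono ?_) _ _ _) _
  filter_upwards [hs] with y hy using ENNReal.rpow_le_rpow hy hp

lemma mildRHS_mono {p : ℝ} (hp : 0 ≤ p) (α : ℝ) {μ ν : Measure ℝᴺ} (hμν : μ ≤ ν)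
    {u v : ℝ → ℝᴺ → ℝ≥0∞} (huv : u ≤ v) : mildRHS p α μ u ≤ mildRHS p α ν v := fun _ ↦
  mildRHS_mono_of_ae_le hp hμν (.of_forall fun s ↦ .of_forall (huv s)) le_rfl

lemma heatSemigroup_iSup {f : ℕ → ℝᴺ → ℝ≥0∞} (hf : ∀ n, Measurable (f n)) (hmono : Monotone f)
    (t : ℝ) (x : ℝᴺ) :
    heatSemigroup t (volume.withDensity fun y ↦ ⨆ n, f n y) x =
      ⨆ n, heatSemigroup t (volume.withDensity (f n)) x := by
  rw [heatSemigroup_withDensity (.iSup hf)]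
  simp only [heatSemigroup_withDensity (hf _), ENNReal.iSup_mul]
  exact lintegral_iSup (fun n ↦ (hf n).mul (measurable_heatKernel.comp
      (f := fun y : ℝᴺ ↦ (t, x - y)) (by fun_prop)).ennreal_ofReal)
    fun i j hij y ↦ mul_le_mul_left (hmono hij y) _

lemma operatorS_iSup {α : ℝ} (hα₀ : 0 < α) (hα₁ : α < 1) {f : ℕ → ℝᴺ → ℝ≥0∞}
    (hf : ∀ n, Measurable (f n)) (hmono : Monotone f) (t : ℝ) (x : ℝᴺ) :
    operatorS α t (volume.withDensity fun y ↦ ⨆ n, f n y) x =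
      ⨆ n, operatorS α t (volume.withDensity (f n)) x := by
  unfold operatorS
  simp only [heatSemigroup_iSup hf hmono, ENNReal.mul_iSup]
  refine lintegral_iSup (fun n ↦ ?_) fun i j hij θ ↦ mul_le_mul_right ?_ _
  · exact (measurable_id.mul (measurable_wrightDensity hα₀ hα₁)).ennreal_ofReal.mul
      ((measurable_heatSemigroup (volume.withDensity (f n))).comp
        (f := fun θ : ℝ ↦ (t ^ α * θ, x)) (by fun_prop))
  · exact heatSemigroup_mono (withDensity_mono (.of_forall (hmono hij))) _ _

lemma mildRHS_iSup {p α : ℝ} (hp : 0 < p) (hα₀ : 0 < α) (hα₁ : α < 1) (μ : Measure ℝᴺ)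
    {u : ℕ → ℝ → ℝᴺ → ℝ≥0∞} (hu : ∀ n, Measurable fun z : ℝ × ℝᴺ ↦ u n z.1 z.2)
    (hmono : Monotone u) (t : ℝ) (x : ℝᴺ) :
    mildRHS p α μ (fun s y ↦ ⨆ n, u n s y) t x = ⨆ n, mildRHS p α μ (u n) t x := by
  have hpow : ∀ s, Monotone fun n y ↦ u n s y ^ p := fun s i j hij y ↦
    ENNReal.rpow_le_rpow (hmono hij s y) hp.le
  have hiSup : ∀ s : ℝ, operatorS α (t - s) (volume.withDensity fun y ↦ (⨆ n, u n s y) ^ p) x =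
      ⨆ n, operatorS α (t - s) (volume.withDensity fun y ↦ u n s y ^ p) x := fun s ↦ by
    have hrpow : ∀ y, (⨆ n, u n s y) ^ p = ⨆ n, u n s y ^ p := fun y ↦
      (ENNReal.orderIsoRpow p hp).map_iSup fun n ↦ u n s y
    simp only [hrpow]
    exact operatorS_iSup hα₀ hα₁ (fun n ↦ ((hu n).comp measurable_prodMk_left).pow_const p)
      (hpow s) (t - s) x
  have hmeas : ∀ n, Measurable fun s : ℝ ↦
      operatorS α (t - s) (volume.withDensity fun y ↦ u n s y ^ p) x := fun n ↦
    (measurable_operatorS hα₀ hα₁ (f := fun s y ↦ u n s y ^ p) ((hu n).pow_const p)).comp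
      (f := fun s : ℝ ↦ ((t, x), s)) (by fun_prop)
  unfold mildRHS
  rw [← ENNReal.add_iSup, ← ENNReal.mul_iSup]
  congr 2
  simp only [hiSup, ENNReal.mul_iSup]
  exact lintegral_iSup (fun n ↦ Measurable.mul (by fun_prop) (hmeas n)) fun i j hij s ↦
    mul_le_mul_right (operatorS_mono (withDensity_mono (.of_forall (hpow s hij))) _ _ _) _

/-- The Picard iterates of the integral equation, starting from `0`. -/
def picard (p α : ℝ) (μ : Measure ℝᴺ) : ℕ → ℝ → ℝᴺ → ℝ≥0∞
  | 0 => 0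
  | n + 1 => mildRHS p α μ (picard p α μ n)

/-- The increasing limit of the Picard iterates. Where it is finite, it is the minimal solution. -/
def picardLimit (p α : ℝ) (μ : Measure ℝᴺ) (t : ℝ) (x : ℝᴺ) : ℝ≥0∞ := ⨆ n, picard p α μ n t x

/-- The Picard limit is finite almost everywhere on `(0, T] × ℝ^N`: this is the criterion for the
existence of the minimal solution, see `exists_isMinimalSolution_iff_finiteUpTo`. -/
def FiniteUpTo (p α : ℝ) (μ : Measure ℝᴺ) (T : ℝ) : Prop :=
  ∀ᵐ t ∂(volume.restrict (Ioc (0 : ℝ) T)), ∀ᵐ x, picardLimit p α μ t x < ∞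

section Picard

variable {p α T : ℝ} {μ ν : Measure (EuclideanSpace ℝ (Fin N))}

lemma measurable_picard [SFinite μ] (hα₀ : 0 < α) (hα₁ : α < 1) (n : ℕ) :
    Measurable fun z : ℝ × ℝᴺ ↦ picard p α μ n z.1 z.2 := by
  induction n with
  | zero => exact measurable_const
  | succ n ih => exact measurable_mildRHS hα₀ hα₁ p μ ih

lemma measurable_picardLimit [SFinite μ] (hα₀ : 0 < α) (hα₁ : α < 1) :
    Measurable fun z : ℝ × ℝᴺ ↦ picardLimit p α μ z.1 z.2 :=
  .iSup fun n ↦ measurable_picard hα₀ hα₁ n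

lemma monotone_picard (hp : 0 ≤ p) : Monotone (picard p α μ) := by
  refine monotone_nat_of_le_succ fun n ↦ ?_
  induction n with
  | zero => exact fun _ _ ↦ zero_le
  | succ n ih => exact mildRHS_mono hp α le_rfl ih

lemma picardLimit_eq_mildRHS [SFinite μ] (hp : 0 < p) (hα₀ : 0 < α) (hα₁ : α < 1) (t : ℝ)
    (x : ℝᴺ) : picardLimit p α μ t x = mildRHS p α μ (picardLimit p α μ) t x := by
  refine Eq.trans ?_ (mildRHS_iSup hp hα₀ hα₁ μ
    (fun n ↦ measurable_picard (p := p) (μ := μ) hα₀ hα₁ n) (monotone_picard hp.le) t x).symm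
  exact le_antisymm (iSup_mono fun n ↦ monotone_picard hp.le n.le_succ t x)
    (iSup_le fun n ↦ le_iSup_of_le (n + 1) le_rfl)

lemma picardLimit_le_of_mildRHS_le {v : ℝ → ℝᴺ → ℝ≥0∞} (hp : 0 ≤ p)
    (hv : ∀ᵐ t ∂(volume.restrict (Ioc (0 : ℝ) T)), ∀ᵐ x, mildRHS p α μ v t x ≤ v t x) :
    ∀ᵐ t ∂(volume.restrict (Ioc (0 : ℝ) T)), ∀ᵐ x, picardLimit p α μ t x ≤ v t x := by
  have hpicard : ∀ n, ∀ᵐ t ∂(volume.restrict (Ioc (0 : ℝ) T)), ∀ᵐ x,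
      picard p α μ n t x ≤ v t x := by
    intro n
    induction n with
    | zero => exact .of_forall fun _ ↦ .of_forall fun _ ↦ zero_le
    | succ n ih =>
      filter_upwards [hv, self_mem_ae_restrict measurableSet_Ioc] with t ht hT
      filter_upwards [ht] with x hx
      exact (mildRHS_mono_of_ae_le hp le_rfl ih hT.2 x).trans hx
  filter_upwards [ae_all_iff.2 hpicard] with t ht
  filter_upwards [ae_all_iff.2 ht] with x hx using iSup_le hx

lemma picardLimit_mono (hp : 0 ≤ p) (hμν : μ ≤ ν) (t : ℝ) (x : ℝᴺ) :
    picardLimit p α μ t x ≤ picardLimit p α ν t x := by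
  have hpicard : ∀ n, picard p α μ n ≤ picard p α ν n := by
    intro n
    induction n with
    | zero => exact le_rfl
    | succ n ih => exact mildRHS_mono hp α hμν ih
  exact iSup_mono fun n ↦ hpicard n t x

lemma FiniteUpTo.mono_time {T' : ℝ} (h : FiniteUpTo p α μ T) (hT : T' ≤ T) :
    FiniteUpTo p α μ T' :=
  ae_restrict_of_ae_restrict_of_subset (Ioc_subset_Ioc_right hT) h

lemma FiniteUpTo.anti (hp : 0 ≤ p) (hμν : μ ≤ ν) (h : FiniteUpTo p α ν T) :
    FiniteUpTo p α μ T := by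
  filter_upwards [h] with t ht
  filter_upwards [ht] with x hx using (picardLimit_mono hp hμν t x).trans_lt hx

lemma exists_isMinimalSolution_iff_finiteUpTo [SFinite μ] (hp : 0 < p) (hα₀ : 0 < α)
    (hα₁ : α < 1) : (∃ u, IsMinimalSolution p α T μ u) ↔ FiniteUpTo p α μ T := by
  have hle : ∀ v, IsSolution p α T μ v → ∀ᵐ t ∂(volume.restrict (Ioc (0 : ℝ) T)),
      ∀ᵐ x, picardLimit p α μ t x ≤ v t x := fun v hv ↦ by
    refine picardLimit_le_of_mildRHS_le hp.le ?_
    filter_upwards [hv.eq_mildRHS] with t ht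
    filter_upwards [ht] with x hx using hx.2.ge
  refine ⟨fun ⟨u, hu⟩ ↦ ?_,
    fun h ↦ ⟨picardLimit p α μ, ⟨measurable_picardLimit hα₀ hα₁, ?_⟩, hle⟩⟩
  · filter_upwards [hu.isSolution.eq_mildRHS, hle u hu.isSolution] with t ht ht'
    filter_upwards [ht, ht'] with x hx hx' using hx'.trans_lt hx.1
  · filter_upwards [h] with t ht
    filter_upwards [ht] with x hx using ⟨hx, picardLimit_eq_mildRHS hp hα₀ hα₁ t x⟩

lemma lifeSpan_eq_sSup_finiteUpTo [SFinite μ] (hp : 0 < p) (hα₀ : 0 < α) (hα₁ : α < 1) :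
    lifeSpan p α μ =
      sSup {τ : ℝ≥0∞ | ∃ T : ℝ, 0 < T ∧ τ = ENNReal.ofReal T ∧ FiniteUpTo p α μ T} := by
  simp only [lifeSpan, exists_isMinimalSolution_iff_finiteUpTo hp hα₀ hα₁]

lemma FiniteUpTo.le_lifeSpan [SFinite μ] (h : FiniteUpTo p α μ T) (hp : 0 < p) (hα₀ : 0 < α)
    (hα₁ : α < 1) (hT : 0 < T) : ENNReal.ofReal T ≤ lifeSpan p α μ := by
  rw [lifeSpan_eq_sSup_finiteUpTo hp hα₀ hα₁]
  exact le_sSup ⟨T, hT, rfl, h⟩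

lemma finiteUpTo_of_lt_lifeSpan [SFinite μ] (hp : 0 < p) (hα₀ : 0 < α) (hα₁ : α < 1)
    (h : ENNReal.ofReal T < lifeSpan p α μ) : FiniteUpTo p α μ T := by
  rw [lifeSpan_eq_sSup_finiteUpTo hp hα₀ hα₁] at h
  obtain ⟨_, ⟨T', hT', rfl, hfinite⟩, hlt⟩ := lt_sSup_iff.1 h
  exact hfinite.mono_time ((ENNReal.ofReal_lt_ofReal_iff hT').1 hlt).le

lemma lifeSpan_anti [SFinite μ] [SFinite ν] (hp : 0 < p) (hα₀ : 0 < α) (hα₁ : α < 1)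
    (hμν : μ ≤ ν) : lifeSpan p α ν ≤ lifeSpan p α μ := by
  rw [lifeSpan_eq_sSup_finiteUpTo hp hα₀ hα₁, lifeSpan_eq_sSup_finiteUpTo hp hα₀ hα₁]
  refine sSup_le_sSup ?_
  rintro _ ⟨T, hT, rfl, h⟩
  exact ⟨T, hT, rfl, h.anti hp.le hμν⟩

end Picard

/-! ### Global existence for small mass -/

section Minkowski

variable {X Y : Type*} [MeasurableSpace X] [MeasurableSpace Y] {μ : Measure X} {ν : Measure Y}
  {p : ℝ}

lemma lintegral_rpow_le_mul_lintegral_rpow_mul (hp : 1 < p) {f b : Y → ℝ≥0∞}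
    (hf : AEMeasurable f ν) (hb : AEMeasurable b ν) (hb₀ : ∀ᵐ y ∂ν, b y ≠ 0)
    (hbtop : ∀ᵐ y ∂ν, b y ≠ ∞) :
    (∫⁻ y, f y ∂ν) ^ p ≤ (∫⁻ y, b y ∂ν) ^ (p - 1) * ∫⁻ y, f y ^ p * b y ^ (1 - p) ∂ν := by
  have hp₀ : 0 < p := by linarith
  have hp₁ : 0 < p - 1 := by linarith
  have hsplit : ∫⁻ y, f y ∂ν =
      ∫⁻ y, ((fun y ↦ b y ^ ((p - 1) / p)) * fun y ↦ f y * b y ^ (-((p - 1) / p))) y ∂ν := by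
    refine lintegral_congr_ae ?_
    filter_upwards [hb₀, hbtop] with y hy₀ hytop
    rw [Pi.mul_apply, mul_left_comm, ← ENNReal.rpow_add _ _ hy₀ hytop, add_neg_cancel,
      ENNReal.rpow_zero, mul_one]
  have hb_pow : ∀ y, (b y ^ ((p - 1) / p)) ^ (p / (p - 1)) = b y := fun y ↦ by
    rw [← ENNReal.rpow_mul, div_mul_div_cancel₀ hp₀.ne', div_self hp₁.ne', ENNReal.rpow_one]
  have hf_pow : ∀ y, (f y * b y ^ (-((p - 1) / p))) ^ p = f y ^ p * b y ^ (1 - p) := fun y ↦ by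
    rw [ENNReal.mul_rpow_of_nonneg _ _ hp₀.le, ← ENNReal.rpow_mul, neg_mul,
      div_mul_cancel₀ _ hp₀.ne', neg_sub]
  have hHolder := ENNReal.lintegral_mul_le_Lp_mul_Lq ν (Real.HolderConjugate.conjExponent hp).symm
    (f := fun y ↦ b y ^ ((p - 1) / p)) (g := fun y ↦ f y * b y ^ (-((p - 1) / p)))
    (hb.pow_const _) (hf.mul (hb.pow_const _))
  rw [← hsplit] at hHolder
  simp only [Real.conjExponent, hb_pow, hf_pow, one_div_div] at hHolder
  calc (∫⁻ y, f y ∂ν) ^ p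
      ≤ ((∫⁻ y, b y ∂ν) ^ ((p - 1) / p) * (∫⁻ y, f y ^ p * b y ^ (1 - p) ∂ν) ^ (1 / p)) ^ p :=
        ENNReal.rpow_le_rpow hHolder hp₀.le
    _ = (∫⁻ y, b y ∂ν) ^ (p - 1) * ∫⁻ y, f y ^ p * b y ^ (1 - p) ∂ν := by
        rw [ENNReal.mul_rpow_of_nonneg _ _ hp₀.le, ← ENNReal.rpow_mul, ← ENNReal.rpow_mul,
          one_div_mul_cancel hp₀.ne', ENNReal.rpow_one, div_mul_cancel₀ _ hp₀.ne']

lemma ae_ae_eq_zero_of_lintegral_rpow_eq_zero [SFinite μ] [SFinite ν] (hp : 0 < p)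
    {f : X → Y → ℝ≥0∞} (hf : Measurable (Function.uncurry f))
    (hzero : ∀ᵐ y ∂ν, ∫⁻ x, f x y ^ p ∂μ = 0) : ∀ᵐ x ∂μ, ∀ᵐ y ∂ν, f x y = 0 := by
  refine (Measure.ae_ae_comm (p := fun x y ↦ f x y = 0) (hf (measurableSet_singleton 0))).2 ?_
  filter_upwards [hzero] with y hy
  have hf_y : Measurable fun x ↦ f x y := hf.comp measurable_prodMk_right
  filter_upwards [(lintegral_eq_zero_iff (hf_y.pow_const p)).1 hy] with x hx using
    (ENNReal.rpow_eq_zero_iff_of_pos hp).1 hx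

lemma lintegral_lintegral_rpow_le_of_ne_zero [SFinite μ] [SFinite ν] (hp : 1 < p)
    {f : X → Y → ℝ≥0∞} (hf : Measurable (Function.uncurry f)) {b : Y → ℝ≥0∞}
    (hb : Measurable b) (hb₀ : ∀ᵐ y ∂ν, b y ≠ 0) (hbtop : ∀ᵐ y ∂ν, b y ≠ ∞)
    (hfb : ∀ y, ∫⁻ x, f x y ^ p ∂μ = b y ^ p) :
    ∫⁻ x, (∫⁻ y, f x y ∂ν) ^ p ∂μ ≤ (∫⁻ y, b y ∂ν) ^ p := by
  have hfp : Measurable (Function.uncurry fun x y ↦ f x y ^ p * b y ^ (1 - p)) :=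
    (hf.pow_const p).mul ((hb.comp measurable_snd).pow_const _)
  calc ∫⁻ x, (∫⁻ y, f x y ∂ν) ^ p ∂μ
      ≤ ∫⁻ x, (∫⁻ y, b y ∂ν) ^ (p - 1) * ∫⁻ y, f x y ^ p * b y ^ (1 - p) ∂ν ∂μ :=
        lintegral_mono fun x ↦ lintegral_rpow_le_mul_lintegral_rpow_mul hp
          (hf.comp measurable_prodMk_left).aemeasurable hb.aemeasurable hb₀ hbtop
    _ = (∫⁻ y, b y ∂ν) ^ (p - 1) * ∫⁻ y, ∫⁻ x, f x y ^ p * b y ^ (1 - p) ∂μ ∂ν := by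
        rw [← lintegral_lintegral_swap hfp.aemeasurable]
        exact lintegral_const_mul _ hfp.lintegral_prod_right'
    _ = (∫⁻ y, b y ∂ν) ^ (p - 1) * ∫⁻ y, b y ∂ν := by
        congr 1
        refine lintegral_congr_ae ?_
        filter_upwards [hb₀, hbtop] with y hy₀ hytop
        have hf_y : Measurable fun x ↦ f x y := hf.comp measurable_prodMk_right
        rw [lintegral_mul_const _ (hf_y.pow_const p), hfb,
          ← ENNReal.rpow_add _ _ hy₀ hytop, add_sub_cancel, ENNReal.rpow_one]
    _ = (∫⁻ y, b y ∂ν) ^ p := by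
        conv_lhs => rw [← ENNReal.rpow_one (∫⁻ y, b y ∂ν), ← ENNReal.rpow_mul, one_mul]
        rw [← ENNReal.rpow_add_of_nonneg _ _ (by linarith) zero_le_one, sub_add_cancel]

lemma lintegral_lintegral_rpow_le [SFinite μ] [SFinite ν] (hp : 1 < p) {f : X → Y → ℝ≥0∞}
    (hf : Measurable (Function.uncurry f)) :
    (∫⁻ x, (∫⁻ y, f x y ∂ν) ^ p ∂μ) ^ (1 / p) ≤ ∫⁻ y, (∫⁻ x, f x y ^ p ∂μ) ^ (1 / p) ∂ν := by
  have hp₀ : 0 < p := by linarith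
  set b : Y → ℝ≥0∞ := fun y ↦ (∫⁻ x, f x y ^ p ∂μ) ^ (1 / p) with hb_def
  have hfp : Measurable (Function.uncurry fun x y ↦ f x y ^ p) := hf.pow_const p
  have hb : Measurable b := hfp.lintegral_prod_left'.pow_const _
  have hfb : ∀ y, ∫⁻ x, f x y ^ p ∂μ = b y ^ p := fun y ↦ by
    rw [hb_def, ← ENNReal.rpow_mul, one_div_mul_cancel hp₀.ne', ENNReal.rpow_one]
  rcases eq_or_ne (∫⁻ y, b y ∂ν) ∞ with htop | htop
  · exact htop ▸ le_top
  have hS : MeasurableSet {y | b y ≠ 0} := (hb (measurableSet_singleton 0)).compl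
  have hvanish : ∀ᵐ x ∂μ, ∀ᵐ y ∂(ν.restrict {y | b y ≠ 0}ᶜ), f x y = 0 := by
    refine ae_ae_eq_zero_of_lintegral_rpow_eq_zero hp₀ hf ?_
    filter_upwards [self_mem_ae_restrict hS.compl] with y hy
    rw [hfb, not_not.1 hy, ENNReal.zero_rpow_of_pos hp₀]
  rw [one_div, ENNReal.rpow_inv_le_iff hp₀]
  calc ∫⁻ x, (∫⁻ y, f x y ∂ν) ^ p ∂μ = ∫⁻ x, (∫⁻ y in {y | b y ≠ 0}, f x y ∂ν) ^ p ∂μ := by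
        refine lintegral_congr_ae ?_
        filter_upwards [hvanish] with x hx
        rw [← lintegral_add_compl _ hS, lintegral_congr_ae hx, lintegral_zero, add_zero]
    _ ≤ (∫⁻ y in {y | b y ≠ 0}, b y ∂ν) ^ p :=
        lintegral_lintegral_rpow_le_of_ne_zero hp hf hb (ae_restrict_mem hS)
          (ae_restrict_of_ae ((ae_lt_top hb htop).mono fun _ ↦ LT.lt.ne)) hfb
    _ ≤ (∫⁻ y, b y ∂ν) ^ p := by
        gcongr
        exact Measure.restrict_le_self

end Minkowski

lemma setLIntegral_one_sub_rpow_mul_rpow_lt_top {a b : ℝ} (ha : 0 < a) (hb : 0 < b) :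
    ∫⁻ r in Ioo (0 : ℝ) 1, ENNReal.ofReal ((1 - r) ^ (a - 1) * r ^ (b - 1)) < ∞ := by
  have hbeta := (intervalIntegrable_iff_integrableOn_Ioo_of_le zero_le_one).1
    (Complex.betaIntegral_convergent (u := b) (v := a) (by simpa) (by simpa))
  refine (setLIntegral_congr_fun measurableSet_Ioo fun r hr ↦ ?_).trans_lt hbeta.2
  have hr₁ : 0 < 1 - r := sub_pos.2 hr.2
  have hreal : (r : ℂ) ^ ((b : ℂ) - 1) * (1 - (r : ℂ)) ^ ((a : ℂ) - 1) =
      (((1 - r) ^ (a - 1) * r ^ (b - 1) : ℝ) : ℂ) := by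
    rw [Complex.ofReal_mul, Complex.ofReal_cpow hr₁.le, Complex.ofReal_cpow hr.1.le, mul_comm]
    push_cast
    rfl
  have hpos : 0 ≤ (1 - r) ^ (a - 1) * r ^ (b - 1) :=
    mul_nonneg (Real.rpow_nonneg hr₁.le _) (Real.rpow_nonneg hr.1.le _)
  simp only [hreal]
  rw [← ofReal_norm, Complex.norm_real, Real.norm_of_nonneg hpos]

lemma setLIntegral_sub_rpow_mul_rpow {t : ℝ} (ht : 0 < t) (a b : ℝ) :
    ∫⁻ s in Ioo 0 t, ENNReal.ofReal ((t - s) ^ (a - 1) * s ^ (b - 1)) =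
      ENNReal.ofReal (t ^ (a + b - 1)) *
        ∫⁻ r in Ioo (0 : ℝ) 1, ENNReal.ofReal ((1 - r) ^ (a - 1) * r ^ (b - 1)) := by
  have himage : (t * ·) '' Ioo 0 1 = Ioo 0 t := by
    rw [image_mul_left_Ioo ht, mul_zero, mul_one]
  rw [← himage, lintegral_image_eq_lintegral_abs_deriv_mul measurableSet_Ioo (f' := fun _ ↦ t)
    (fun x _ ↦ by simpa using ((hasDerivAt_id x).const_mul t).hasDerivWithinAt)
    (mul_right_injective₀ ht.ne').injOn, ← lintegral_const_mul' _ _ ENNReal.ofReal_ne_top]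
  refine setLIntegral_congr_fun measurableSet_Ioo fun r hr ↦ ?_
  have hr₁ : 0 < 1 - r := sub_pos.2 hr.2
  rw [abs_of_pos ht, ← ENNReal.ofReal_mul ht.le, ← ENNReal.ofReal_mul (by positivity),
    ← mul_one_sub, Real.mul_rpow ht.le hr₁.le, Real.mul_rpow ht.le hr.1.le,
    show a + b - 1 = 1 + (a - 1) + (b - 1) by ring, Real.rpow_add ht, Real.rpow_add ht,
    Real.rpow_one]
  ring_nf

lemma ofReal_mul_setLIntegral_sub_rpow {α t : ℝ} (hα₀ : 0 < α) (ht : 0 < t) :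
    ENNReal.ofReal α * ∫⁻ s in Ioo 0 t, ENNReal.ofReal ((t - s) ^ (α - 1)) =
      ENNReal.ofReal (t ^ α) := by
  have hinteg : IntervalIntegrable (fun s ↦ (t - s) ^ (α - 1)) volume 0 t := by
    simpa using ((intervalIntegral.intervalIntegrable_rpow' (a := 0) (b := t)
      (by linarith : -1 < α - 1)).comp_sub_left t).symm
  rw [← ofReal_integral_eq_lintegral_ofReal
      ((intervalIntegrable_iff_integrableOn_Ioo_of_le ht.le).1 hinteg)
      ((ae_restrict_mem measurableSet_Ioo).mono fun s hs ↦
        Real.rpow_nonneg (sub_pos.2 hs.2).le _),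
    ← integral_Ioc_eq_integral_Ioo, ← intervalIntegral.integral_of_le ht.le,
    intervalIntegral.integral_comp_sub_left (fun r ↦ r ^ (α - 1)), sub_self, sub_zero,
    integral_rpow (.inl (by linarith)), sub_add_cancel, Real.zero_rpow hα₀.ne', sub_zero,
    ← ENNReal.ofReal_mul hα₀.le, mul_div_cancel₀ _ hα₀.ne']

lemma exists_forall_ofReal_rpow_mul_le {a : ℝ} (ha : 0 < a) {D ε : ℝ≥0∞} (hD : D ≠ ∞)
    (hε : 0 < ε) : ∃ T > 0, ∀ t ∈ Ioc 0 T, ENNReal.ofReal (t ^ a) * D ≤ ε := by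
  have hrpow : Tendsto (fun t : ℝ ↦ ENNReal.ofReal (t ^ a)) (𝓝[>] 0) (𝓝 0) := by
    have hcont := (ENNReal.continuous_ofReal.comp (Real.continuous_rpow_const ha.le)).tendsto 0
    simp only [Function.comp_def, Real.zero_rpow ha.ne', ENNReal.ofReal_zero] at hcont
    exact hcont.mono_left nhdsWithin_le_nhds
  have hlim := ENNReal.Tendsto.mul_const hrpow (.inr hD)
  rw [zero_mul] at hlim
  exact mem_nhdsGT_iff_exists_Ioc_subset.1 (hlim.eventually_le_const hε)

lemma heatSemigroup_le_of_le_smul_volume {μ : Measure ℝᴺ} {K : ℝ≥0∞} (hμ : μ ≤ K • volume)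
    {τ : ℝ} (hτ : 0 < τ) (x : ℝᴺ) : heatSemigroup τ μ x ≤ K := by
  refine (heatSemigroup_mono hμ τ x).trans_eq ?_
  rw [heatSemigroup, lintegral_smul_measure, lintegral_heatKernel_left hτ, smul_eq_mul, mul_one]

lemma lintegral_mul_heatSemigroup_le_of_le_smul_volume {μ : Measure ℝᴺ} {K : ℝ≥0∞} (hK : K ≠ ∞)
    (hμ : μ ≤ K • volume) (w : ℝ → ℝ≥0∞) {α t : ℝ} (ht : 0 < t) (x : ℝᴺ) :
    ∫⁻ θ in Ioi (0 : ℝ), w θ * heatSemigroup (t ^ α * θ) μ x ≤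
      (∫⁻ θ in Ioi (0 : ℝ), w θ) * K := by
  rw [← lintegral_mul_const' _ _ hK]
  refine setLIntegral_mono' measurableSet_Ioi fun θ (hθ : 0 < θ) ↦ mul_le_mul_right ?_ _
  exact heatSemigroup_le_of_le_smul_volume hμ (by positivity) x

lemma mildRHS_const_le {p α t : ℝ} (hp : 0 ≤ p) (hα₀ : 0 < α) {μ : Measure ℝᴺ} {K M : ℝ≥0∞}
    (hK : K ≠ ∞) (hμ : μ ≤ K • volume) (hM : M ≠ ∞) (ht : 0 < t) (x : ℝᴺ) :
    mildRHS p α μ (fun _ _ ↦ M) t x ≤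
      (∫⁻ θ in Ioi (0 : ℝ), ENNReal.ofReal (wrightDensity α θ)) * K +
        ENNReal.ofReal (t ^ α) *
          ((∫⁻ θ in Ioi (0 : ℝ), ENNReal.ofReal (θ * wrightDensity α θ)) * M ^ p) := by
  have hMp : M ^ p ≠ ∞ := ENNReal.rpow_ne_top_of_nonneg hp hM
  refine add_le_add (lintegral_mul_heatSemigroup_le_of_le_smul_volume hK hμ _ ht x) ?_
  rw [← ofReal_mul_setLIntegral_sub_rpow hα₀ ht, mul_assoc, ← lintegral_mul_const _ (by fun_prop)]
  refine mul_le_mul_right (setLIntegral_mono' measurableSet_Ioo fun s hs ↦ ?_) _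
  exact mul_le_mul_right (lintegral_mul_heatSemigroup_le_of_le_smul_volume hMp
    (withDensity_const _).le _ (sub_pos.2 hs.2) x) _

lemma exists_finiteUpTo_of_le_smul_volume {p α : ℝ} (hp : 0 ≤ p) (hα₀ : 0 < α) (hα₁ : α < 1)
    {μ : Measure ℝᴺ} {K : ℝ≥0∞} (hK : K ≠ ∞) (hμ : μ ≤ K • volume) :
    ∃ T > 0, FiniteUpTo p α μ T := by
  have hH₀ : ∫⁻ θ in Ioi (0 : ℝ), ENNReal.ofReal (wrightDensity α θ) ≠ ∞ := by
    simpa using (lintegral_wrightDensity_mul_rpow_lt_top hα₀ hα₁ (k := 0) (by norm_num)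
      (by positivity)).ne
  have hH₁ : ∫⁻ θ in Ioi (0 : ℝ), ENNReal.ofReal (θ * wrightDensity α θ) ≠ ∞ := by
    simpa using (lintegral_mul_wrightDensity_mul_rpow_lt_top hα₀ hα₁ (k := 0) (by norm_num)
      (sub_pos.2 (one_lt_one_div hα₀ hα₁))).ne
  set M := (∫⁻ θ in Ioi (0 : ℝ), ENNReal.ofReal (wrightDensity α θ)) * K + 1
  have hM : M ≠ ∞ := ENNReal.add_ne_top.2 ⟨ENNReal.mul_ne_top hH₀ hK, ENNReal.one_ne_top⟩
  obtain ⟨T, hT, hle⟩ := exists_forall_ofReal_rpow_mul_le hα₀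
    (ENNReal.mul_ne_top hH₁ (ENNReal.rpow_ne_top_of_nonneg hp hM)) one_pos
  have hsuper : ∀ᵐ t ∂(volume.restrict (Ioc (0 : ℝ) T)), ∀ᵐ x,
      mildRHS p α μ (fun _ _ ↦ M) t x ≤ M := by
    filter_upwards [self_mem_ae_restrict measurableSet_Ioc] with t ht
    exact .of_forall fun x ↦ (mildRHS_const_le hp hα₀ hK hμ hM ht.1 x).trans
      (add_le_add_right (hle t ht) _)
  refine ⟨T, hT, ?_⟩
  filter_upwards [picardLimit_le_of_mildRHS_le hp hsuper] with t ht
  filter_upwards [ht] with x hx using hx.trans_lt hM.lt_top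

lemma lintegral_const_mul_rpow_rpow {X : Type*} [MeasurableSpace X] {μ : Measure X} {p : ℝ}
    (hp : 0 < p) (c : ℝ≥0∞) {f : X → ℝ≥0∞} (hf : Measurable f) :
    (∫⁻ x, (c * f x) ^ p ∂μ) ^ (1 / p) = c * (∫⁻ x, f x ^ p ∂μ) ^ (1 / p) := by
  simp only [ENNReal.mul_rpow_of_nonneg _ _ hp.le]
  rw [lintegral_const_mul _ (hf.pow_const p), ENNReal.mul_rpow_of_nonneg _ _ (by positivity),
    ← ENNReal.rpow_mul, mul_one_div_cancel hp.ne', ENNReal.rpow_one]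

section SmallMass

variable {p α : ℝ}

lemma lintegral_heatSemigroup_rpow_le (hN : 1 ≤ N) (hp : p = fujitaExponent N) (μ : Measure ℝᴺ)
    [SFinite μ] {τ : ℝ} (hτ : 0 < τ) :
    (∫⁻ x, heatSemigroup τ μ x ^ p) ^ (1 / p) ≤ ENNReal.ofReal (τ ^ (-(1 / p))) * μ univ := by
  have hp₁ : 1 < p := hp ▸ one_lt_fujitaExponent hN
  have hkernel : Measurable (Function.uncurry fun x y : ℝᴺ ↦
      ENNReal.ofReal (heatKernel τ (x - y))) :=
    (measurable_heatKernel.comp (f := fun z : ℝᴺ × ℝᴺ ↦ (τ, z.1 - z.2))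
      (by fun_prop)).ennreal_ofReal
  refine (lintegral_lintegral_rpow_le hp₁ hkernel).trans ?_
  rw [← lintegral_const]
  refine lintegral_mono fun y ↦ ?_
  rw [Real.rpow_neg hτ.le, ← Real.inv_rpow hτ.le, ← ENNReal.ofReal_rpow_of_pos (by positivity)]
  refine ENNReal.rpow_le_rpow ?_ (by positivity)
  exact hp ▸ lintegral_heatKernel_rpow_fujitaExponent_le hN hτ y

lemma lintegral_lintegral_mul_heatSemigroup_rpow_le (hN : 1 ≤ N) (hp : p = fujitaExponent N)
    {w : ℝ → ℝ≥0∞} (hw : Measurable w) (μ : Measure ℝᴺ) [SFinite μ] {t : ℝ} (ht : 0 < t) :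
    (∫⁻ x, (∫⁻ θ in Ioi (0 : ℝ), w θ * heatSemigroup (t ^ α * θ) μ x) ^ p) ^ (1 / p) ≤
      ENNReal.ofReal (t ^ (-(α / p))) *
        (∫⁻ θ in Ioi (0 : ℝ), w θ * ENNReal.ofReal (θ ^ (-(1 / p)))) * μ univ := by
  have hp₁ : 1 < p := hp ▸ one_lt_fujitaExponent hN
  have hmeas : Measurable (Function.uncurry fun (x : ℝᴺ) (θ : ℝ) ↦
      w θ * heatSemigroup (t ^ α * θ) μ x) :=
    (hw.comp measurable_snd).mul ((measurable_heatSemigroup μ).comp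
      (f := fun z : ℝᴺ × ℝ ↦ (t ^ α * z.2, z.1)) (by fun_prop))
  have hweight : Measurable fun θ : ℝ ↦ w θ * ENNReal.ofReal (θ ^ (-(1 / p))) :=
    hw.mul (by fun_prop)
  refine (lintegral_lintegral_rpow_le hp₁ hmeas).trans ?_
  rw [← lintegral_const_mul _ hweight, ← lintegral_mul_const _ (hweight.const_mul _)]
  refine setLIntegral_mono' measurableSet_Ioi fun θ (hθ : 0 < θ) ↦ ?_
  have hpow : (t ^ α * θ) ^ (-(1 / p)) = t ^ (-(α / p)) * θ ^ (-(1 / p)) := by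
    rw [Real.mul_rpow (by positivity) hθ.le, ← Real.rpow_mul ht.le]
    ring_nf
  have hslice : Measurable (heatSemigroup (t ^ α * θ) μ) :=
    (measurable_heatSemigroup μ).comp measurable_prodMk_left
  rw [lintegral_const_mul_rpow_rpow (by linarith) _ hslice]
  refine (mul_le_mul_right (lintegral_heatSemigroup_rpow_le hN hp μ (by positivity)) _).trans_eq ?_
  rw [hpow, ENNReal.ofReal_mul (by positivity)]
  ring

/-- The nonlinear term of the integral equation, without the factor `α`. -/
def duhamel (p α : ℝ) (u : ℝ → ℝᴺ → ℝ≥0∞) (t : ℝ) (x : ℝᴺ) : ℝ≥0∞ :=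
  ∫⁻ s in Ioo (0 : ℝ) t, ENNReal.ofReal ((t - s) ^ (α - 1)) *
    operatorS α (t - s) (volume.withDensity fun y ↦ u s y ^ p) x

lemma measurable_operatorS_rpow (hα₀ : 0 < α) (hα₁ : α < 1) {u : ℝ → ℝᴺ → ℝ≥0∞}
    (hu : Measurable fun z : ℝ × ℝᴺ ↦ u z.1 z.2) (p t : ℝ) :
    Measurable fun z : ℝᴺ × ℝ ↦
      operatorS α (t - z.2) (volume.withDensity fun y ↦ u z.2 y ^ p) z.1 :=
  (measurable_operatorS hα₀ hα₁ (f := fun s y ↦ u s y ^ p) (hu.pow_const p)).comp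
    (f := fun z : ℝᴺ × ℝ ↦ ((t, z.1), z.2)) (by fun_prop)

lemma measurable_duhamel_integrand (hα₀ : 0 < α) (hα₁ : α < 1) {u : ℝ → ℝᴺ → ℝ≥0∞}
    (hu : Measurable fun z : ℝ × ℝᴺ ↦ u z.1 z.2) (p t : ℝ) :
    Measurable fun z : ℝᴺ × ℝ ↦ ENNReal.ofReal ((t - z.2) ^ (α - 1)) *
      operatorS α (t - z.2) (volume.withDensity fun y ↦ u z.2 y ^ p) z.1 :=
  .mul (by fun_prop) (measurable_operatorS_rpow hα₀ hα₁ hu p t)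

lemma measurable_duhamel (hα₀ : 0 < α) (hα₁ : α < 1) {u : ℝ → ℝᴺ → ℝ≥0∞}
    (hu : Measurable fun z : ℝ × ℝᴺ ↦ u z.1 z.2) (p t : ℝ) : Measurable (duhamel p α u t) :=
  (measurable_duhamel_integrand hα₀ hα₁ hu p t).lintegral_prod_right'

lemma exists_lintegral_operatorP_rpow_le (hN : 1 ≤ N) (hp : p = fujitaExponent N) (hα₀ : 0 < α)
    (hα₁ : α < 1) : ∃ C ≠ ∞, ∀ (μ : Measure ℝᴺ) [SFinite μ], ∀ t > 0,
      (∫⁻ x, operatorP α t μ x ^ p) ^ (1 / p) ≤ C * μ univ * ENNReal.ofReal (t ^ (-(α / p))) := by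
  have hp₁ : 1 < p := hp ▸ one_lt_fujitaExponent hN
  have hp_inv : 1 / p < 1 := (div_lt_one (by linarith)).2 hp₁
  have hp_inv₀ : 0 < 1 / p := by positivity
  refine ⟨_, (lintegral_wrightDensity_mul_rpow_lt_top hα₀ hα₁ (k := -(1 / p)) (by linarith)
    (by linarith [one_div_pos.2 hα₀])).ne, fun μ _ t ht ↦ ?_⟩
  exact (lintegral_lintegral_mul_heatSemigroup_rpow_le hN hp
    (measurable_wrightDensity hα₀ hα₁).ennreal_ofReal μ ht).trans_eq (by ring)

lemma lintegral_duhamel_integrand_rpow_le (hN : 1 ≤ N) (hp : p = fujitaExponent N) (hα₀ : 0 < α)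
    (hα₁ : α < 1) {u : ℝ → ℝᴺ → ℝ≥0∞} (hu : Measurable fun z : ℝ × ℝᴺ ↦ u z.1 z.2) {Q : ℝ≥0∞}
    {s t : ℝ} (hs : s ∈ Ioo 0 t) (hQ : ∫⁻ y, u s y ^ p ≤ Q * ENNReal.ofReal (s ^ (-α))) :
    (∫⁻ x, (ENNReal.ofReal ((t - s) ^ (α - 1)) *
        operatorS α (t - s) (volume.withDensity fun y ↦ u s y ^ p) x) ^ p) ^ (1 / p) ≤
      (∫⁻ θ in Ioi (0 : ℝ), ENNReal.ofReal (θ * wrightDensity α θ) *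
          ENNReal.ofReal (θ ^ (-(1 / p)))) * Q *
        ENNReal.ofReal ((t - s) ^ ((α - α / p) - 1) * s ^ ((1 - α) - 1)) := by
  have hp₁ : 1 < p := hp ▸ one_lt_fujitaExponent hN
  have hts : 0 < t - s := sub_pos.2 hs.2
  have hweight : Measurable fun θ ↦ ENNReal.ofReal (θ * wrightDensity α θ) :=
    (measurable_id.mul (measurable_wrightDensity hα₀ hα₁)).ennreal_ofReal
  have hslice : Measurable (operatorS α (t - s) (volume.withDensity fun y ↦ u s y ^ p)) :=
    (measurable_operatorS_rpow hα₀ hα₁ hu p t).comp (f := fun x ↦ (x, s)) (by fun_prop)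
  have hpow : (t - s) ^ (α - α / p - 1) = (t - s) ^ (α - 1) * (t - s) ^ (-(α / p)) := by
    rw [← Real.rpow_add hts]
    ring_nf
  have hS := lintegral_lintegral_mul_heatSemigroup_rpow_le hN hp (α := α) hweight
    (volume.withDensity fun y ↦ u s y ^ p) hts
  rw [withDensity_apply _ .univ, setLIntegral_univ] at hS
  rw [lintegral_const_mul_rpow_rpow (by linarith) _ hslice]
  refine (mul_le_mul_right (hS.trans (mul_le_mul_right hQ _)) _).trans_eq ?_
  rw [hpow, sub_sub_cancel_left, ENNReal.ofReal_mul (by positivity),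
    ENNReal.ofReal_mul (by positivity)]
  ring

lemma exists_lintegral_duhamel_rpow_le (hN : 1 ≤ N) (hp : p = fujitaExponent N) (hα₀ : 0 < α)
    (hα₁ : α < 1) : ∃ D ≠ ∞, ∀ u : ℝ → ℝᴺ → ℝ≥0∞, (Measurable fun z : ℝ × ℝᴺ ↦ u z.1 z.2) →
      ∀ Q, (∀ s > 0, ∫⁻ y, u s y ^ p ≤ Q * ENNReal.ofReal (s ^ (-α))) → ∀ t > 0,
        (∫⁻ x, duhamel p α u t x ^ p) ^ (1 / p) ≤
          D * Q * ENNReal.ofReal (t ^ (-(α / p))) := by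
  have hp₁ : 1 < p := hp ▸ one_lt_fujitaExponent hN
  have hp_inv : 1 / p < 1 := (div_lt_one (by linarith)).2 hp₁
  refine ⟨_, ENNReal.mul_ne_top
    (lintegral_mul_wrightDensity_mul_rpow_lt_top hα₀ hα₁ (k := -(1 / p)) (by linarith)
      (by linarith [one_lt_one_div hα₀ hα₁, one_div_pos.2 (one_pos.trans hp₁)])).ne
    (setLIntegral_one_sub_rpow_mul_rpow_lt_top (sub_pos.2 (div_lt_self hα₀ hp₁))
      (sub_pos.2 hα₁)).ne, fun u hu Q hQ t ht ↦ ?_⟩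
  refine (lintegral_lintegral_rpow_le hp₁ (measurable_duhamel_integrand hα₀ hα₁ hu p t)).trans ?_
  refine (setLIntegral_mono' measurableSet_Ioo fun s hs ↦
    lintegral_duhamel_integrand_rpow_le hN hp hα₀ hα₁ hu hs (hQ s hs.1)).trans_eq ?_
  rw [lintegral_const_mul _ (by fun_prop), setLIntegral_sub_rpow_mul_rpow ht,
    show α - α / p + (1 - α) - 1 = -(α / p) by ring]
  ring

lemma lintegral_mildRHS_rpow_le (hp : 1 ≤ p) (hα₀ : 0 < α)
    (hα₁ : α < 1) (μ : Measure ℝᴺ) [SFinite μ] {u : ℝ → ℝᴺ → ℝ≥0∞}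
    (hu : Measurable fun z : ℝ × ℝᴺ ↦ u z.1 z.2) (t : ℝ) :
    (∫⁻ x, mildRHS p α μ u t x ^ p) ^ (1 / p) ≤
      (∫⁻ x, operatorP α t μ x ^ p) ^ (1 / p) + (∫⁻ x, duhamel p α u t x ^ p) ^ (1 / p) := by
  have hP : Measurable (operatorP α t μ) :=
    (measurable_operatorP hα₀ hα₁ μ).comp (f := fun x ↦ (t, x)) (by fun_prop)
  refine le_trans ?_ (ENNReal.lintegral_Lp_add_le hP.aemeasurable
    (measurable_duhamel hα₀ hα₁ hu p t).aemeasurable hp)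
  gcongr with x
  exact add_le_add_right (mul_le_of_le_one_left' (ENNReal.ofReal_le_one.2 hα₁.le)) _

lemma finiteUpTo_of_lintegral_picard_rpow_le {μ : Measure ℝᴺ} [SFinite μ] (hp : 0 < p)
    (hα₀ : 0 < α) (hα₁ : α < 1) {B : ℝ → ℝ≥0∞} (hB : ∀ t, B t ≠ ∞)
    (hpicard : ∀ n, ∀ t > 0, ∫⁻ x, picard p α μ n t x ^ p ≤ B t) (T : ℝ) :
    FiniteUpTo p α μ T := by
  filter_upwards [self_mem_ae_restrict measurableSet_Ioc] with t ht
  have hmeas : ∀ n, Measurable fun x ↦ picard p α μ n t x ^ p := fun n ↦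
    ((measurable_picard hα₀ hα₁ n).comp (f := fun x ↦ (t, x)) (by fun_prop)).pow_const p
  have hrpow : ∀ x, picardLimit p α μ t x ^ p = ⨆ n, picard p α μ n t x ^ p := fun x ↦
    (ENNReal.orderIsoRpow p hp).map_iSup fun n ↦ picard p α μ n t x
  have hfinite : ∫⁻ x, ⨆ n, picard p α μ n t x ^ p ≠ ∞ := by
    rw [lintegral_iSup hmeas fun i j hij x ↦
      ENNReal.rpow_le_rpow (monotone_picard hp.le hij t x) hp.le]
    exact ne_top_of_le_ne_top (hB t) (iSup_le fun n ↦ hpicard n t ht.1)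
  filter_upwards [ae_lt_top (.iSup hmeas) hfinite] with x hx
  exact (ENNReal.rpow_lt_top_iff_of_pos hp).1 (hrpow x ▸ hx)

lemma lintegral_picard_rpow_le {μ : Measure ℝᴺ} [SFinite μ] (hp : 1 < p) (hα₀ : 0 < α)
    (hα₁ : α < 1) {D E M : ℝ≥0∞}
    (hP : ∀ t > 0, (∫⁻ x, operatorP α t μ x ^ p) ^ (1 / p) ≤ E * ENNReal.ofReal (t ^ (-(α / p))))
    (hduhamel : ∀ u : ℝ → ℝᴺ → ℝ≥0∞, (Measurable fun z : ℝ × ℝᴺ ↦ u z.1 z.2) →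
      ∀ Q, (∀ s > 0, ∫⁻ y, u s y ^ p ≤ Q * ENNReal.ofReal (s ^ (-α))) → ∀ t > 0,
        (∫⁻ x, duhamel p α u t x ^ p) ^ (1 / p) ≤ D * Q * ENNReal.ofReal (t ^ (-(α / p))))
    (hM : E + D * M ^ p ≤ M) (n : ℕ) :
    ∀ t > 0, ∫⁻ x, picard p α μ n t x ^ p ≤ M ^ p * ENNReal.ofReal (t ^ (-α)) := by
  have hp₀ : 0 < p := one_pos.trans hp
  induction n with
  | zero => simp [picard, hp₀]
  | succ n ih =>
    intro t ht
    have hmeas := measurable_picard (p := p) (μ := μ) hα₀ hα₁ n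
    have hnorm : (∫⁻ x, picard p α μ (n + 1) t x ^ p) ^ (1 / p) ≤
        M * ENNReal.ofReal (t ^ (-(α / p))) := by
      refine (lintegral_mildRHS_rpow_le hp.le hα₀ hα₁ μ hmeas t).trans ?_
      refine (add_le_add (hP t ht) (hduhamel _ hmeas _ ih t ht)).trans ?_
      rw [← add_mul]
      gcongr
    rw [one_div, ENNReal.rpow_inv_le_iff hp₀, ENNReal.mul_rpow_of_nonneg _ _ hp₀.le,
      ENNReal.ofReal_rpow_of_pos (Real.rpow_pos_of_pos ht _), ← Real.rpow_mul ht.le, neg_mul,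
      div_mul_cancel₀ _ hp₀.ne'] at hnorm
    exact hnorm

lemma exists_finiteUpTo_of_measure_univ_le (hN : 1 ≤ N) (hp : p = fujitaExponent N)
    (hα₀ : 0 < α) (hα₁ : α < 1) : ∃ m > 0, ∀ (μ : Measure ℝᴺ) [SFinite μ],
      μ univ ≤ ENNReal.ofReal m → ∀ T, FiniteUpTo p α μ T := by
  have hp₁ : 1 < p := hp ▸ one_lt_fujitaExponent hN
  have hp₀ : 0 < p := by linarith
  obtain ⟨C, hC, hP⟩ := exists_lintegral_operatorP_rpow_le hN hp hα₀ hα₁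
  obtain ⟨D, hD, hduhamel⟩ := exists_lintegral_duhamel_rpow_le hN hp hα₀ hα₁
  obtain ⟨M, hM, hDM⟩ := exists_forall_ofReal_rpow_mul_le (sub_pos.2 hp₁) hD (ε := 2⁻¹) (by simp)
  obtain ⟨m, hm, hCm⟩ := exists_forall_ofReal_rpow_mul_le one_pos hC (ε := 2⁻¹ * ENNReal.ofReal M)
    (by simpa using hM)
  refine ⟨m, hm, fun μ _ hμ ↦ ?_⟩
  have hC_half : C * μ univ ≤ 2⁻¹ * ENNReal.ofReal M := by
    have hCm' := hCm m ⟨hm, le_rfl⟩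
    rw [Real.rpow_one, mul_comm] at hCm'
    exact (mul_le_mul_right hμ C).trans hCm'
  have hD_half : D * ENNReal.ofReal M ^ p ≤ 2⁻¹ * ENNReal.ofReal M := by
    refine le_of_eq_of_le ?_ (mul_le_mul_left (hDM M ⟨hM, le_rfl⟩) _)
    rw [mul_right_comm, ← ENNReal.ofReal_mul (by positivity), ← Real.rpow_add_one hM.ne',
      sub_add_cancel, ENNReal.ofReal_rpow_of_pos hM, mul_comm]
  have hself : C * μ univ + D * ENNReal.ofReal M ^ p ≤ ENNReal.ofReal M := by
    refine (add_le_add hC_half hD_half).trans_eq ?_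
    rw [← add_mul, ENNReal.inv_two_add_inv_two, one_mul]
  exact finiteUpTo_of_lintegral_picard_rpow_le hp₀ hα₀ hα₁
    (B := fun t ↦ ENNReal.ofReal M ^ p * ENNReal.ofReal (t ^ (-α))) (fun t ↦ by finiteness)
    (lintegral_picard_rpow_le hp₁ hα₀ hα₁ (hP μ) hduhamel hself)

end SmallMass

/-! ### Growth of the local mass -/

section SuperlinearGrowth

variable {z : ℝ → ℝ} {p k a b z₀ : ℝ}

lemma two_pow_mul_le_of_superlinear_growth (hp : 1 < p) (hk : 0 < k) (n : ℕ) (hz₀ : 0 < z₀)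
    (hstart : z₀ ≤ z a)
    (hgrowth : ∀ s t, a ≤ s → s ≤ t → t ≤ b → z s + k * (t - s) * z s ^ p ≤ z t)
    (hlength : z₀ ^ (1 - p) / k * (1 - 2 ^ (1 - p))⁻¹ ≤ b - a) : 2 ^ n * z₀ ≤ z b := by
  have hq₁ : (2 : ℝ) ^ (1 - p) < 1 := Real.rpow_lt_one_of_one_lt_of_neg one_lt_two (by linarith)
  have : 0 < (1 - (2 : ℝ) ^ (1 - p))⁻¹ := inv_pos.2 (by linarith)
  induction n generalizing a z₀ with
  | zero =>
    have hab : a ≤ b := sub_nonneg.1 (le_trans (by positivity) hlength)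
    have hgain : 0 ≤ k * (b - a) * z a ^ p :=
      mul_nonneg (mul_nonneg hk.le (sub_nonneg.2 hab))
        (Real.rpow_nonneg (hz₀.le.trans hstart) p)
    linarith [hgrowth a b le_rfl hab le_rfl]
  | succ n ih =>
    -- The time `δ` in which `z` doubles shrinks by the factor `2 ^ (1 - p)` at every doubling.
    set δ := z₀ ^ (1 - p) / k with hδ
    have hδ₀ : 0 < δ := by positivity
    have hδ_next : (2 * z₀) ^ (1 - p) / k = 2 ^ (1 - p) * δ := by
      rw [hδ, Real.mul_rpow zero_le_two hz₀.le, mul_div_assoc]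
    have hS_eq : (1 - (2 : ℝ) ^ (1 - p))⁻¹ = 1 + 2 ^ (1 - p) * (1 - 2 ^ (1 - p))⁻¹ := by
      field_simp [(sub_pos.2 hq₁).ne']
      ring
    have hlength' : δ + 2 ^ (1 - p) * δ * (1 - 2 ^ (1 - p))⁻¹ ≤ b - a := by
      rw [hS_eq] at hlength
      linarith
    have htail : 0 ≤ 2 ^ (1 - p) * δ * (1 - 2 ^ (1 - p))⁻¹ := by positivity
    have hdouble : 2 * z₀ ≤ z (a + δ) := by
      have hpow : k * δ * z₀ ^ p = z₀ := by
        rw [hδ, mul_div_cancel₀ _ hk.ne', ← Real.rpow_add hz₀, sub_add_cancel, Real.rpow_one]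
      calc 2 * z₀ = z₀ + k * δ * z₀ ^ p := by rw [hpow, two_mul]
        _ ≤ z a + k * (a + δ - a) * z a ^ p := by rw [add_sub_cancel_left]; gcongr
        _ ≤ z (a + δ) := hgrowth _ _ le_rfl (by linarith) (by linarith)
    refine le_of_eq_of_le (by ring) (ih (a := a + δ) (z₀ := 2 * z₀) (by positivity) hdouble
      (fun s t hs ↦ hgrowth s t (by linarith)) ?_)
    rw [hδ_next]
    linarith

lemma sub_le_of_superlinear_growth (hp : 1 < p) (hk : 0 < k) (hz₀ : 0 < z₀) (hstart : z₀ ≤ z a)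
    (hgrowth : ∀ s t, a ≤ s → s ≤ t → t ≤ b → z s + k * (t - s) * z s ^ p ≤ z t) :
    b - a ≤ z₀ ^ (1 - p) / k * (1 - 2 ^ (1 - p))⁻¹ := by
  by_contra! hlt
  obtain ⟨n, hn⟩ := pow_unbounded_of_one_lt (z b / z₀) one_lt_two
  rw [div_lt_iff₀ hz₀] at hn
  exact hn.not_ge (two_pow_mul_le_of_superlinear_growth hp hk n hz₀ hstart hgrowth hlt.le)

lemma setLIntegral_Ioo_inv {s t : ℝ} (hs : 0 < s) (hst : s ≤ t) :
    ∫⁻ r in Ioo s t, ENNReal.ofReal r⁻¹ = ENNReal.ofReal (Real.log (t / s)) := by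
  have hinteg : IntervalIntegrable (fun r : ℝ ↦ r⁻¹) volume s t :=
    intervalIntegral.intervalIntegrable_inv (fun r hr ↦
      (hs.trans_le (uIcc_of_le hst ▸ hr).1).ne') continuousOn_id
  rw [← integral_inv_of_pos hs (hs.trans_le hst), intervalIntegral.integral_of_le hst,
    ← restrict_Ioo_eq_restrict_Ioc, ofReal_integral_eq_lintegral_ofReal
      ((intervalIntegrable_iff_integrableOn_Ioo_of_le hst).1 hinteg)]
  filter_upwards [self_mem_ae_restrict measurableSet_Ioo] with r hr
  exact inv_nonneg.2 (hs.trans hr.1).le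

lemma ofReal_mul_log_le_setLIntegral {g : ℝ → ℝ≥0∞} {c s t : ℝ} (hc : 0 ≤ c) (hs : 0 < s)
    (hst : s ≤ t) (hg : ∀ r ∈ Ioo s t, ENNReal.ofReal (c * r⁻¹) ≤ g r) :
    ENNReal.ofReal (c * Real.log (t / s)) ≤ ∫⁻ r in Ioo s t, g r := by
  rw [ENNReal.ofReal_mul hc, ← setLIntegral_Ioo_inv hs hst,
    ← lintegral_const_mul' _ _ ENNReal.ofReal_ne_top]
  refine setLIntegral_mono' measurableSet_Ioo fun r hr ↦ ?_
  rw [← ENNReal.ofReal_mul hc]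
  exact hg r hr

lemma setLIntegral_Ioo_add_le (g : ℝ → ℝ≥0∞) {r s t : ℝ} (hrs : r ≤ s) (hst : s ≤ t) :
    (∫⁻ x in Ioo r s, g x) + ∫⁻ x in Ioo s t, g x ≤ ∫⁻ x in Ioo r t, g x := by
  rw [← lintegral_union measurableSet_Ioo (disjoint_left.2 fun x hx hx' ↦ lt_asymm hx.2 hx'.1)]
  exact lintegral_mono_set (union_subset (Ioo_subset_Ioo_right hst) (Ioo_subset_Ioo_left hrs))

lemma log_div_le_of_rpow_mul_inv_le {g : ℝ → ℝ≥0∞} {A B d T₁ T : ℝ} (hp : 1 < p) (hA : 0 < A)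
    (hB : 0 < B) (hd : 0 < d) (hT₁ : 0 < T₁) (hT : T₁ ≤ T) (hg : ∫⁻ s in Ioo T₁ T, g s ≠ ∞)
    (hlow : ∀ t ∈ Icc T₁ T, ENNReal.ofReal
      (d * (A + B * (∫⁻ s in Ioo T₁ t, g s).toReal) ^ p * t⁻¹) ≤ g t) :
    Real.log (T / T₁) ≤ A ^ (1 - p) / (B * d) * (1 - 2 ^ (1 - p))⁻¹ := by
  set I : ℝ → ℝ≥0∞ := fun t ↦ ∫⁻ s in Ioo T₁ t, g s
  have hI_mono : Monotone I := fun s t hst ↦ lintegral_mono_set (Ioo_subset_Ioo_right hst)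
  have hI_ne : ∀ t ≤ T, I t ≠ ∞ := fun t ht ↦ ne_top_of_le_ne_top hg (hI_mono ht)
  have hI_step : ∀ s t, T₁ ≤ s → s ≤ t → t ≤ T →
      (I s).toReal + d * (A + B * (I s).toReal) ^ p * Real.log (t / s) ≤ (I t).toReal := by
    intro s t hs hst ht
    have hs₀ : 0 < s := hT₁.trans_le hs
    have hlog : 0 ≤ Real.log (t / s) := Real.log_nonneg ((one_le_div hs₀).2 hst)
    have hgain : ENNReal.ofReal (d * (A + B * (I s).toReal) ^ p * Real.log (t / s)) ≤
        ∫⁻ r in Ioo s t, g r := by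
      refine ofReal_mul_log_le_setLIntegral (by positivity) hs₀ hst fun r hr ↦ ?_
      have hr₀ : 0 < r := hs₀.trans hr.1
      have hmono := ENNReal.toReal_mono (hI_ne r (hr.2.le.trans ht)) (hI_mono hr.1.le)
      refine le_trans ?_ (hlow r ⟨hs.trans hr.1.le, hr.2.le.trans ht⟩)
      gcongr
    have htoReal := ENNReal.toReal_mono (hI_ne t ht)
      ((add_le_add_right hgain (I s)).trans (setLIntegral_Ioo_add_le g hs hst))
    rwa [ENNReal.toReal_add (hI_ne s (hst.trans ht)) ENNReal.ofReal_ne_top,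
      ENNReal.toReal_ofReal (by positivity)] at htoReal
  rw [Real.log_div (hT₁.trans_le hT).ne' hT₁.ne']
  refine sub_le_of_superlinear_growth (z := fun x ↦ A + B * (I (Real.exp x)).toReal) hp
    (mul_pos hB hd) hA (le_add_of_nonneg_right (by positivity)) fun x y hx hxy hy ↦ ?_
  have hstep := hI_step (Real.exp x) (Real.exp y) ((Real.log_le_iff_le_exp hT₁).1 hx)
    (Real.exp_le_exp.2 hxy) ((Real.le_log_iff_exp_le (hT₁.trans_le hT)).1 hy)
  rw [← Real.exp_sub, Real.log_exp] at hstep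
  linarith [mul_le_mul_of_nonneg_left hstep hB.le]

end SuperlinearGrowth

/-- The parabolic ball of radius `t^{α/2}`. -/
def parabolicBall (α t : ℝ) : Set ℝᴺ := Metric.closedBall 0 (t ^ (α / 2))

lemma measurableSet_parabolicBall (α t : ℝ) : MeasurableSet (parabolicBall (N := N) α t) :=
  measurableSet_closedBall

lemma parabolicBall_subset {α s t : ℝ} (hα : 0 ≤ α) (hs : 0 ≤ s) (hst : s ≤ t) :
    parabolicBall (N := N) α s ⊆ parabolicBall α t :=
  Metric.closedBall_subset_closedBall (Real.rpow_le_rpow hs hst (by positivity))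

lemma volume_parabolicBall_rpow (hN : 1 ≤ N) {p α t : ℝ} (hp : p = fujitaExponent N)
    (ht : 0 < t) : volume (parabolicBall (N := N) α t) ^ (p - 1) =
      ENNReal.ofReal (t ^ α) * volume (Metric.ball (0 : ℝᴺ) 1) ^ (p - 1) := by
  have hp₁ : 1 < p := hp ▸ one_lt_fujitaExponent hN
  have hradius : ((t ^ (α / 2)) ^ N) ^ (p - 1) = t ^ α := by
    rw [← Real.rpow_mul_natCast ht.le, ← Real.rpow_mul ht.le, hp, fujitaExponent]
    congr 1
    field_simp
    ring
  rw [parabolicBall, Measure.addHaar_closedBall _ _ (by positivity), finrank_euclideanSpace_fin,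
    ENNReal.mul_rpow_of_nonneg _ _ (by linarith), ENNReal.ofReal_rpow_of_pos (by positivity),
    hradius]

section MassLowerBound

variable {α α₀ τ t : ℝ}

lemma le_setLIntegral_heatSemigroup {c ρ : ℝ} (μ : Measure ℝᴺ) [SFinite μ]
    (hc : ∀ y : ℝᴺ, ‖y‖ ≤ ρ → ENNReal.ofReal c ≤
      ∫⁻ x in Metric.closedBall 0 ρ, ENNReal.ofReal (heatKernel τ (x - y))) :
    ENNReal.ofReal c * μ (Metric.closedBall 0 ρ) ≤
      ∫⁻ x in Metric.closedBall 0 ρ, heatSemigroup τ μ x := by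
  have hmeas : Measurable (Function.uncurry fun x y : ℝᴺ ↦
      ENNReal.ofReal (heatKernel τ (x - y))) :=
    (measurable_heatKernel.comp (f := fun z : ℝᴺ × ℝᴺ ↦ (τ, z.1 - z.2))
      (by fun_prop)).ennreal_ofReal
  unfold heatSemigroup
  rw [lintegral_lintegral_swap hmeas.aemeasurable, ← setLIntegral_const]
  refine le_trans ?_ (setLIntegral_le_lintegral (Metric.closedBall 0 ρ) _)
  exact setLIntegral_mono' measurableSet_closedBall fun y hy ↦ hc y (mem_closedBall_zero_iff.1 hy)

lemma exists_le_setLIntegral_heatSemigroup : ∃ c > 0, ∀ (μ : Measure ℝᴺ) [SFinite μ], ∀ α > 0,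
    ∀ τ t θ : ℝ, 0 < τ → τ ≤ t → 0 < θ →
      ENNReal.ofReal c * ENNReal.ofReal (min 1 (1 / θ) ^ ((N : ℝ) / 2)) * μ (parabolicBall α t) ≤
        ∫⁻ x in parabolicBall α t, heatSemigroup (τ ^ α * θ) μ x := by
  obtain ⟨c, hc, hlow⟩ := exists_le_setLIntegral_heatKernel (N := N)
  refine ⟨c, hc, fun μ _ α hα τ t θ hτ hτt hθ ↦ ?_⟩
  have ht : 0 < t := hτ.trans_le hτt
  have hmin : min 1 (1 / θ) ≤ min 1 ((t ^ (α / 2)) ^ 2 / (τ ^ α * θ)) := by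
    have hsq : (t ^ (α / 2)) ^ 2 = t ^ α := by
      rw [← Real.rpow_mul_natCast ht.le, Nat.cast_two, div_mul_cancel₀ _ two_ne_zero]
    refine min_le_min_left _ ?_
    rw [hsq, div_le_div_iff₀ hθ (by positivity), one_mul]
    gcongr
  rw [← ENNReal.ofReal_mul hc.le]
  refine le_trans ?_ (le_setLIntegral_heatSemigroup μ fun y hy ↦
    hlow (t ^ (α / 2)) (τ ^ α * θ) (by positivity) (by positivity) y hy)
  unfold parabolicBall
  gcongr

lemma exists_le_setLIntegral_lintegral_mul_heatSemigroup : ∃ c > 0, ∀ (μ : Measure ℝᴺ) [SFinite μ],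
    ∀ α > 0, ∀ τ t : ℝ, 0 < τ → τ ≤ t → ∀ w : ℝ → ℝ≥0∞, Measurable w →
      ENNReal.ofReal c *
        (∫⁻ θ in Ioi (0 : ℝ), w θ * ENNReal.ofReal (min 1 (1 / θ) ^ ((N : ℝ) / 2))) *
          μ (parabolicBall α t) ≤
        ∫⁻ x in parabolicBall α t,
          ∫⁻ θ in Ioi (0 : ℝ), w θ * heatSemigroup (τ ^ α * θ) μ x := by
  obtain ⟨c, hc, hlow⟩ := exists_le_setLIntegral_heatSemigroup (N := N)
  refine ⟨c, hc, fun μ _ α hα τ t hτ hτt w hw ↦ ?_⟩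
  have hmeas : Measurable (Function.uncurry fun (x : ℝᴺ) (θ : ℝ) ↦
      w θ * heatSemigroup (τ ^ α * θ) μ x) :=
    (hw.comp measurable_snd).mul ((measurable_heatSemigroup μ).comp
      (f := fun z : ℝᴺ × ℝ ↦ (τ ^ α * z.2, z.1)) (by fun_prop))
  have hweight : Measurable fun θ : ℝ ↦ w θ * ENNReal.ofReal (min 1 (1 / θ) ^ ((N : ℝ) / 2)) :=
    hw.mul (by fun_prop)
  rw [lintegral_lintegral_swap hmeas.aemeasurable, ← lintegral_const_mul _ hweight,
    ← lintegral_mul_const _ (hweight.const_mul _)]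
  refine setLIntegral_mono' measurableSet_Ioi fun θ (hθ : 0 < θ) ↦ ?_
  have hslice : Measurable (heatSemigroup (τ ^ α * θ) μ) :=
    (measurable_heatSemigroup μ).comp (f := fun x ↦ (τ ^ α * θ, x)) (by fun_prop)
  rw [lintegral_const_mul _ hslice]
  refine le_of_eq_of_le ?_ (mul_le_mul_right (hlow μ α hα τ t θ hτ hτt hθ) (w θ))
  ring

lemma exists_le_setLIntegral_operatorP (hα₀ : 0 < α₀) : ∃ c > 0, ∀ α, α₀ ≤ α → α < 1 →
    ∀ (μ : Measure ℝᴺ) [SFinite μ], ∀ τ t : ℝ, 0 < τ → τ ≤ t →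
      ENNReal.ofReal c * μ (parabolicBall α t) ≤
        ∫⁻ x in parabolicBall α t, operatorP α τ μ x := by
  obtain ⟨c, hc, hlow⟩ := exists_le_setLIntegral_lintegral_mul_heatSemigroup (N := N)
  obtain ⟨d, hd, hmoment⟩ := exists_le_lintegral_wrightDensity hα₀ 0 ((N : ℝ) / 2)
  simp only [Real.rpow_zero, one_mul] at hmoment
  refine ⟨c * d, mul_pos hc hd, fun α hα hα₁ μ _ τ t hτ hτt ↦ ?_⟩
  have hα' := hα₀.trans_le hα
  refine le_trans ?_ (hlow μ α hα' τ t hτ hτt _ (measurable_wrightDensity hα' hα₁).ennreal_ofReal)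
  rw [ENNReal.ofReal_mul hc.le]
  gcongr
  exact hmoment α hα hα₁

lemma exists_le_setLIntegral_operatorS (hα₀ : 0 < α₀) : ∃ c > 0, ∀ α, α₀ ≤ α → α < 1 →
    ∀ (μ : Measure ℝᴺ) [SFinite μ], ∀ τ t : ℝ, 0 < τ → τ ≤ t →
      ENNReal.ofReal c * μ (parabolicBall α t) ≤
        ∫⁻ x in parabolicBall α t, operatorS α τ μ x := by
  obtain ⟨c, hc, hlow⟩ := exists_le_setLIntegral_lintegral_mul_heatSemigroup (N := N)
  obtain ⟨d, hd, hmoment⟩ := exists_le_lintegral_wrightDensity hα₀ 1 ((N : ℝ) / 2)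
  simp only [Real.rpow_one] at hmoment
  refine ⟨c * d, mul_pos hc hd, fun α hα hα₁ μ _ τ t hτ hτt ↦ ?_⟩
  have hα' := hα₀.trans_le hα
  refine le_trans ?_ (hlow μ α hα' τ t hτ hτt (fun θ ↦ ENNReal.ofReal (θ * wrightDensity α θ))
    (measurable_id.mul (measurable_wrightDensity hα' hα₁)).ennreal_ofReal)
  rw [ENNReal.ofReal_mul hc.le]
  gcongr
  exact hmoment α hα hα₁

end MassLowerBound

/-- The integral of `u(t)^p` over the parabolic ball. -/
def powMass (p α : ℝ) (u : ℝ → ℝᴺ → ℝ≥0∞) (t : ℝ) : ℝ≥0∞ := ∫⁻ x in parabolicBall α t, u t x ^ p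

section LocalMass

variable {p α t : ℝ} {u : ℝ → EuclideanSpace ℝ (Fin N) → ℝ≥0∞}

lemma measurable_powMass (hu : Measurable fun z : ℝ × ℝᴺ ↦ u z.1 z.2) :
    Measurable (powMass p α u) := by
  have hball : MeasurableSet {z : ℝ × ℝᴺ | ‖z.2‖ ≤ z.1 ^ (α / 2)} :=
    measurableSet_le (by fun_prop) (by fun_prop)
  have hpowMass : powMass p α u = fun t ↦ ∫⁻ x,
      {z : ℝ × ℝᴺ | ‖z.2‖ ≤ z.1 ^ (α / 2)}.indicator (fun z ↦ u z.1 z.2 ^ p) (t, x) := by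
    ext t
    rw [powMass, ← lintegral_indicator (measurableSet_parabolicBall α t)]
    simp [indicator, parabolicBall]
  rw [hpowMass]
  exact .lintegral_prod_right' ((hu.pow_const p).indicator hball)

lemma setLIntegral_rpow_le_powMass (hN : 1 ≤ N) (hp : p = fujitaExponent N) (ht : 0 < t)
    (hu : Measurable (u t)) : (∫⁻ x in parabolicBall α t, u t x) ^ p ≤
      ENNReal.ofReal (t ^ α) * volume (Metric.ball (0 : ℝᴺ) 1) ^ (p - 1) * powMass p α u t := by
  have hp₁ : 1 < p := hp ▸ one_lt_fujitaExponent hN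
  rw [← volume_parabolicBall_rpow hN hp ht]
  simpa [powMass] using lintegral_rpow_le_mul_lintegral_rpow_mul
    (ν := volume.restrict (parabolicBall α t)) hp₁ hu.aemeasurable
    (aemeasurable_const (b := (1 : ℝ≥0∞))) (by simp) (by simp)

lemma ofReal_div_le_powMass (hN : 1 ≤ N) (hp : p = fujitaExponent N) (ht : 0 < t)
    (hu : Measurable (u t)) {z : ℝ} (hz : 0 < z)
    (hzu : ENNReal.ofReal z ≤ ∫⁻ x in parabolicBall α t, u t x) :
    ENNReal.ofReal (z ^ p / (t ^ α * volume.real (Metric.ball (0 : ℝᴺ) 1) ^ (p - 1))) ≤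
      powMass p α u t := by
  have hp₁ : 1 < p := hp ▸ one_lt_fujitaExponent hN
  have hω : 0 < volume.real (Metric.ball (0 : ℝᴺ) 1) := volume_real_ball_zero_one_pos
  have hHolder := (ENNReal.rpow_le_rpow hzu (by linarith)).trans
    (setLIntegral_rpow_le_powMass hN hp (α := α) ht hu)
  rw [ENNReal.ofReal_rpow_of_pos hz, ← ofReal_measureReal measure_ball_lt_top.ne,
    ENNReal.ofReal_rpow_of_pos hω, ← ENNReal.ofReal_mul (by positivity)] at hHolder
  rw [ENNReal.ofReal_div_of_pos (by positivity)]
  exact ENNReal.div_le_of_le_mul' hHolder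

lemma le_setLIntegral_duhamel (hα₀ : 0 < α) (hα₁ : α < 1) {c : ℝ}
    (hc : ∀ (ν : Measure ℝᴺ) [SFinite ν], ∀ τ, 0 < τ → τ ≤ t →
      ENNReal.ofReal c * ν (parabolicBall α t) ≤ ∫⁻ x in parabolicBall α t, operatorS α τ ν x)
    (hu : Measurable fun z : ℝ × ℝᴺ ↦ u z.1 z.2) :
    ENNReal.ofReal (t ^ (α - 1)) * (ENNReal.ofReal c * ∫⁻ s in Ioo 0 t, powMass p α u s) ≤
      ∫⁻ x in parabolicBall α t, duhamel p α u t x := by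
  unfold duhamel
  rw [lintegral_lintegral_swap (f := fun x s ↦ ENNReal.ofReal ((t - s) ^ (α - 1)) *
      operatorS α (t - s) (volume.withDensity fun y ↦ u s y ^ p) x)
      (measurable_duhamel_integrand hα₀ hα₁ hu p t).aemeasurable,
    ← lintegral_const_mul _ (measurable_powMass hu),
    ← lintegral_const_mul _ ((measurable_powMass hu).const_mul _)]
  refine setLIntegral_mono' measurableSet_Ioo fun s hs ↦ ?_
  have hts : 0 < t - s := sub_pos.2 hs.2
  have hpow : t ^ (α - 1) ≤ (t - s) ^ (α - 1) :=
    Real.rpow_le_rpow_of_nonpos hts (by linarith [hs.1]) (by linarith)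
  have hmass : powMass p α u s ≤
      (volume.withDensity fun y ↦ u s y ^ p) (parabolicBall α t) := by
    rw [withDensity_apply _ (measurableSet_parabolicBall α t)]
    exact lintegral_mono_set (parabolicBall_subset hα₀.le hs.1.le hs.2.le)
  rw [lintegral_const_mul' _ _ ENNReal.ofReal_ne_top]
  exact mul_le_mul' (ENNReal.ofReal_le_ofReal hpow)
    ((mul_le_mul_right hmass _).trans (hc _ (t - s) hts (by linarith [hs.1])))

lemma le_setLIntegral_mildRHS (hα₀ : 0 < α) (hα₁ : α < 1) {μ : Measure ℝᴺ} [SFinite μ] {b c : ℝ}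
    (hb : ENNReal.ofReal b * μ (parabolicBall α t) ≤
      ∫⁻ x in parabolicBall α t, operatorP α t μ x)
    (hc : ∀ (ν : Measure ℝᴺ) [SFinite ν], ∀ τ, 0 < τ → τ ≤ t →
      ENNReal.ofReal c * ν (parabolicBall α t) ≤ ∫⁻ x in parabolicBall α t, operatorS α τ ν x)
    (hu : Measurable fun z : ℝ × ℝᴺ ↦ u z.1 z.2) :
    ENNReal.ofReal b * μ (parabolicBall α t) + ENNReal.ofReal α *
      (ENNReal.ofReal (t ^ (α - 1)) * (ENNReal.ofReal c * ∫⁻ s in Ioo 0 t, powMass p α u s)) ≤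
      ∫⁻ x in parabolicBall α t, mildRHS p α μ u t x := by
  have hP : Measurable (operatorP α t μ) :=
    (measurable_operatorP hα₀ hα₁ μ).comp (f := fun x ↦ (t, x)) (by fun_prop)
  change _ ≤ ∫⁻ x in parabolicBall α t, (operatorP α t μ x + ENNReal.ofReal α * duhamel p α u t x)
  rw [lintegral_add_left hP, lintegral_const_mul _ (measurable_duhamel hα₀ hα₁ hu p t)]
  exact add_le_add hb (mul_le_mul_right (le_setLIntegral_duhamel hα₀ hα₁ hc hu) _)

end LocalMass

section Finiteness

variable {p α T T' : ℝ} {μ : Measure (EuclideanSpace ℝ (Fin N))}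

lemma FiniteUpTo.exists_mem_Ioc (h : FiniteUpTo p α μ T') (hT : 0 ≤ T) (hT' : T < T') :
    ∃ t ∈ Ioc T T', ∃ x, picardLimit p α μ t x < ∞ := by
  have hne : (ae (volume.restrict (Ioc T T'))).NeBot := by
    rw [ae_neBot, Ne, Measure.restrict_eq_zero, Real.volume_Ioc, ENNReal.ofReal_eq_zero]
    linarith
  have hfinite := ae_restrict_of_ae_restrict_of_subset (Ioc_subset_Ioc_left hT) h
  have hmem : ∀ᵐ s ∂volume.restrict (Ioc T T'), s ∈ Ioc T T' :=
    self_mem_ae_restrict measurableSet_Ioc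
  obtain ⟨t, ht, hx⟩ := (hmem.and hfinite).exists
  exact ⟨t, ht, hx.exists⟩

lemma le_heatKernel_of_norm_le {τ₁ τ τ₂ D : ℝ} (hτ₁ : 0 < τ₁) (h₁ : τ₁ ≤ τ) (h₂ : τ ≤ τ₂)
    {x : ℝᴺ} (hx : ‖x‖ ≤ D) :
    (4 * Real.pi * τ₂) ^ (-((N : ℝ) / 2)) * Real.exp (-(D ^ 2 / (4 * τ₁))) ≤ heatKernel τ x := by
  have hτ : 0 < τ := hτ₁.trans_le h₁
  have : 0 < τ₂ := hτ.trans_le h₂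
  rw [heatKernel, neg_div]
  refine mul_le_mul (Real.rpow_le_rpow_of_nonpos (by positivity) (by gcongr) ?_) ?_
    (Real.exp_nonneg _) (by positivity)
  · exact neg_nonpos.2 (by positivity)
  · gcongr

lemma setLIntegral_mul_wrightDensity_mul_ne_zero (hα₀ : 0 < α) (hα₁ : α < 1) {g : ℝ → ℝ≥0∞}
    (hg : Measurable g) (hg₀ : ∀ θ > 0, g θ ≠ 0) :
    ∫⁻ θ in Ioi 0, ENNReal.ofReal (θ * wrightDensity α θ) * g θ ≠ 0 := by
  intro hzero
  obtain ⟨d, hd, hmoment⟩ := exists_le_lintegral_wrightDensity hα₀ 1 0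
  have hmeas : Measurable fun θ ↦ ENNReal.ofReal (θ * wrightDensity α θ) * g θ :=
    (measurable_id.mul (measurable_wrightDensity hα₀ hα₁)).ennreal_ofReal.mul hg
  rw [lintegral_eq_zero_iff hmeas] at hzero
  refine (hmoment α le_rfl hα₁).not_gt ?_
  rw [lintegral_eq_zero_of_ae_eq_zero]
  · simpa using hd
  · filter_upwards [hzero, self_mem_ae_restrict measurableSet_Ioi] with θ hθ (hθ₀ : 0 < θ)
    rw [Real.rpow_one, (mul_eq_zero.1 hθ).resolve_right (hg₀ θ hθ₀), zero_mul, Pi.zero_apply]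

lemma exists_mul_measure_le_operatorS (hα₀ : 0 < α) (hα₁ : α < 1) {τ₁ : ℝ} (hτ₁ : 0 < τ₁)
    (τ₂ R : ℝ) (x : ℝᴺ) : ∃ J ≠ 0, ∀ τ ∈ Icc τ₁ τ₂, ∀ ν : Measure ℝᴺ,
      J * ν (Metric.closedBall 0 R) ≤ operatorS α τ ν x := by
  obtain hτ₁₂ | hτ₁₂ := lt_or_ge τ₂ τ₁
  · exact ⟨1, one_ne_zero, fun τ hτ ↦ absurd (hτ.1.trans hτ.2) hτ₁₂.not_ge⟩
  have hτ₂ : 0 < τ₂ := hτ₁.trans_le hτ₁₂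
  set g : ℝ → ℝ≥0∞ := fun θ ↦ ENNReal.ofReal ((4 * Real.pi * (τ₂ ^ α * θ)) ^ (-((N : ℝ) / 2)) *
    Real.exp (-((‖x‖ + R) ^ 2 / (4 * (τ₁ ^ α * θ)))))
  have hg : Measurable g := by fun_prop
  have hmeas : Measurable fun θ ↦ ENNReal.ofReal (θ * wrightDensity α θ) * g θ :=
    (measurable_id.mul (measurable_wrightDensity hα₀ hα₁)).ennreal_ofReal.mul hg
  refine ⟨_, setLIntegral_mul_wrightDensity_mul_ne_zero hα₀ hα₁ hg fun θ hθ ↦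
    (ENNReal.ofReal_pos.2 (by positivity)).ne', fun τ hτ ν ↦ ?_⟩
  rw [← lintegral_mul_const _ hmeas]
  refine setLIntegral_mono' measurableSet_Ioi fun θ (hθ : 0 < θ) ↦ ?_
  rw [mul_assoc, ← setLIntegral_const]
  refine mul_le_mul_right (le_trans (setLIntegral_mono' measurableSet_closedBall fun y hy ↦
    ENNReal.ofReal_le_ofReal ?_) (setLIntegral_le_lintegral (Metric.closedBall 0 R) _)) _
  have hτ₀ : 0 < τ := hτ₁.trans_le hτ.1
  exact le_heatKernel_of_norm_le (by positivity)
    (mul_le_mul_of_nonneg_right (Real.rpow_le_rpow hτ₁.le hτ.1 hα₀.le) hθ.le)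
    (mul_le_mul_of_nonneg_right (Real.rpow_le_rpow hτ₀.le hτ.2 hα₀.le) hθ.le)
    ((norm_sub_le x y).trans (add_le_add_right (mem_closedBall_zero_iff.1 hy) _))

lemma setLIntegral_powMass_lt_top [SFinite μ] (hp : 0 < p) (hα₀ : 0 < α) (hα₁ : α < 1)
    (hT : 0 < T) (hT' : T < T') (hfinite : FiniteUpTo p α μ T') :
    ∫⁻ s in Ioo 0 T, powMass p α (picardLimit p α μ) s < ∞ := by
  obtain ⟨t, ⟨htT, -⟩, x, hx⟩ := hfinite.exists_mem_Ioc hT.le hT'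
  have ht : 0 < t := hT.trans htT
  obtain ⟨J, hJ, hJS⟩ := exists_mul_measure_le_operatorS hα₀ hα₁ (sub_pos.2 htT) t
    (T ^ (α / 2)) x
  rw [picardLimit_eq_mildRHS hp hα₀ hα₁] at hx
  have hduhamel : ENNReal.ofReal α * duhamel p α (picardLimit p α μ) t x < ∞ :=
    le_add_self.trans_lt hx
  have hlow : ENNReal.ofReal (t ^ (α - 1)) * J *
      ∫⁻ s in Ioo 0 T, powMass p α (picardLimit p α μ) s ≤
        duhamel p α (picardLimit p α μ) t x := by
    rw [← lintegral_const_mul _ (measurable_powMass (measurable_picardLimit hα₀ hα₁))]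
    refine le_trans ?_ (lintegral_mono_set (Ioo_subset_Ioo_right htT.le))
    refine setLIntegral_mono' measurableSet_Ioo fun s hs ↦ ?_
    have hmass : powMass p α (picardLimit p α μ) s ≤
        (volume.withDensity fun y ↦ picardLimit p α μ s y ^ p)
          (Metric.closedBall 0 (T ^ (α / 2))) := by
      rw [withDensity_apply _ measurableSet_closedBall]
      exact lintegral_mono_set (parabolicBall_subset hα₀.le hs.1.le hs.2.le)
    rw [mul_assoc]
    refine mul_le_mul' (ENNReal.ofReal_le_ofReal ?_) ((mul_le_mul_right hmass J).trans
      (hJS (t - s) ⟨by linarith [hs.2], by linarith [hs.1]⟩ _))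
    exact Real.rpow_le_rpow_of_nonpos (by linarith [hs.2]) (by linarith [hs.1]) (by linarith)
  have hfactor : ENNReal.ofReal (t ^ (α - 1)) * J ≠ 0 :=
    mul_ne_zero (ENNReal.ofReal_pos.2 (by positivity)).ne' hJ
  refine ENNReal.lt_top_of_mul_ne_top_right (ne_top_of_le_ne_top ?_ hlow) hfactor
  exact (ENNReal.lt_top_of_mul_ne_top_right hduhamel.ne (ENNReal.ofReal_pos.2 hα₀).ne').ne

end Finiteness

section LogBound

variable {p α b c m T₁ T T' : ℝ} {μ : Measure (EuclideanSpace ℝ (Fin N))}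

lemma le_setLIntegral_picardLimit [SFinite μ] (hp : 0 < p) (hα₀ : 0 < α) (hα₁ : α < 1)
    (hb : 0 ≤ b) (hc : 0 ≤ c) (hm : 0 ≤ m) {t : ℝ} (hT₁ : 0 < T₁) (ht : t ∈ Icc T₁ T)
    (hP : ENNReal.ofReal b * μ (parabolicBall α t) ≤
      ∫⁻ x in parabolicBall α t, operatorP α t μ x)
    (hS : ∀ (ν : Measure ℝᴺ) [SFinite ν], ∀ τ, 0 < τ → τ ≤ t →
      ENNReal.ofReal c * ν (parabolicBall α t) ≤ ∫⁻ x in parabolicBall α t, operatorS α τ ν x)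
    (hμ : ENNReal.ofReal m ≤ μ (parabolicBall α T₁))
    (hfinite : ∫⁻ s in Ioo T₁ t, powMass p α (picardLimit p α μ) s ≠ ∞) :
    ENNReal.ofReal (b * m + α * c * T ^ (α - 1) *
        (∫⁻ s in Ioo T₁ t, powMass p α (picardLimit p α μ) s).toReal) ≤
      ∫⁻ x in parabolicBall α t, picardLimit p α μ t x := by
  have ht₀ : 0 < t := hT₁.trans_le ht.1
  have hT₀ : 0 < T := ht₀.trans_le ht.2
  have hmass := le_setLIntegral_mildRHS (p := p) hα₀ hα₁ hP hS
    (measurable_picardLimit (p := p) (μ := μ) hα₀ hα₁)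
  simp only [← picardLimit_eq_mildRHS hp hα₀ hα₁] at hmass
  refine le_trans ?_ hmass
  have hpow : T ^ (α - 1) ≤ t ^ (α - 1) :=
    Real.rpow_le_rpow_of_nonpos ht₀ ht.2 (by linarith)
  rw [ENNReal.ofReal_add (by positivity) (by positivity), ENNReal.ofReal_mul hb,
    show α * c * T ^ (α - 1) = α * (T ^ (α - 1) * c) by ring, mul_assoc α, mul_assoc (T ^ (α - 1)),
    ENNReal.ofReal_mul hα₀.le, ENNReal.ofReal_mul (by positivity), ENNReal.ofReal_mul hc,
    ENNReal.ofReal_toReal hfinite]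
  gcongr
  exact hμ.trans (measure_mono (parabolicBall_subset hα₀.le hT₁.le ht.1))

lemma rpow_mul_inv_le_inv_rpow (hα₁ : α ≤ 1) {t : ℝ} (hT₁ : 0 < T₁) (ht : T₁ ≤ t) :
    T₁ ^ (1 - α) * t⁻¹ ≤ (t ^ α)⁻¹ := by
  have ht₀ : 0 < t := hT₁.trans_le ht
  calc T₁ ^ (1 - α) * t⁻¹ ≤ t ^ (1 - α) * t⁻¹ := by gcongr
    _ = (t ^ α)⁻¹ := by
      rw [Real.rpow_sub ht₀, Real.rpow_one]
      field_simp

lemma FiniteUpTo.log_div_le [SFinite μ] (hfinite : FiniteUpTo p α μ T') (hN : 1 ≤ N)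
    (hp : p = fujitaExponent N) (hα₀ : 0 < α) (hα₁ : α < 1) (hb : 0 < b) (hc : 0 < c)
    (hP : ∀ t > 0, ENNReal.ofReal b * μ (parabolicBall α t) ≤
      ∫⁻ x in parabolicBall α t, operatorP α t μ x)
    (hS : ∀ (ν : Measure ℝᴺ) [SFinite ν], ∀ τ t, 0 < τ → τ ≤ t →
      ENNReal.ofReal c * ν (parabolicBall α t) ≤ ∫⁻ x in parabolicBall α t, operatorS α τ ν x)
    (hT₁ : 0 < T₁) (hT : T₁ ≤ T) (hT' : T < T') (hm : 0 < m)
    (hμ : ENNReal.ofReal m ≤ μ (parabolicBall α T₁)) :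
    Real.log (T / T₁) ≤ (b * m) ^ (1 - p) / (α * c * T ^ (α - 1) *
      (T₁ ^ (1 - α) / volume.real (Metric.ball (0 : ℝᴺ) 1) ^ (p - 1))) * (1 - 2 ^ (1 - p))⁻¹ := by
  have hp₁ : 1 < p := hp ▸ one_lt_fujitaExponent hN
  have hT₀ : 0 < T := hT₁.trans_le hT
  have hω : 0 < volume.real (Metric.ball (0 : ℝᴺ) 1) := volume_real_ball_zero_one_pos
  have hmass : ∀ t ≤ T, ∫⁻ s in Ioo T₁ t, powMass p α (picardLimit p α μ) s ≠ ∞ := fun t ht ↦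
    ((lintegral_mono_set (Ioo_subset_Ioo hT₁.le ht)).trans_lt
      (setLIntegral_powMass_lt_top (by linarith) hα₀ hα₁ hT₀ hT' hfinite)).ne
  refine log_div_le_of_rpow_mul_inv_le hp₁ (by positivity) (by positivity) (by positivity) hT₁ hT
    (hmass T le_rfl) fun t ht ↦ ?_
  have ht₀ : 0 < t := hT₁.trans_le ht.1
  have hu : Measurable (picardLimit p α μ t) :=
    (measurable_picardLimit hα₀ hα₁).comp (f := fun x ↦ (t, x)) (by fun_prop)
  refine le_trans (ENNReal.ofReal_le_ofReal ?_) (ofReal_div_le_powMass hN hp ht₀ hu (by positivity)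
    (le_setLIntegral_picardLimit (by linarith) hα₀ hα₁ hb.le hc.le hm.le hT₁ ht (hP t ht₀)
      (fun ν _ τ ↦ hS ν τ t) hμ (hmass t ht.2)))
  rw [div_mul_eq_mul_div, div_mul_eq_mul_div, mul_right_comm, div_mul_eq_div_div,
    div_eq_inv_mul (_ ^ p)]
  gcongr
  exact rpow_mul_inv_le_inv_rpow hα₁.le hT₁ ht.1

lemma exp_neg_one_le_rpow_mul_rpow (hT₁ : 0 < T₁) (hT : 0 < T)
    (hlog : (1 - α) * Real.log (T / T₁) ≤ 1) :
    Real.exp (-1) ≤ T ^ (α - 1) * T₁ ^ (1 - α) := by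
  rw [Real.log_div hT.ne' hT₁.ne'] at hlog
  rw [Real.rpow_def_of_pos hT, Real.rpow_def_of_pos hT₁, ← Real.exp_add]
  exact Real.exp_le_exp.2 (by linarith)

lemma exists_log_mul_rpow_le (hN : 1 ≤ N) (hp : p = fujitaExponent N) {α₀ : ℝ} (hα₀ : 0 < α₀) :
    ∃ C > 0, ∀ α, α₀ ≤ α → α < 1 → ∀ (μ : Measure ℝᴺ) [SFinite μ], ∀ T₁ T T' m, 0 < T₁ → T₁ ≤ T →
      T < T' → (1 - α) * Real.log (T / T₁) ≤ 1 → FiniteUpTo p α μ T' → 0 < m →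
        ENNReal.ofReal m ≤ μ (parabolicBall α T₁) → Real.log (T / T₁) * m ^ (p - 1) ≤ C := by
  obtain ⟨b, hb, hP⟩ := exists_le_setLIntegral_operatorP (N := N) hα₀
  obtain ⟨c, hc, hS⟩ := exists_le_setLIntegral_operatorS (N := N) hα₀
  have hp₁ : 1 < p := hp ▸ one_lt_fujitaExponent hN
  have hω : 0 < volume.real (Metric.ball (0 : ℝᴺ) 1) := volume_real_ball_zero_one_pos
  set k : ℝ := α₀ * c * Real.exp (-1) / volume.real (Metric.ball (0 : ℝᴺ) 1) ^ (p - 1)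
  have hgap : 0 < 1 - (2 : ℝ) ^ (1 - p) :=
    sub_pos.2 (Real.rpow_lt_one_of_one_lt_of_neg one_lt_two (by linarith))
  refine ⟨b ^ (1 - p) / k * (1 - 2 ^ (1 - p))⁻¹, by positivity,
    fun α hα hα₁ μ _ T₁ T T' m hT₁ hT hT' hlog hfinite hm hμ ↦ ?_⟩
  have hα' : 0 < α := hα₀.trans_le hα
  have hT₀ : 0 < T := hT₁.trans_le hT
  have hk : k ≤ α * c * T ^ (α - 1) *
      (T₁ ^ (1 - α) / volume.real (Metric.ball (0 : ℝᴺ) 1) ^ (p - 1)) := by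
    have hexp := exp_neg_one_le_rpow_mul_rpow hT₁ hT₀ hlog
    rw [mul_div_assoc', mul_assoc (α * c)]
    unfold k
    gcongr
  calc Real.log (T / T₁) * m ^ (p - 1)
      ≤ (b * m) ^ (1 - p) / k * (1 - 2 ^ (1 - p))⁻¹ * m ^ (p - 1) := by
        refine mul_le_mul_of_nonneg_right ((hfinite.log_div_le hN hp hα' hα₁ hb hc
          (fun t ht ↦ hP α hα hα₁ μ t t ht le_rfl) (fun ν _ ↦ hS α hα hα₁ ν) hT₁ hT hT' hm
          hμ).trans ?_) (by positivity)
        gcongr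
    _ = b ^ (1 - p) / k * (1 - 2 ^ (1 - p))⁻¹ * (m ^ (1 - p) * m ^ (p - 1)) := by
        rw [Real.mul_rpow hb.le hm.le]
        ring
    _ = _ := by
        rw [← Real.rpow_add hm]
        simp

end LogBound

/-! ### Life span for decaying initial data -/

section DecayingDatum

variable {A κ : ℝ}

instance : SFinite (decayingDatum N A κ) := by
  unfold decayingDatum
  infer_instance

lemma decayingDatum_le_smul_volume (hA : 0 ≤ A) (hκ : 0 ≤ κ) :
    decayingDatum N A κ ≤ ENNReal.ofReal κ • volume := by
  rw [decayingDatum, ← withDensity_const]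
  refine withDensity_mono (.of_forall fun x ↦ ENNReal.ofReal_le_ofReal ?_)
  exact mul_le_of_le_one_right hκ
    (Real.rpow_le_one_of_one_le_of_nonpos (by linarith [norm_nonneg x]) (by linarith))

lemma decayingDatum_mono (A : ℝ) : Monotone (decayingDatum N A) := fun _ _ h ↦
  withDensity_mono (.of_forall fun _ ↦ ENNReal.ofReal_le_ofReal
    (mul_le_mul_of_nonneg_right h (by positivity)))

lemma exists_decayingDatum_univ_le {m : ℝ} (hA : N < A) (hm : 0 < m) :
    ∃ κ > 0, decayingDatum N A κ univ ≤ ENNReal.ofReal m := by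
  have hinteg : Integrable (fun x : ℝᴺ ↦ (1 + ‖x‖) ^ (-A)) volume :=
    integrable_one_add_norm (by simpa using hA)
  set M := ∫ x : ℝᴺ, (1 + ‖x‖) ^ (-A)
  have : 0 ≤ M := integral_nonneg fun x ↦ by positivity
  refine ⟨m / (M + 1), by positivity, ?_⟩
  rw [decayingDatum, withDensity_apply _ .univ, Measure.restrict_univ,
    ← ofReal_integral_eq_lintegral_ofReal (hinteg.const_mul _)
      (.of_forall fun x ↦ by positivity), integral_const_mul]
  refine ENNReal.ofReal_le_ofReal ?_
  rw [div_mul_eq_mul_div, div_le_iff₀ (by positivity)]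
  gcongr
  linarith

lemma exists_le_decayingDatum_closedBall (hA : 0 ≤ A) :
    ∃ c > 0, ∀ κ R : ℝ, 0 ≤ κ → 1 ≤ R →
      ENNReal.ofReal (c * κ) ≤ decayingDatum N A κ (Metric.closedBall 0 R) := by
  have hω : 0 < volume.real (Metric.closedBall (0 : ℝᴺ) 1) := ENNReal.toReal_pos
    (Metric.measure_closedBall_pos _ _ one_pos).ne' measure_closedBall_lt_top.ne
  refine ⟨2 ^ (-A) * volume.real (Metric.closedBall (0 : ℝᴺ) 1), by positivity,
    fun κ R hκ hR ↦ ?_⟩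
  refine le_trans ?_ (measure_mono (Metric.closedBall_subset_closedBall hR))
  rw [decayingDatum, withDensity_apply _ measurableSet_closedBall, mul_comm, ← mul_assoc,
    ENNReal.ofReal_mul (by positivity), ofReal_measureReal measure_closedBall_lt_top.ne,
    ← setLIntegral_const]
  refine setLIntegral_mono' measurableSet_closedBall fun x hx ↦
    ENNReal.ofReal_le_ofReal (mul_le_mul_of_nonneg_left ?_ hκ)
  exact Real.rpow_le_rpow_of_nonpos (by positivity)
    (by linarith [mem_closedBall_zero_iff.1 hx]) (by linarith)

lemma setIntegral_closedBall_fun_norm {E : Type*} [NormedAddCommGroup E] [NormedSpace ℝ E]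
    [FiniteDimensional ℝ E] [Nontrivial E] [MeasurableSpace E] [BorelSpace E] (μ : Measure E)
    [μ.IsAddHaarMeasure] (f : ℝ → ℝ) (R : ℝ) :
    ∫ x in Metric.closedBall 0 R, f ‖x‖ ∂μ = Module.finrank ℝ E * μ.real (Metric.ball 0 1) *
      ∫ y in Ioc 0 R, y ^ (Module.finrank ℝ E - 1) * f y := by
  have hindicator : (fun x : E ↦ (Iic R).indicator f ‖x‖) =
      (Metric.closedBall 0 R).indicator fun x ↦ f ‖x‖ := by
    ext x
    simp [indicator]
  have hpolar := integral_fun_norm_addHaar μ ((Iic R).indicator f)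
  rw [hindicator, integral_indicator measurableSet_closedBall] at hpolar
  rw [hpolar, nsmul_eq_mul, smul_eq_mul, ← mul_assoc, ← Ioi_inter_Iic,
    ← setIntegral_indicator measurableSet_Iic]
  simp only [smul_eq_mul, indicator_mul_right]

lemma two_rpow_neg_mul_inv_le (hN : 1 ≤ N) {y : ℝ} (hy : 1 ≤ y) :
    2 ^ (-(N : ℝ)) * y⁻¹ ≤ y ^ (N - 1) * (1 + y) ^ (-(N : ℝ)) := by
  have hy₀ : 0 < y := by linarith
  have hpow : y ^ (N - 1) * y ^ (-(N : ℝ)) = y⁻¹ := by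
    rw [← Real.rpow_natCast, ← Real.rpow_add hy₀, Nat.cast_sub hN, ← Real.rpow_neg_one]
    congr 1
    push_cast
    ring
  calc 2 ^ (-(N : ℝ)) * y⁻¹ = y ^ (N - 1) * (2 * y) ^ (-(N : ℝ)) := by
        rw [← hpow, Real.mul_rpow zero_le_two hy₀.le]
        ring
    _ ≤ y ^ (N - 1) * (1 + y) ^ (-(N : ℝ)) := mul_le_mul_of_nonneg_left
        (Real.rpow_le_rpow_of_nonpos (by positivity) (by linarith) (by simp)) (by positivity)

lemma log_le_setIntegral_pow_mul_rpow (hN : 1 ≤ N) {R : ℝ} (hR : 1 ≤ R) :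
    2 ^ (-(N : ℝ)) * Real.log R ≤ ∫ y in Ioc 0 R, y ^ (N - 1) * (1 + y) ^ (-(N : ℝ)) := by
  have hR₀ : 0 < R := by linarith
  have hcont : ContinuousOn (fun y : ℝ ↦ y ^ (N - 1) * (1 + y) ^ (-(N : ℝ))) (Icc 0 R) :=
    ContinuousOn.mul (by fun_prop) (ContinuousOn.rpow_const (by fun_prop)
      fun y hy ↦ .inl (by linarith [hy.1]))
  have hinteg : IntervalIntegrable (fun y : ℝ ↦ y⁻¹) volume 1 R :=
    intervalIntegral.intervalIntegrable_inv
      (fun y hy ↦ (one_pos.trans_le (uIcc_of_le hR ▸ hy).1).ne') continuousOn_id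
  rw [← div_one R, ← integral_inv_of_pos one_pos hR₀, div_one,
    ← intervalIntegral.integral_const_mul]
  calc ∫ y in (1 : ℝ)..R, 2 ^ (-(N : ℝ)) * y⁻¹
      ≤ ∫ y in (1 : ℝ)..R, y ^ (N - 1) * (1 + y) ^ (-(N : ℝ)) :=
        intervalIntegral.integral_mono_on hR (hinteg.const_mul _)
          ((hcont.mono (Icc_subset_Icc_left zero_le_one)).intervalIntegrable_of_Icc hR)
          fun y hy ↦ two_rpow_neg_mul_inv_le hN hy.1
    _ = ∫ y in Ioc 1 R, y ^ (N - 1) * (1 + y) ^ (-(N : ℝ)) :=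
        intervalIntegral.integral_of_le hR
    _ ≤ ∫ y in Ioc 0 R, y ^ (N - 1) * (1 + y) ^ (-(N : ℝ)) := by
        refine setIntegral_mono_set ((hcont.integrableOn_Icc).mono_set Ioc_subset_Icc_self) ?_
          (Ioc_subset_Ioc_left zero_le_one).eventuallyLE
        filter_upwards [self_mem_ae_restrict measurableSet_Ioc] with y hy
        have : 0 < y := hy.1
        positivity

lemma exists_log_le_decayingDatum_closedBall (hN : 1 ≤ N) :
    ∃ c > 0, ∀ κ R : ℝ, 0 ≤ κ → 1 ≤ R →
      ENNReal.ofReal (c * κ * Real.log R) ≤ decayingDatum N N κ (Metric.closedBall 0 R) := by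
  have hω : 0 < volume.real (Metric.ball (0 : ℝᴺ) 1) := volume_real_ball_zero_one_pos
  have : Nonempty (Fin N) := ⟨⟨0, hN⟩⟩
  refine ⟨N * volume.real (Metric.ball (0 : ℝᴺ) 1) * 2 ^ (-(N : ℝ)), by positivity,
    fun κ R hκ hR ↦ ?_⟩
  have hinteg : IntegrableOn (fun x : ℝᴺ ↦ (1 + ‖x‖) ^ (-(N : ℝ))) (Metric.closedBall 0 R) :=
    (Continuous.rpow_const (by fun_prop) fun x ↦ .inl (by positivity)).continuousOn
      |>.integrableOn_compact (isCompact_closedBall _ _)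
  rw [decayingDatum, withDensity_apply _ measurableSet_closedBall,
    ← ofReal_integral_eq_lintegral_ofReal (hinteg.const_mul κ) (.of_forall fun x ↦ by positivity),
    integral_const_mul, setIntegral_closedBall_fun_norm volume fun y ↦ (1 + y) ^ (-(N : ℝ)),
    finrank_euclideanSpace_fin]
  refine ENNReal.ofReal_le_ofReal ?_
  have hlog := log_le_setIntegral_pow_mul_rpow hN hR
  calc _ = κ * (N * volume.real (Metric.ball (0 : ℝᴺ) 1) *
        (2 ^ (-(N : ℝ)) * Real.log R)) := by ring
    _ ≤ _ := by gcongr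

end DecayingDatum

section LifeSpan

variable {p A α α₀ κ : ℝ}

lemma rpow_div_four_le_mul_exp_neg_rpow {L T : ℝ} (hα : 0 ≤ α) (hT : 0 < T)
    (hL : L ≤ Real.log T / 2) : T ^ (α / 4) ≤ (T * Real.exp (-L)) ^ (α / 2) := by
  have hsqrt : T ^ (1 / 2 : ℝ) ≤ T * Real.exp (-L) := by
    rw [Real.rpow_def_of_pos hT]
    nth_rewrite 2 [← Real.exp_log hT]
    rw [← Real.exp_add]
    exact Real.exp_le_exp.2 (by linarith)
  calc T ^ (α / 4) = (T ^ (1 / 2 : ℝ)) ^ (α / 2) := by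
        rw [← Real.rpow_mul hT.le]
        congr 1
        ring
    _ ≤ (T * Real.exp (-L)) ^ (α / 2) := Real.rpow_le_rpow (by positivity) hsqrt (by positivity)

lemma exists_min_log_mul_rpow_le (hN : 1 ≤ N) (hp : p = fujitaExponent N) (hα₀ : 0 < α₀) :
    ∃ C > 0, ∀ α, α₀ ≤ α → α < 1 → ∀ (μ : Measure ℝᴺ) [SFinite μ], ∀ T m, 1 < T → 0 < m →
      ENNReal.ofReal T < lifeSpan p α μ →
        ENNReal.ofReal m ≤ μ (Metric.closedBall 0 (T ^ (α / 4))) →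
          min (Real.log T / 2) (1 / (1 - α)) * m ^ (p - 1) ≤ C := by
  obtain ⟨C, hC, hbound⟩ := exists_log_mul_rpow_le hN hp hα₀
  have hp₀ : 0 < p := zero_lt_one.trans (hp ▸ one_lt_fujitaExponent hN)
  refine ⟨C, hC, fun α hα hα₁ μ _ T m hT hm hlife hμ ↦ ?_⟩
  have hα' : 0 < α := hα₀.trans_le hα
  have hα₁' : 0 < 1 - α := by linarith
  have hT₀ : 0 < T := by linarith
  have hlogT : 0 < Real.log T := Real.log_pos hT
  set L := min (Real.log T / 2) (1 / (1 - α))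
  have hL : 0 < L := lt_min (by positivity) (by positivity)
  obtain ⟨T', hTT', hT'⟩ := ENNReal.lt_iff_exists_nnreal_btwn.1 hlife
  rw [← ENNReal.ofReal_coe_nnreal] at hTT' hT'
  have hlog : Real.log (T / (T * Real.exp (-L))) = L := by
    rw [Real.log_div hT₀.ne' (by positivity), Real.log_mul hT₀.ne' (Real.exp_pos _).ne',
      Real.log_exp]
    ring
  rw [← hlog]
  refine hbound α hα hα₁ μ (T * Real.exp (-L)) T T' m (by positivity)
    (mul_le_of_le_one_right hT₀.le (Real.exp_le_one_iff.2 (by linarith)))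
    ((ENNReal.ofReal_lt_ofReal_iff_of_nonneg hT₀.le).1 hTT') ?_
    (finiteUpTo_of_lt_lifeSpan hp₀ hα' hα₁ hT') hm
    (hμ.trans (measure_mono (Metric.closedBall_subset_closedBall
      (rpow_div_four_le_mul_exp_neg_rpow hα'.le hT₀ (min_le_left _ _)))))
  rw [hlog, mul_comm, ← le_div_iff₀ hα₁']
  exact min_le_right _ _

lemma rpow_mul_log_le_min {T : ℝ} (hα : α < 1) (hT : 1 < T) :
    T ^ ((α - 1) / 2) * Real.log T ≤ 2 * min (Real.log T / 2) (1 / (1 - α)) := by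
  have hT₀ : 0 < T := by linarith
  have hlogT : 0 < Real.log T := Real.log_pos hT
  have hα' : 0 < 1 - α := by linarith
  rw [mul_min_of_nonneg _ _ zero_le_two]
  refine le_min ?_ ?_
  · rw [mul_div_cancel₀ _ two_ne_zero]
    exact mul_le_of_le_one_left hlogT.le
      (Real.rpow_le_one_of_one_le_of_nonpos hT.le (by linarith))
  · set y := (1 - α) / 2 * Real.log T with hy
    have hrpow : T ^ ((α - 1) / 2) = (Real.exp y)⁻¹ := by
      rw [Real.rpow_def_of_pos hT₀, ← Real.exp_neg, hy]
      congr 1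
      ring
    have hlog : Real.log T = y * (2 * (1 / (1 - α))) := by
      rw [hy]
      field_simp
    rw [hrpow, hlog, ← mul_assoc]
    refine mul_le_of_le_one_left (by positivity) ?_
    rw [inv_mul_le_one₀ (Real.exp_pos y)]
    linarith [Real.add_one_le_exp y]

lemma one_le_min_log {T : ℝ} (hα₀ : 0 ≤ α) (hα₁ : α < 1) (hT : Real.exp 2 ≤ T) :
    1 ≤ min (Real.log T / 2) (1 / (1 - α)) := by
  have hlog := Real.log_le_log (Real.exp_pos 2) hT
  rw [Real.log_exp] at hlog
  refine le_min (by linarith) ?_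
  rw [le_div_iff₀ (by linarith)]
  linarith

lemma rpow_mul_log_le_of_forall_lt {a B T₀ : ℝ} (hT₀ : 0 < T₀) (hB : 0 ≤ B)
    (h : ∀ T, 1 < T → T < T₀ → T ^ a * Real.log T ≤ B) : T₀ ^ a * Real.log T₀ ≤ B := by
  obtain hT₁ | hT₁ := le_or_gt T₀ 1
  · exact (mul_nonpos_of_nonneg_of_nonpos (by positivity) (Real.log_nonpos hT₀.le hT₁)).trans hB
  · have hcont : ContinuousAt (fun T : ℝ ↦ T ^ a * Real.log T) T₀ :=
      (Real.continuousAt_rpow_const _ _ (.inl hT₀.ne')).mul (Real.continuousAt_log hT₀.ne')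
    refine le_of_tendsto (hcont.tendsto.mono_left (nhdsWithin_le_nhds (s := Iio T₀))) ?_
    filter_upwards [Ioo_mem_nhdsLT hT₁] with T hT
    exact h T hT.1 hT.2

lemma exists_eq_ofReal_rpow_mul_log_le {a B : ℝ} {L : ℝ≥0∞} (hL₀ : 0 < L) (hL : L < ∞)
    (hB : 0 ≤ B) (h : ∀ T, 1 < T → ENNReal.ofReal T < L → T ^ a * Real.log T ≤ B) :
    ∃ T > 0, L = ENNReal.ofReal T ∧ T ^ a * Real.log T ≤ B := by
  have hpos : 0 < L.toReal := ENNReal.toReal_pos hL₀.ne' hL.ne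
  exact ⟨L.toReal, hpos, (ENNReal.ofReal_toReal hL.ne).symm,
    rpow_mul_log_le_of_forall_lt hpos hB fun T hT hTL ↦
      h T hT ((ENNReal.ofReal_lt_iff_lt_toReal (by linarith) hL.ne).2 hTL)⟩

lemma lifeSpan_decayingDatum_pos (hp : 0 < p) (hα₀ : 0 < α) (hα₁ : α < 1) (hA : 0 ≤ A)
    (hκ : 0 ≤ κ) : 0 < lifeSpan p α (decayingDatum N A κ) := by
  obtain ⟨T, hT, hfinite⟩ := exists_finiteUpTo_of_le_smul_volume hp.le hα₀ hα₁
    ENNReal.ofReal_ne_top (decayingDatum_le_smul_volume (N := N) hA hκ)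
  exact (ENNReal.ofReal_pos.2 hT).trans_le (hfinite.le_lifeSpan hp hα₀ hα₁ hT)

lemma exists_lifeSpan_decayingDatum_eq_top (hN : 1 ≤ N) (hp : p = fujitaExponent N) (hA : N < A)
    (hα₀ : 0 < α) (hα₁ : α < 1) : ∃ κ > 0, lifeSpan p α (decayingDatum N A κ) = ∞ := by
  have hp₀ : 0 < p := zero_lt_one.trans (hp ▸ one_lt_fujitaExponent hN)
  obtain ⟨m, hm, hfinite⟩ := exists_finiteUpTo_of_measure_univ_le hN hp hα₀ hα₁
  obtain ⟨κ, hκ, hmass⟩ := exists_decayingDatum_univ_le hA hm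
  refine ⟨κ, hκ, ENNReal.eq_top_of_forall_nnreal_le fun r ↦ ?_⟩
  refine le_trans ?_ ((hfinite _ hmass (r + 1)).le_lifeSpan hp₀ hα₀ hα₁ (by positivity))
  rw [← ENNReal.ofReal_coe_nnreal]
  exact ENNReal.ofReal_le_ofReal (by linarith)

lemma exists_min_log_mul_size_rpow_le (hN : 1 ≤ N) (hp : p = fujitaExponent N) (hA : 0 ≤ A)
    (hα₀ : 0 < α₀) :
    ∃ C > 0, ∀ α, α₀ ≤ α → α < 1 → ∀ κ T : ℝ, 0 < κ → 1 < T →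
      ENNReal.ofReal T < lifeSpan p α (decayingDatum N A κ) →
        min (Real.log T / 2) (1 / (1 - α)) * κ ^ (p - 1) ≤ C := by
  obtain ⟨C, hC, hbound⟩ := exists_min_log_mul_rpow_le hN hp hα₀
  obtain ⟨c, hc, hmass⟩ := exists_le_decayingDatum_closedBall (N := N) hA
  refine ⟨C / c ^ (p - 1), by positivity, fun α hα hα₁ κ T hκ hT hlife ↦ ?_⟩
  have hmin := hbound α hα hα₁ _ T (c * κ) hT (by positivity) hlife
    (hmass κ _ hκ.le (Real.one_le_rpow hT.le (by linarith)))
  rw [Real.mul_rpow hc.le hκ.le] at hmin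
  rw [le_div_iff₀ (by positivity)]
  linarith

lemma exists_min_log_mul_size_mul_log_rpow_le (hN : 1 ≤ N) (hp : p = fujitaExponent N)
    (hα₀ : 0 < α₀) :
    ∃ C > 0, ∀ α, α₀ ≤ α → α < 1 → ∀ κ T : ℝ, 0 < κ → 1 < T →
      ENNReal.ofReal T < lifeSpan p α (decayingDatum N N κ) →
        min (Real.log T / 2) (1 / (1 - α)) * (κ * Real.log T) ^ (p - 1) ≤ C := by
  obtain ⟨C, hC, hbound⟩ := exists_min_log_mul_rpow_le hN hp hα₀
  obtain ⟨c, hc, hmass⟩ := exists_log_le_decayingDatum_closedBall hN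
  refine ⟨C / (c * α₀ / 4) ^ (p - 1), by positivity, fun α hα hα₁ κ T hκ hT hlife ↦ ?_⟩
  have hlogT : 0 < Real.log T := Real.log_pos hT
  have hlog : c * α₀ / 4 * (κ * Real.log T) ≤ c * κ * Real.log (T ^ (α / 4)) := by
    rw [Real.log_rpow (by linarith)]
    calc c * α₀ / 4 * (κ * Real.log T) = c * κ * (α₀ / 4 * Real.log T) := by ring
      _ ≤ c * κ * (α / 4 * Real.log T) := by gcongr
  have hmin := hbound α hα hα₁ _ T (c * α₀ / 4 * (κ * Real.log T)) hT (by positivity) hlife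
    ((ENNReal.ofReal_le_ofReal hlog).trans
      (hmass κ _ hκ.le (Real.one_le_rpow hT.le (by linarith))))
  rw [Real.mul_rpow (by positivity) (by positivity)] at hmin
  rw [le_div_iff₀ (by positivity)]
  linarith

/-- The threshold `K(α)`: the supremum of the sizes `κ` for which the minimal solution is global. -/
def criticalSize (N : ℕ) (p A α : ℝ) : ℝ :=
  sSup {κ : ℝ | 0 < κ ∧ lifeSpan p α (decayingDatum N A κ) = ∞}

lemma bddAbove_lifeSpan_decayingDatum_eq_top (hN : 1 ≤ N) (hp : p = fujitaExponent N) (hA : 0 ≤ A)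
    (hα₀ : 0 < α) (hα₁ : α < 1) :
    BddAbove {κ : ℝ | 0 < κ ∧ lifeSpan p α (decayingDatum N A κ) = ∞} := by
  have hp₁ : 1 < p := hp ▸ one_lt_fujitaExponent hN
  obtain ⟨C, hC, hbound⟩ := exists_min_log_mul_size_rpow_le hN hp hA hα₀
  refine ⟨C ^ (p - 1)⁻¹, fun κ ⟨hκ, hlife⟩ ↦ ?_⟩
  rw [Real.le_rpow_inv_iff_of_pos hκ.le hC.le (by linarith)]
  exact (le_mul_of_one_le_left (by positivity) (one_le_min_log hα₀.le hα₁ le_rfl)).trans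
    (hbound α le_rfl hα₁ κ (Real.exp 2) hκ (Real.one_lt_exp_iff.2 two_pos)
      (hlife ▸ ENNReal.ofReal_lt_top))

lemma criticalSize_pos (hN : 1 ≤ N) (hp : p = fujitaExponent N) (hA : N < A) (hα₀ : 0 < α)
    (hα₁ : α < 1) : 0 < criticalSize N p A α := by
  obtain ⟨κ, hκ, hlife⟩ := exists_lifeSpan_decayingDatum_eq_top hN hp hA hα₀ hα₁
  exact hκ.trans_le (le_csSup (bddAbove_lifeSpan_decayingDatum_eq_top hN hp
    (N.cast_nonneg.trans hA.le) hα₀ hα₁) ⟨hκ, hlife⟩)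

lemma lifeSpan_eq_top_of_lt_criticalSize (hN : 1 ≤ N) (hp : p = fujitaExponent N) (hA : N < A)
    (hα₀ : 0 < α) (hα₁ : α < 1) (hκ : κ < criticalSize N p A α) :
    lifeSpan p α (decayingDatum N A κ) = ∞ := by
  have hp₀ : 0 < p := zero_lt_one.trans (hp ▸ one_lt_fujitaExponent hN)
  obtain ⟨κ', ⟨-, hlife⟩, hκ'⟩ := exists_lt_of_lt_csSup
    (exists_lifeSpan_decayingDatum_eq_top hN hp hA hα₀ hα₁) hκ
  exact top_le_iff.1 (hlife ▸ lifeSpan_anti hp₀ hα₀ hα₁ (decayingDatum_mono A hκ'.le))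

lemma lifeSpan_lt_top_of_criticalSize_lt (hN : 1 ≤ N) (hp : p = fujitaExponent N) (hA : N < A)
    (hα₀ : 0 < α) (hα₁ : α < 1) (hκ : criticalSize N p A α < κ) :
    lifeSpan p α (decayingDatum N A κ) < ∞ :=
  lt_top_iff_ne_top.2 fun hlife ↦ hκ.not_ge (le_csSup
    (bddAbove_lifeSpan_decayingDatum_eq_top hN hp (N.cast_nonneg.trans hA.le) hα₀ hα₁)
    ⟨(criticalSize_pos hN hp hA hα₀ hα₁).trans hκ, hlife⟩)

lemma exists_rpow_mul_log_lifeSpan_le (hN : 1 ≤ N) (hp : p = fujitaExponent N) (hA : N < A)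
    (hα₀ : 0 < α₀) :
    ∃ C > 0, ∀ α, α₀ ≤ α → α < 1 → ∀ κ, criticalSize N p A α < κ →
      ∃ T > 0, lifeSpan p α (decayingDatum N A κ) = ENNReal.ofReal T ∧
        T ^ ((α - 1) / 2) * Real.log T ≤ C * κ ^ (-(p - 1)) := by
  have hp₀ : 0 < p := zero_lt_one.trans (hp ▸ one_lt_fujitaExponent hN)
  have hA₀ : 0 ≤ A := N.cast_nonneg.trans hA.le
  obtain ⟨C, hC, hbound⟩ := exists_min_log_mul_size_rpow_le hN hp hA₀ hα₀
  refine ⟨2 * C, by positivity, fun α hα hα₁ κ hκ ↦ ?_⟩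
  have hα' : 0 < α := hα₀.trans_le hα
  have hκ₀ : 0 < κ := (criticalSize_pos hN hp hA hα' hα₁).trans hκ
  refine exists_eq_ofReal_rpow_mul_log_le (lifeSpan_decayingDatum_pos hp₀ hα' hα₁ hA₀ hκ₀.le)
    (lifeSpan_lt_top_of_criticalSize_lt hN hp hA hα' hα₁ hκ) (by positivity) fun T hT hlife ↦ ?_
  rw [Real.rpow_neg hκ₀.le, ← div_eq_mul_inv, le_div_iff₀ (by positivity)]
  calc T ^ ((α - 1) / 2) * Real.log T * κ ^ (p - 1)
      ≤ 2 * min (Real.log T / 2) (1 / (1 - α)) * κ ^ (p - 1) := by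
        exact mul_le_mul_of_nonneg_right (rpow_mul_log_le_min hα₁ hT) (by positivity)
    _ ≤ 2 * C := by linarith [hbound α hα hα₁ κ T hκ₀ hT hlife]

lemma lifeSpan_critical_decay_lt_top (hN : 1 ≤ N) (hp : p = fujitaExponent N) (hα₀ : 0 < α)
    (hα₁ : α < 1) (hκ : 0 < κ) : lifeSpan p α (decayingDatum N N κ) < ∞ := by
  have hp₁ : 1 < p := hp ▸ one_lt_fujitaExponent hN
  obtain ⟨C, hC, hbound⟩ := exists_min_log_mul_size_mul_log_rpow_le hN hp hα₀
  refine lt_top_iff_ne_top.2 fun hlife ↦ ?_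
  set b := C ^ (p - 1)⁻¹ / κ
  have hb : 0 < b := by positivity
  have hmin := hbound α le_rfl hα₁ κ (Real.exp (b + 2)) hκ (Real.one_lt_exp_iff.2 (by positivity))
    (hlife ▸ ENNReal.ofReal_lt_top)
  have hpow : (κ * (b + 2)) ^ (p - 1) ≤ C := by
    rw [Real.log_exp] at hmin
    refine (le_mul_of_one_le_left (by positivity) ?_).trans hmin
    simpa only [Real.log_exp] using
      one_le_min_log hα₀.le hα₁ (Real.exp_le_exp.2 (by linarith : 2 ≤ b + 2))
  rw [← Real.le_rpow_inv_iff_of_pos (by positivity) hC.le (by linarith), ← le_div_iff₀' hκ] at hpow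
  linarith

lemma rpow_mul_log_rpow {T : ℝ} (hp : 0 < p) (hT : 1 < T) (a : ℝ) :
    (T ^ (a / p) * Real.log T) ^ p = T ^ a * Real.log T * Real.log T ^ (p - 1) := by
  have hlogT : 0 < Real.log T := Real.log_pos hT
  rw [Real.mul_rpow (by positivity) hlogT.le, ← Real.rpow_mul (by linarith),
    div_mul_cancel₀ _ hp.ne', mul_assoc, ← Real.rpow_one_add' hlogT.le (by linarith)]
  congr 2
  ring

lemma exists_rpow_mul_log_lifeSpan_critical_decay_le (hN : 1 ≤ N) (hp : p = fujitaExponent N)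
    (hα₀ : 0 < α₀) :
    ∃ C > 0, ∀ α, α₀ ≤ α → α < 1 → ∀ κ > 0,
      ∃ T > 0, lifeSpan p α (decayingDatum N N κ) = ENNReal.ofReal T ∧
        T ^ ((α - 1) / (2 * p)) * Real.log T ≤ C * κ ^ (-((p - 1) / p)) := by
  have hp₀ : 0 < p := zero_lt_one.trans (hp ▸ one_lt_fujitaExponent hN)
  obtain ⟨C, hC, hbound⟩ := exists_min_log_mul_size_mul_log_rpow_le hN hp hα₀
  refine ⟨(2 * C) ^ p⁻¹, by positivity, fun α hα hα₁ κ hκ ↦ ?_⟩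
  have hα' : 0 < α := hα₀.trans_le hα
  refine exists_eq_ofReal_rpow_mul_log_le
    (lifeSpan_decayingDatum_pos hp₀ hα' hα₁ N.cast_nonneg hκ.le)
    (lifeSpan_critical_decay_lt_top hN hp hα' hα₁ hκ) (by positivity) fun T hT hlife ↦ ?_
  have hlogT : 0 < Real.log T := Real.log_pos hT
  have hconst : (2 * C) ^ p⁻¹ * κ ^ (-((p - 1) / p)) = (2 * C * κ ^ (-(p - 1))) ^ p⁻¹ := by
    rw [Real.mul_rpow (x := 2 * C) (by positivity) (by positivity), ← Real.rpow_mul hκ.le,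
      ← div_eq_mul_inv (-(p - 1)), neg_div]
  rw [hconst, Real.le_rpow_inv_iff_of_pos (by positivity) (by positivity) hp₀, ← div_div,
    rpow_mul_log_rpow hp₀ hT, Real.rpow_neg hκ.le, ← div_eq_mul_inv, le_div_iff₀ (by positivity)]
  calc T ^ ((α - 1) / 2) * Real.log T * Real.log T ^ (p - 1) * κ ^ (p - 1)
      = T ^ ((α - 1) / 2) * Real.log T * (κ * Real.log T) ^ (p - 1) := by
        rw [Real.mul_rpow hκ.le hlogT.le]
        ring
    _ ≤ 2 * min (Real.log T / 2) (1 / (1 - α)) * (κ * Real.log T) ^ (p - 1) := by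
        exact mul_le_mul_of_nonneg_right (rpow_mul_log_le_min hα₁ hT) (by positivity)
    _ ≤ 2 * C := by linarith [hbound α hα hα₁ κ T hκ hT hlife]

end LifeSpan

end TimeFractionalFujita

end

theorem mainTheorem10_general (N : ℕ) (hN : 1 ≤ N) (p A : ℝ)
    (hp : p = TimeFractionalFujita.fujitaExponent N) :
    ((N : ℝ) < A →
      ∃ K : ℝ → ℝ,
        (∀ α : ℝ, 0 < α → α < 1 →
          0 < K α ∧
          ∀ κ : ℝ, 0 < κ → κ < K α →
            TimeFractionalFujita.lifeSpan p α
              (TimeFractionalFujita.decayingDatum N A κ) = ⊤) ∧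
        (∀ α₀ : ℝ, 0 < α₀ →
          ∃ C : ℝ, 0 < C ∧
            ∀ α : ℝ, α₀ ≤ α → α < 1 → ∀ κ : ℝ, K α < κ →
              ∃ T : ℝ, 0 < T ∧
                TimeFractionalFujita.lifeSpan p α
                  (TimeFractionalFujita.decayingDatum N A κ) = ENNReal.ofReal T ∧
                T ^ ((α - 1) / 2) * Real.log T ≤ C * κ ^ (-(p - 1)))) ∧
    (∀ α₀ : ℝ, 0 < α₀ →
      ∃ C : ℝ, 0 < C ∧
        ∀ α : ℝ, α₀ ≤ α → α < 1 → ∀ κ : ℝ, 0 < κ →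
          ∃ T : ℝ, 0 < T ∧
            TimeFractionalFujita.lifeSpan p α
              (TimeFractionalFujita.decayingDatum N N κ) = ENNReal.ofReal T ∧
            T ^ ((α - 1) / (2 * p)) * Real.log T ≤ C * κ ^ (-((p - 1) / p))) := by
  refine ⟨fun hA ↦ ⟨TimeFractionalFujita.criticalSize N p A, fun α hα₀ hα₁ ↦ ⟨?_, ?_⟩, ?_⟩, ?_⟩
  · exact TimeFractionalFujita.criticalSize_pos hN hp hA hα₀ hα₁
  · exact fun κ _ hκ ↦
      TimeFractionalFujita.lifeSpan_eq_top_of_lt_criticalSize hN hp hA hα₀ hα₁ hκ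
  · exact fun α₀ hα₀ ↦ TimeFractionalFujita.exists_rpow_mul_log_lifeSpan_le hN hp hA hα₀
  · exact fun α₀ hα₀ ↦
      TimeFractionalFujita.exists_rpow_mul_log_lifeSpan_critical_decay_le hN hp hα₀

theorem mainTheorem10 (N : ℕ) (hN : 1 ≤ N) (p A : ℝ)
    (hp : p = TimeFractionalFujita.fujitaExponent N) (hA : 2 / (p - 1) ≤ A) :
    ((N : ℝ) < A →
      ∃ K : ℝ → ℝ,
        (∀ α : ℝ, 0 < α → α < 1 →
          0 < K α ∧
          ∀ κ : ℝ, 0 < κ → κ < K α →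
            TimeFractionalFujita.lifeSpan p α
              (TimeFractionalFujita.decayingDatum N A κ) = ⊤) ∧
        (∀ α₀ : ℝ, 0 < α₀ → α₀ < 1 →
          ∃ C : ℝ, 0 < C ∧
            ∀ α : ℝ, α₀ ≤ α → α < 1 → ∀ κ : ℝ, K α < κ →
              ∃ T : ℝ, 0 < T ∧
                TimeFractionalFujita.lifeSpan p α
                  (TimeFractionalFujita.decayingDatum N A κ) = ENNReal.ofReal T ∧
                T ^ ((α - 1) / 2) * Real.log T ≤ C * κ ^ (-(p - 1)))) ∧
    (A = (N : ℝ) →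
      ∀ α₀ : ℝ, 0 < α₀ → α₀ < 1 →
        ∃ C κ₀ : ℝ, 0 < C ∧ 0 < κ₀ ∧
          ∀ α : ℝ, α₀ ≤ α → α < 1 → ∀ κ : ℝ, 0 < κ → κ < κ₀ →
            ∃ T : ℝ, 0 < T ∧
              TimeFractionalFujita.lifeSpan p α
                (TimeFractionalFujita.decayingDatum N A κ) = ENNReal.ofReal T ∧
              T ^ ((α - 1) / (2 * p)) * Real.log T ≤ C * κ ^ (-((p - 1) / p))) := by
  obtain ⟨hfast, hcritical⟩ := mainTheorem10_general N hN p A hp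
  refine ⟨fun hNA ↦ ?_, ?_⟩
  · obtain ⟨K, hK, hlifeSpan⟩ := hfast hNA
    exact ⟨K, hK, fun α₀ hα₀ _ ↦ hlifeSpan α₀ hα₀⟩
  · rintro rfl α₀ hα₀ -
    obtain ⟨C, hC, hlifeSpan⟩ := hcritical α₀ hα₀
    exact ⟨C, 1, hC, one_pos, fun α hα hα₁ κ hκ _ ↦ hlifeSpan α hα hα₁ κ hκ⟩
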